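/- Let $\Sigma$ be a nonempty, Hausdorff, second countable real analytic manifold of dimension $n$, let $U$ be an open neighborhood of $\{0\}\times\Sigma$ in $\mathbb R\times\Sigma$, and let $g=-dt^2+h_t(y)\,dy^2$ be a real analytic Lorentzian metric on $U$, where each $h_t(y)$, $(t,y)\in U$, is a positive definite symmetric form on $T_y\Sigma$. Let $V:U\to\mathbb R$ be real analytic and let $P=-\Box_g+V$ be the Klein-Gordon operator, that is $$P=\partial_t^2+r(t,y)\partial_t+a(t,y,\partial_y),\quad r=|h_t|^{-\frac12}\partial_t|h_t|^{\frac12},\quad a=-|h_t|^{-\frac12}\partial_j|h_t|^{\frac12}h_t^{jk}\partial_k+V,$$ with $|h|=\det h$ in local coordinates. Then $h_t(y)$ and $V(t,y)$ have extensions $h_z(y)$, $V(z,y)$ that are holomorphic in $z$ and jointly real analytic, with $h_z(y)$ nondegenerate, on an open neighborhood $W$ of $\{0\}\times\Sigma$ in $\mathbb C\times\Sigma$. Fix any such extension, so that $r$ and $a$ extend to $W$ by the same formulas (with $|h|^{-1/2}\partial |h|^{1/2}=\frac12|h|^{-1}\partial|h|$), and define the Wick rotated operator $$K=-\partial_s^2-\mathrm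 i\,r(\mathrm is,y)\,\partial_s+a(\mathrm is,y,\partial_y)$$ at the points $(s,y)$ with $(\mathrm is,y)\in W$. For an open set $\Omega\subset\mathbb R\times\Sigma$ contained in $U$ and in $\{(s,y):(\mathrm is,y)\in W\}$, let $L^2(\Omega)$ be the $L^2$ space for the measure $|\hat h_s(y)|^{\frac12}ds\,dy$, where $|\hat h_s|=|\det h_{\mathrm is}|$, with scalar product $(v|u)=\int_\Omega\overline v\,u\,|\hat h_s|^{\frac12}ds\,dy$. Let $H^1_0(\Omega)$ be the closure of $C_c^\infty(\Omega)$ for the norm $$\|u\|_{H^1(\Omega)}^2=\int_\Omega\big(|\partial_su|^2+\partial_j\overline u\,h_0^{jk}\,\partial_ku+|u|^2\big)|h_0|^{\frac12}\,ds\,dy,$$ and let $Q_\Omega(v,u)=(v|Ku)$, $Q_\Omega^*(v,u)=\overline{Q_\Omega(u,v)}$, both with domain $C_c^\infty(\Omega)\subset L^2(\Omega)$. Then every neighborhood of $\{0\}\times\Sigma$ in $\mathbb R\times\Sigma$ contains an open neighborhood $\Omega$ of $\{0\}\times\Sigma$ as above, with smooth boundary, such that: 1. $\Omega$ is invariant under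 $(s,y)\mapsto(-s,y)$; 2. $Q_\Omega$ and $Q_\Omega^*$ are densely defined and closeable on $L^2(\Omega)$; 3. their closures $\overline{Q_\Omega}$ and $\overline{Q_\Omega^*}$ are closed sectorial forms with domain $H^1_0(\Omega)$; 4. the operators $K_\Omega$ and $K_\Omega^*$ associated with $\overline{Q_\Omega}$ and $\overline{Q_\Omega^*}$ (that is, $u\in\mathrm{Dom}\,K_\Omega$ and $K_\Omega u=w$ if and only if $u\in H^1_0(\Omega)$ and $\overline{Q_\Omega}(v,u)=(v|w)$ for all $v\in H^1_0(\Omega)$, and likewise for $K_\Omega^*$) are closed and densely defined, and $0$ lies in the resolvent sets of both; 5. $K_\Omega^*$ is the Hilbert space adjoint of $K_\Omega$. -/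

import Mathlib

open Set Filter Topology MeasureTheory
open scoped ContDiff Manifold ENNReal ComplexConjugate

noncomputable section

namespace WickRotation

/-! ## Unbounded sesquilinear forms on a Hilbert space -/

section Forms

variable {H : Type*} [NormedAddCommGroup H] [InnerProductSpace ℂ H]

variable (H) in
/-- A sesquilinear form on a complex Hilbert space, defined on a linear subspace, antilinear in
its first and linear in its second argument. -/
structure SesqForm where
  domain : Submodule ℂ H
  form : domain →ₗ⋆[ℂ] domain →ₗ[ℂ] ℂ

namespace SesqForm

/-- The adjoint form `Q*(v, u) = conj (Q(u, v))`, with the same domain. -/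
def adjoint (Q : SesqForm H) : SesqForm H where
  domain := Q.domain
  form := LinearMap.mk₂'ₛₗ (starRingEnd ℂ) (RingHom.id ℂ) (fun v u => conj (Q.form u v))
    (by intros; simp) (by intros; simp) (by intros; simp) (by intros; simp)

/-- The numerical range lies in a sector `|arg (ζ - γ)| ≤ θ` with `θ < π / 2`. -/
def IsSectorial (Q : SesqForm H) : Prop :=
  ∃ γ θ : ℝ, 0 ≤ θ ∧ θ < Real.pi / 2 ∧
    ∀ u : Q.domain, ‖(u : H)‖ = 1 → |Complex.arg (Q.form u u - (γ : ℂ))| ≤ θ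

/-- `Q`-convergence of a sequence of the form domain to `f`: it converges to `f` in the Hilbert
space and `Q[u_m - u_n] → 0`. -/
def FormTendsto (Q : SesqForm H) (u : ℕ → Q.domain) (f : H) : Prop :=
  Tendsto (fun k => (u k : H)) atTop (𝓝 f) ∧
  Tendsto (fun p : ℕ × ℕ => Q.form (u p.1 - u p.2) (u p.1 - u p.2)) atTop (𝓝 0)

/-- Closed form: `Q`-limits belong to the domain, and `Q[u_k - f] → 0`. -/
def IsClosed (Q : SesqForm H) : Prop :=
  ∀ (u : ℕ → Q.domain) (f : H), Q.FormTendsto u f →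
    ∃ hf : f ∈ Q.domain,
      Tendsto (fun k => Q.form (u k - ⟨f, hf⟩) (u k - ⟨f, hf⟩)) atTop (𝓝 0)

/-- Closeable form: `Q[u_k] → 0` whenever `u_k` is `Q`-convergent to `0`. -/
def IsCloseable (Q : SesqForm H) : Prop :=
  ∀ u : ℕ → Q.domain, Q.FormTendsto u 0 → Tendsto (fun k => Q.form (u k) (u k)) atTop (𝓝 0)

/-- `Qc` is the closure of `Q`: its domain consists of all `Q`-limits, and its values are the
limits of the values of `Q` along `Q`-convergent sequences. -/
def IsClosure (Q Qc : SesqForm H) : Prop :=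
  (∀ f : H, f ∈ Qc.domain ↔ ∃ u : ℕ → Q.domain, Q.FormTendsto u f) ∧
  ∀ (v u : ℕ → Q.domain) (g f : Qc.domain),
    Q.FormTendsto v (g : H) → Q.FormTendsto u (f : H) →
      Tendsto (fun k => Q.form (v k) (u k)) atTop (𝓝 (Qc.form g f))

/-- `T` is the operator associated with `Q`: `u ∈ Dom T` and `T u = w` if and only if
`u ∈ Dom Q` and `Q(v, u) = (v | w)` for all `v ∈ Dom Q`. -/
def IsAssociated (Q : SesqForm H) (T : H →ₗ.[ℂ] H) : Prop :=
  ∀ u w : H, (u, w) ∈ T.graph ↔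
    ∃ hu : u ∈ Q.domain, ∀ v : Q.domain, Q.form v ⟨u, hu⟩ = inner ℂ (v : H) w

end SesqForm

/-- The resolvent set of an unbounded operator: `T - z` is a bijection from `Dom T` onto the
Hilbert space, with bounded inverse `R`. -/
def resolventSet (T : H →ₗ.[ℂ] H) : Set ℂ :=
  {z | ∃ R : H →L[ℂ] H,
    (∀ f : H, ∃ hf : R f ∈ T.domain, T ⟨R f, hf⟩ - z • R f = f) ∧
    ∀ u : T.domain, R (T u - z • (u : H)) = u}

end Forms

/-! ## Coordinates -/

/-- The coordinate space of an `n`-dimensional manifold. -/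
abbrev Coord (n : ℕ) : Type := EuclideanSpace ℝ (Fin n)

section Geometry

variable {n : ℕ} {S : Type*} [TopologicalSpace S] [ChartedSpace (Coord n) S]

/-- The `j`-th standard basis vector of the coordinate space. -/
def stdVec (j : Fin n) : Coord n := EuclideanSpace.single j (1 : ℝ)

/-- The chart around `c`, with values in the coordinate space. -/
abbrev chart (c : S) : PartialEquiv S (Coord n) := extChartAt (𝓡 n) c

/-- The coordinate vector field `∂_j` of the chart around `c`, at the point with coordinates
`x`. -/
def coordVec (c : S) (x : Coord n) (j : Fin n) : TangentSpace (𝓡 n) ((chart c).symm x) :=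
  mfderiv 𝓘(ℝ, Coord n) (𝓡 n) (chart (n := n) c).symm x (stdVec j)

/-- The matrix of components `b(∂_j, ∂_k)`, in the chart around `c`, of a field `b` of bilinear
forms on the tangent spaces, with values in `F` (here `ℝ` or `ℂ`). A `ℂ`-valued real-bilinear form
on a tangent space is the same as a complex-bilinear form on its complexification. -/
def gram {F : Type*} [AddCommGroup F] [Module ℝ F]
    (b : ∀ y : S, TangentSpace (𝓡 n) y →ₗ[ℝ] TangentSpace (𝓡 n) y →ₗ[ℝ] F)
    (c : S) (x : Coord n) : Matrix (Fin n) (Fin n) F :=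
  fun j k => b ((chart c).symm x) (coordVec c x j) (coordVec c x k)

/-! ## The Lorentzian data and its Wick rotation -/

variable (n S) in
/-- A real analytic Lorentzian metric `-dt² + h_t(y) dy²` in Gaussian normal coordinates, on an
open neighborhood `dom` of `{0} × S` in `ℝ × S`, with a real analytic real-valued potential. -/
structure AnalyticKGData where
  dom : Set (ℝ × S)
  isOpen_dom : IsOpen dom
  zero_mem : ∀ y : S, ((0 : ℝ), y) ∈ dom
  metric : ℝ → ∀ y : S, TangentSpace (𝓡 n) y →ₗ[ℝ] TangentSpace (𝓡 n) y →ₗ[ℝ] ℝ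
  metric_symm : ∀ t y, (t, y) ∈ dom → ∀ v w, metric t y v w = metric t y w v
  metric_pos : ∀ t y, (t, y) ∈ dom → ∀ v, v ≠ 0 → 0 < metric t y v v
  metric_analytic : ∀ (c : S) (j k : Fin n),
    AnalyticOnNhd ℝ (fun p : ℝ × Coord n => gram (metric p.1) c p.2 j k)
      {p | p.2 ∈ (chart (n := n) c).target ∧ (p.1, (chart c).symm p.2) ∈ dom}
  potential : ℝ × S → ℝ
  potential_analytic : ContMDiffOn (𝓘(ℝ, ℝ).prod (𝓡 n)) 𝓘(ℝ, ℝ) ω potential dom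

/-- An extension of `h_t(y)` and of the potential, holomorphic in `t`, to an open neighborhood
`dom` of `{0} × S` in `ℂ × S` on which the extended `h_z(y)` is nondegenerate. -/
structure HolExtension (G : AnalyticKGData n S) where
  dom : Set (ℂ × S)
  isOpen_dom : IsOpen dom
  zero_mem : ∀ y : S, ((0 : ℂ), y) ∈ dom
  metric : ℂ → ∀ y : S, TangentSpace (𝓡 n) y →ₗ[ℝ] TangentSpace (𝓡 n) y →ₗ[ℝ] ℂ
  metric_holomorphic : ∀ (y : S) (v w : TangentSpace (𝓡 n) y),
    DifferentiableOn ℂ (fun z => metric z y v w) {z | (z, y) ∈ dom}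
  metric_analytic : ∀ (c : S) (j k : Fin n),
    AnalyticOnNhd ℝ (fun p : ℂ × Coord n => gram (metric p.1) c p.2 j k)
      {p | p.2 ∈ (chart (n := n) c).target ∧ (p.1, (chart c).symm p.2) ∈ dom}
  metric_extends : ∀ (t : ℝ) (y : S), (t, y) ∈ G.dom → ((t : ℂ), y) ∈ dom →
    ∀ v w, metric (t : ℂ) y v w = (G.metric t y v w : ℂ)
  metric_nondegenerate : ∀ z y, (z, y) ∈ dom → (gram (metric z) y (chart y y)).det ≠ 0
  potential : ℂ × S → ℂ
  potential_holomorphic : ∀ y : S,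
    DifferentiableOn ℂ (fun z => potential (z, y)) {z | (z, y) ∈ dom}
  potential_analytic : ContMDiffOn (𝓘(ℝ, ℂ).prod (𝓡 n)) 𝓘(ℝ, ℂ) ω potential dom
  potential_extends : ∀ (t : ℝ) (y : S), (t, y) ∈ G.dom → ((t : ℂ), y) ∈ dom →
    potential ((t : ℂ), y) = (G.potential (t, y) : ℂ)

variable {G : AnalyticKGData n S}

namespace HolExtension

/-- The points `(s, y)` for which `(i s, y)` lies in the domain of the extension. -/
def wickDom (W : HolExtension G) : Set (ℝ × S) := {p | (Complex.I * (p.1 : ℂ), p.2) ∈ W.dom}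

/-- `r(z, y) = |h|^{-1/2} ∂_z |h|^{1/2} = (1/2) |h|⁻¹ ∂_z |h|`, where `|h| = det h_z(y)` in
coordinates. -/
def coeffR (W : HolExtension G) (z : ℂ) (y : S) : ℂ :=
  1 / 2 * (gram (W.metric z) y (chart y y)).det⁻¹ *
    deriv (fun z' : ℂ => (gram (W.metric z') y (chart y y)).det) z

/-- `a(z, y, ∂_y) f = - |h|^{-1/2} ∂_j (|h|^{1/2} h^{jk} ∂_k f) + V f`, where `h = h_z(y)`,
`V = V(z, y)`, evaluated at `y` in the coordinates of the chart around `y`. The first term is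
written without square roots, as
`|h|^{-1/2} ∂_j (|h|^{1/2} X) = ∂_j X + (1/2) |h|⁻¹ (∂_j |h|) X`. -/
def opA (W : HolExtension G) (z : ℂ) (f : S → ℂ) (y : S) : ℂ :=
  - (∑ j : Fin n, ∑ k : Fin n,
      (fderiv ℝ (fun x : Coord n => (gram (W.metric z) y x)⁻¹ j k *
          fderiv ℝ (fun x' => f ((chart y).symm x')) x (stdVec k)) (chart y y) (stdVec j)
        + 1 / 2 * (gram (W.metric z) y (chart y y)).det⁻¹ *
          fderiv ℝ (fun x : Coord n => (gram (W.metric z) y x).det) (chart y y) (stdVec j) *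
          ((gram (W.metric z) y (chart y y))⁻¹ j k *
            fderiv ℝ (fun x' => f ((chart y).symm x')) (chart y y) (stdVec k))))
  + W.potential (z, y) * f y

/-- The Wick rotated operator `K = -∂_s² - i r(i s, y) ∂_s + a(i s, y, ∂_y)`. -/
def opK (W : HolExtension G) (u : ℝ × S → ℂ) (p : ℝ × S) : ℂ :=
  - iteratedDeriv 2 (fun s : ℝ => u (s, p.2)) p.1
  - Complex.I * W.coeffR (Complex.I * (p.1 : ℂ)) p.2 * deriv (fun s : ℝ => u (s, p.2)) p.1
  + W.opA (Complex.I * (p.1 : ℂ)) (fun y => u (p.1, y)) p.2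

end HolExtension

/-! ## Measures, function spaces, domains -/

/-- A sequence of points whose chart domains cover the manifold. -/
theorem exists_chart_cover (n : ℕ) (S : Type*) [TopologicalSpace S] [ChartedSpace (Coord n) S]
    [SecondCountableTopology S] [Nonempty S] :
    ∃ c : ℕ → S, ⋃ i, (chart (n := n) (c i)).source = univ := by
  obtain ⟨s, hs, hu⟩ := TopologicalSpace.countable_cover_nhds
    (f := fun x : S => (chart (n := n) x).source) (fun x => extChartAt_source_mem_nhds x)
  have hne : s.Nonempty := by
    by_contra h
    rw [Set.not_nonempty_iff_eq_empty] at h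
    subst h
    obtain ⟨x⟩ := (inferInstance : Nonempty S)
    have hx : x ∈ (univ : Set S) := mem_univ x
    rw [← hu] at hx
    simp at hx
  obtain ⟨c, rfl⟩ := hs.exists_eq_range hne
  exact ⟨c, by simpa [Set.biUnion_range] using hu⟩

variable [MeasurableSpace S] [SecondCountableTopology S] [Nonempty S]

/-- The measure on `ℝ × S` that is `ρ c (s, x) ds dx` in the coordinates `x` of the chart around
`c`, for densities `ρ c` that transform as densities do under a change of charts: it is glued from
the disjoint pieces of a countable cover by chart domains. -/
def densityMeasure (ρ : S → ℝ × Coord n → ℝ≥0∞) : Measure (ℝ × S) :=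
  let c : ℕ → S := (exists_chart_cover n S).choose
  Measure.sum fun i : ℕ =>
    Measure.map (fun p : ℝ × Coord n => (p.1, (chart (c i)).symm p.2))
      (((volume : Measure (ℝ × Coord n)).restrict
        {p | p.2 ∈ (chart (n := n) (c i)).target ∧
          ∀ j < i, (chart (c i)).symm p.2 ∉ (chart (n := n) (c j)).source}).withDensity (ρ (c i)))

/-- The measure `|h_0|^{1/2} ds dy`. -/
def measure0 (G : AnalyticKGData n S) : Measure (ℝ × S) :=
  densityMeasure fun c p => ENNReal.ofReal (Real.sqrt (gram (G.metric 0) c p.2).det)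

/-- The measure `|ĥ_s|^{1/2} ds dy`, `ĥ_s = (h_{is}* h_{is})^{1/2}`; the determinant of `ĥ_s` is
the modulus of that of `h_{is}`. -/
def wickMeasure (W : HolExtension G) : Measure (ℝ × S) :=
  densityMeasure fun c p =>
    ENNReal.ofReal (Real.sqrt ‖(gram (W.metric (Complex.I * (p.1 : ℂ))) c p.2).det‖)

/-- The Hilbert space `L²(Ω, |ĥ_s|^{1/2} ds dy)`. -/
abbrev L2 (W : HolExtension G) (Ω : Set (ℝ × S)) : Type _ :=
  Lp ℂ 2 ((wickMeasure W).restrict Ω)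

/-- The test functions `C_c^∞(Ω)`, as functions on `ℝ × S`. -/
def TestFn (n : ℕ) {S : Type*} [TopologicalSpace S] [ChartedSpace (Coord n) S]
    (Ω : Set (ℝ × S)) : Set (ℝ × S → ℂ) :=
  {u | ContMDiff (𝓘(ℝ, ℝ).prod (𝓡 n)) 𝓘(ℝ, ℂ) ∞ u ∧ HasCompactSupport u ∧ tsupport u ⊆ Ω}

/-- The pointwise integrand `|∂_s u|² + ∂_j ū h_0^{jk} ∂_k u + |u|²` of the `H¹` norm. -/
def h1Density (G : AnalyticKGData n S) (u : ℝ × S → ℂ) (p : ℝ × S) : ℝ :=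
  ‖deriv (fun s : ℝ => u (s, p.2)) p.1‖ ^ 2
  + (∑ j : Fin n, ∑ k : Fin n,
      conj (fderiv ℝ (fun x => u (p.1, (chart p.2).symm x)) (chart p.2 p.2) (stdVec j)) *
      (((gram (G.metric 0) p.2 (chart p.2 p.2))⁻¹ j k : ℝ) : ℂ) *
      fderiv ℝ (fun x => u (p.1, (chart p.2).symm x)) (chart p.2 p.2) (stdVec k)).re
  + ‖u p‖ ^ 2

/-- The square of the norm of `H¹(Ω)`. -/
def h1NormSq (G : AnalyticKGData n S) (Ω : Set (ℝ × S)) (u : ℝ × S → ℂ) : ℝ≥0∞ :=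
  ∫⁻ p in Ω, ENNReal.ofReal (h1Density G u p) ∂(measure0 G)

/-- `H¹_0(Ω)`, the closure of `C_c^∞(Ω)` for the `H¹` norm, as a set of elements of
`L²(Ω, |ĥ_s|^{1/2} ds dy)`: the `L²(Ω, |h_0|^{1/2} ds dy)` limits of sequences of test functions
that are Cauchy for the `H¹` norm. -/
def H10 (W : HolExtension G) (Ω : Set (ℝ × S)) : Set (L2 W Ω) :=
  {f | ∃ u : ℕ → ℝ × S → ℂ, (∀ k, u k ∈ TestFn n Ω) ∧
    Tendsto (fun q : ℕ × ℕ => h1NormSq G Ω (u q.1 - u q.2)) atTop (𝓝 0) ∧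
    Tendsto (fun k => eLpNorm (fun p => u k p - f p) 2 ((measure0 G).restrict Ω)) atTop (𝓝 0)}

/-- `Q` is the form `Q_Ω(v, u) = (v | K u)` on `L²(Ω)` with domain `C_c^∞(Ω)` (the integrals that
define it are required to converge). -/
def IsDirichletForm (W : HolExtension G) (Ω : Set (ℝ × S)) (Q : SesqForm (L2 W Ω)) : Prop :=
  (∀ u ∈ TestFn n Ω, MemLp u 2 ((wickMeasure W).restrict Ω)) ∧
  (∀ f : L2 W Ω, f ∈ Q.domain ↔ ∃ u ∈ TestFn n Ω, f =ᵐ[(wickMeasure W).restrict Ω] u) ∧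
  ∀ g f : Q.domain, ∀ v ∈ TestFn n Ω, ∀ u ∈ TestFn n Ω,
    (g : L2 W Ω) =ᵐ[(wickMeasure W).restrict Ω] v →
    (f : L2 W Ω) =ᵐ[(wickMeasure W).restrict Ω] u →
      Integrable (fun p => conj (v p) * W.opK u p) ((wickMeasure W).restrict Ω) ∧
      Q.form g f = ∫ p in Ω, conj (v p) * W.opK u p ∂(wickMeasure W)

/-- `Ω` has a smooth boundary: near each boundary point it is the set `{ρ < 0}` for a smooth real
function `ρ` with nonvanishing differential at that point. -/
def HasSmoothBoundary (n : ℕ) {S : Type*} [TopologicalSpace S] [ChartedSpace (Coord n) S]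
    (Ω : Set (ℝ × S)) : Prop :=
  ∀ p ∈ frontier Ω, ∃ (N : Set (ℝ × S)) (ρ : ℝ × S → ℝ), IsOpen N ∧ p ∈ N ∧
    ContMDiffOn (𝓘(ℝ, ℝ).prod (𝓡 n)) 𝓘(ℝ, ℝ) ∞ ρ N ∧
    mfderiv (𝓘(ℝ, ℝ).prod (𝓡 n)) 𝓘(ℝ, ℝ) ρ p ≠ 0 ∧
    ∀ q ∈ N, q ∈ Ω ↔ ρ q < 0

end Geometry

end WickRotation

end

noncomputable section

set_option linter.unusedSectionVars false

namespace WickRotation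

/-! In a thin tube around {0} × Σ the operator K is a small perturbation of the Laplacian of ds² +
h_0, and the Dirichlet condition on a thin tube gives a Poincaré inequality strong enough to absorb
all lower order terms. The domain is Ω = {|s| < ε(y)} with ε smooth, positive, and as small as each
y demands. Neither compactness of Σ nor a lower bound on ε is needed, because the estimates carry
the weight ε(y)⁻².

Energy identity. K is in divergence form for the complex density (det h_{is})^{1/2}, while L² uses
its modulus. Integrating by parts therefore turns (v | K u) into the integral of a first order
energy density with the correction -(i/2) v̄ times a contraction of Im d log det h_{is} with du
(`locE_sub_locK`, `integral_locK_eq`, `integral_opK_eq`). This density is chart independent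
(`locE_idProd`). Independence of K itself from the chart, and its linearity, follow by testing
against all test functions rather than by transforming second derivatives.

Coercivity. At s = 0 the metric is real and positive, so near s = 0 the energy differs from the
kinetic density `kin` by at most kin/4 + B(y)|u|² (`norm_locE_sub_le`, `exists_local_bound`). The
measure |h_0|^{1/2} ds dy does not depend on s, so ∂_s(ε⁻² s|u|²) integrates to zero, which gives ∫
ε⁻²|u|² ≤ 4 ∫ kin (`poincare`). If B ≤ ε⁻²/64, then ∫ kin / 4 ≤ Re Q[u] and |Q[u]| ≤ 3 ∫ kin
(`energy_estimate`). Hence Q is sectorial and coercive, and its form norm is equivalent to the H¹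
norm, so the closure has domain H¹_0 (`isClosure_domain_eq_H10`).

Abstract part. In the completion V of the domain for Re Q, the form is (x | A x) with A bounded and
Re (x | A x) = ‖x‖² (`SesqForm.exists_representation`). The induced map J : V → H is injective
because Q comes from an operator on a dense domain; this is closeability. By Lax–Milgram A is
invertible, K is the inverse of R = J A⁻¹ J*, and K* is the inverse of R*
(`SesqForm.closure_of_coercive`, `exists_inverse_pair`).

Existence of the extension. The Taylor series in (t, x) is complexified and then restricted to real
x. On discs around t = 0 the result is unique by the identity theorem, so the local extensions agree
automatically (`nonempty_holExtension`). -/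

/-! ### Abstract theory: coercive sectorial forms, their closures and operators. -/

/-- The completion of an inner product on a complex vector space. -/
theorem exists_hilbert_completion.{u} {D : Type u} [AddCommGroup D] [Module ℂ D]
    (c : InnerProductSpace.Core ℂ D) :
    ∃ (V : Type u) (_ : NormedAddCommGroup V) (_ : InnerProductSpace ℂ V) (_ : CompleteSpace V)
      (e : D →ₗ[ℂ] V), DenseRange e ∧ ∀ v u : D, inner ℂ (e v) (e u) = c.inner v u := by
  let i1 : NormedAddCommGroup D := c.toNormedAddCommGroup
  let i2 : InnerProductSpace ℂ D := InnerProductSpace.ofCore c.toCore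
  refine ⟨UniformSpace.Completion D, inferInstance, inferInstance, inferInstance,
    (UniformSpace.Completion.toComplL (𝕜 := ℂ) (E := D)).toLinearMap,
    UniformSpace.Completion.denseRange_coe, fun v u => ?_⟩
  exact UniformSpace.Completion.inner_coe (𝕜 := ℂ) v u

namespace SesqForm

variable {H : Type*} [NormedAddCommGroup H] [InnerProductSpace ℂ H]

theorem tendsto_conj_zero {α : Type*} {l : Filter α} {f : α → ℂ} (h : Tendsto f l (𝓝 0)) :
    Tendsto (fun x => conj (f x)) l (𝓝 0) := by
  have := (Complex.continuous_conj.tendsto 0).comp h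
  rwa [map_zero] at this

/-- The quadratic forms of Q and Q* are complex conjugates, so they define the same convergence;
this transfers closeability, closedness and closures from Q to Q*. -/
theorem formTendsto_adjoint (Q : SesqForm H) (u : ℕ → Q.domain) (f : H) :
    Q.adjoint.FormTendsto u f ↔ Q.FormTendsto u f := by
  refine and_congr Iff.rfl ⟨fun h => ?_, fun h => tendsto_conj_zero h⟩
  exact (tendsto_conj_zero h).congr fun p => Complex.conj_conj _

theorem IsCloseable.adjoint {Q : SesqForm H} (h : Q.IsCloseable) : Q.adjoint.IsCloseable :=
  fun u hu => tendsto_conj_zero (h u ((Q.formTendsto_adjoint u 0).1 hu))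

theorem IsClosed.adjoint {Q : SesqForm H} (h : Q.IsClosed) : Q.adjoint.IsClosed := by
  intro u f hu
  obtain ⟨hf, ht⟩ := h u f ((Q.formTendsto_adjoint u f).1 hu)
  exact ⟨hf, tendsto_conj_zero ht⟩

theorem IsClosure.adjoint {Q Qc : SesqForm H} (h : Q.IsClosure Qc) :
    Q.adjoint.IsClosure Qc.adjoint := by
  refine ⟨fun f => (h.1 f).trans (exists_congr fun u => (Q.formTendsto_adjoint u f).symm), ?_⟩
  intro v u g f hv hu
  have := h.2 u v f g ((Q.formTendsto_adjoint u f).1 hu) ((Q.formTendsto_adjoint v g).1 hv)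
  exact (Complex.continuous_conj.tendsto _).comp this

/-- For z ≠ 0, cos (arg z) = Re z / |z| ≥ 1/M, and arccos is decreasing. At z = 0 the convention arg
0 = 0 applies. -/
theorem abs_arg_le_arccos {z : ℂ} {M : ℝ} (hM : 1 ≤ M) (h : ‖z‖ ≤ M * z.re) :
    |z.arg| ≤ Real.arccos (1 / M) := by
  by_cases hz : z = 0
  · simp [hz, Real.arccos_nonneg]
  have hn : 0 < ‖z‖ := norm_pos_iff.2 hz
  have hc : 1 / M ≤ Real.cos |z.arg| := by
    rw [Real.cos_abs, Complex.cos_arg hz, div_le_div_iff₀ (by linarith) hn]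
    linarith
  rw [← Real.arccos_cos (abs_nonneg _) (Complex.abs_arg_le_pi z)]
  exact Real.arccos_le_arccos hc

theorem isSectorial_of_norm_le {Q : SesqForm H} {M : ℝ} (hM : 1 ≤ M)
    (h : ∀ u, ‖Q.form u u‖ ≤ M * (Q.form u u).re) : Q.IsSectorial := by
  refine ⟨0, Real.arccos (1 / M), Real.arccos_nonneg _, ?_, fun u _ => ?_⟩
  · rw [Real.arccos_lt_pi_div_two]
    positivity
  · rw [Complex.ofReal_zero, sub_zero]
    exact abs_arg_le_arccos hM (h u)

end SesqForm

/-- The inverse of an injective bounded operator with injective adjoint, as an unbounded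
operator. -/
theorem exists_inverse_pair {H : Type*} [NormedAddCommGroup H] [InnerProductSpace ℂ H]
    [CompleteSpace H] (R : H →L[ℂ] H) (hR : Function.Injective R)
    (hR' : Function.Injective (ContinuousLinearMap.adjoint R)) :
    ∃ K K' : H →ₗ.[ℂ] H, (∀ u w, (u, w) ∈ K.graph ↔ R w = u) ∧
      (∀ u w, (u, w) ∈ K'.graph ↔ ContinuousLinearMap.adjoint R w = u) ∧
      Dense (K.domain : Set H) ∧ Dense (K'.domain : Set H) ∧ K.IsClosed ∧ K'.IsClosed ∧
      (0 : ℂ) ∈ resolventSet K ∧ (0 : ℂ) ∈ resolventSet K' ∧ K.adjoint = K' := by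
  have main : ∀ R : H →L[ℂ] H, Function.Injective R →
      Function.Injective (ContinuousLinearMap.adjoint R) →
      ∃ K : H →ₗ.[ℂ] H, (∀ u w, (u, w) ∈ K.graph ↔ R w = u) ∧
      Dense (K.domain : Set H) ∧ K.IsClosed ∧ (0 : ℂ) ∈ resolventSet K := by
    intro R hR hR'
    set T : H →ₗ.[ℂ] H := R.toLinearMap.toPMap ⊤ with hT
    have hker : LinearMap.ker T.toFun = ⊥ := by
      rw [LinearMap.ker_eq_bot']
      intro m hm
      have : R (m : H) = R 0 := by rw [map_zero]; exact hm
      exact Subtype.ext (hR this)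
    have hg : ∀ u w, (u, w) ∈ T.inverse.graph ↔ R w = u := by
      intro u w
      rw [LinearPMap.inverse_graph hker]
      simp [hT, LinearPMap.mem_graph_iff]
    have hdom : ∀ u, u ∈ T.inverse.domain ↔ ∃ w, R w = u := by
      intro u
      rw [LinearPMap.mem_domain_iff]
      simp only [hg]
    refine ⟨T.inverse, hg, ?_, ?_, ?_⟩
    -- The domain of the inverse is the range of R, whose orthogonal complement is the kernel of R*.
    · rw [Submodule.dense_iff_topologicalClosure_eq_top,
        Submodule.topologicalClosure_eq_top_iff, Submodule.eq_bot_iff]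
      intro x hx
      apply hR'
      rw [map_zero]
      refine ext_inner_left ℂ fun w => ?_
      rw [ContinuousLinearMap.adjoint_inner_right, inner_zero_right]
      exact (Submodule.mem_orthogonal _ _).1 hx _ ((hdom _).2 ⟨w, rfl⟩)
    · have : (T.inverse.graph : Set (H × H)) = {p | R p.2 = p.1} := by
        ext ⟨u, w⟩
        exact hg u w
      rw [LinearPMap.IsClosed, this]
      exact isClosed_eq (R.continuous.comp continuous_snd) continuous_fst
    · refine ⟨R, fun f => ?_, fun u => ?_⟩
      · have h1 : (R f, f) ∈ T.inverse.graph := (hg _ _).2 rfl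
        obtain ⟨⟨y, hy⟩, h2, h3⟩ := (LinearPMap.mem_graph_iff _).1 h1
        simp only at h2 h3
        subst h2
        exact ⟨hy, by rw [h3]; simp⟩
      · rw [zero_smul, sub_zero]
        exact (hg _ _).1 (T.inverse.mem_graph u)
  obtain ⟨K, hK, hd, hc, hr⟩ := main R hR hR'
  obtain ⟨K', hK', hd', hc', hr'⟩ := main (ContinuousLinearMap.adjoint R) hR'
    (by rwa [ContinuousLinearMap.adjoint_adjoint])
  refine ⟨K, K', hK, hK', hd, hd', hc, hc', hr, hr', ?_⟩
  apply LinearPMap.eq_of_eq_graph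
  -- The graph of K is {(R w, w)}, so (x, y) lies in the graph of K* exactly when (R w | y) = (w |
  -- x) for all w, that is, x = R* y.
  rw [LinearPMap.adjoint_graph_eq_graph_adjoint hd]
  ext ⟨x, y⟩
  rw [Submodule.mem_adjoint_iff, hK']
  constructor
  · intro h
    refine ext_inner_left ℂ fun w => ?_
    rw [ContinuousLinearMap.adjoint_inner_right]
    exact (sub_eq_zero.1 (h (R w) w ((hK _ _).2 rfl))).symm
  · rintro rfl a b hab
    rw [hK] at hab
    subst hab
    rw [ContinuousLinearMap.adjoint_inner_right, sub_self]

/-- A bound on the quadratic form bounds the sesquilinear form. -/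
theorem norm_sesq_le {D : Type*} [AddCommGroup D] [Module ℂ D] (B : D →ₗ⋆[ℂ] D →ₗ[ℂ] ℂ)
    (N : D → ℝ) (hN0 : ∀ v, 0 < N v ∨ v = 0) (hNs : ∀ (r : ℂ) v, N (r • v) = ‖r‖ * N v)
    (hpar : ∀ v u, N (v + u) ^ 2 + N (v - u) ^ 2 = 2 * (N v ^ 2 + N u ^ 2)) {M : ℝ}
    (h : ∀ u, ‖B u u‖ ≤ M * N u ^ 2) (v u : D) : ‖B v u‖ ≤ 2 * M * (N v * N u) := by
  -- Polarization, combined with the parallelogram law, first gives the inhomogeneous bound M (N(v)²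
  -- + N(u)²).
  have hpol : ∀ v u, 4 * B v u = B (v + u) (v + u) - B (v - u) (v - u)
      - Complex.I * B (v + Complex.I • u) (v + Complex.I • u)
      + Complex.I * B (v - Complex.I • u) (v - Complex.I • u) := by
    intro v u
    simp only [map_add, map_sub, map_smulₛₗ, LinearMap.add_apply, LinearMap.sub_apply,
      LinearMap.smul_apply, smul_eq_mul, Complex.conj_I, RingHom.id_apply]
    linear_combination (2 * B v u - 2 * B u v) * Complex.I_sq
  have hsum : ∀ v u, ‖B v u‖ ≤ M * (N v ^ 2 + N u ^ 2) := by
    intro v u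
    have h4 : ‖4 * B v u‖ ≤ ‖B (v + u) (v + u)‖ + ‖B (v - u) (v - u)‖
        + ‖B (v + Complex.I • u) (v + Complex.I • u)‖
        + ‖B (v - Complex.I • u) (v - Complex.I • u)‖ := by
      rw [hpol]
      refine (norm_add_le _ _).trans (add_le_add ((norm_sub_le _ _).trans
        (add_le_add (norm_sub_le _ _) ?_)) ?_) <;> simp
    have hI : N (Complex.I • u) = N u := by rw [hNs]; simp
    have p1 := hpar v u
    have p2 := hpar v (Complex.I • u)
    rw [hI] at p2
    rw [norm_mul, Complex.norm_ofNat] at h4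
    have e := h (v + u)
    have e1 := h (v - u)
    have e2 := h (v + Complex.I • u)
    have e3 := h (v - Complex.I • u)
    linear_combination (h4 + e + e1 + e2 + e3 + M * p1 + M * p2) / 4
  rcases hN0 v with hv | rfl
  swap
  · have : N (0 : D) = 0 := by simpa using hNs 0 0
    simp [this]
  rcases hN0 u with hu | rfl
  swap
  · have : N (0 : D) = 0 := by simpa using hNs 0 0
    simp [this]
  -- Normalizing both arguments to N = 1 turns the sum of squares into the product N(v) N(u).
  have h5 := hsum (((N v)⁻¹ : ℂ) • v) (((N u)⁻¹ : ℂ) • u)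
  rw [hNs, hNs] at h5
  simp only [map_smulₛₗ, LinearMap.smul_apply, smul_eq_mul, RingHom.id_apply, norm_mul, norm_inv,
    Complex.norm_real, Real.norm_eq_abs, abs_of_pos hv, abs_of_pos hu, map_inv₀,
    Complex.conj_ofReal, inv_mul_cancel₀ hv.ne', inv_mul_cancel₀ hu.ne'] at h5
  have h6 : ‖B v u‖ = (N v * N u) * ((N v)⁻¹ * ((N u)⁻¹ * ‖B v u‖)) := by
    field_simp
  rw [h6]
  calc _ ≤ (N v * N u) * (M * (1 ^ 2 + 1 ^ 2)) := by
        refine mul_le_mul_of_nonneg_left ?_ (mul_pos hv hu).le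
        linarith
    _ = _ := by ring

/-- The inner product `(Q(v, u) + conj Q(u, v)) / 2` of a strictly accretive form. -/
@[reducible] def SesqForm.realPartCore {H : Type*} [NormedAddCommGroup H] [InnerProductSpace ℂ H]
    (Q : SesqForm H) (h : ∀ u : Q.domain, 0 ≤ (Q.form u u).re)
    (h' : ∀ u : Q.domain, (Q.form u u).re = 0 → u = 0) : InnerProductSpace.Core ℂ Q.domain where
  inner v u := (Q.form v u + conj (Q.form u v)) / 2
  conj_inner_symm v u := by simp [add_comm, map_ofNat (starRingEnd ℂ) 2]
  re_inner_nonneg u := by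
    have : (Q.form u u + conj (Q.form u u)) / 2 = (((Q.form u u).re : ℝ) : ℂ) := by
      rw [Complex.add_conj]; push_cast; ring
    rw [this]; exact h u
  add_left u v w := by simp; ring
  smul_left u v r := by simp; ring
  definite u hu := by
    have : (Q.form u u + conj (Q.form u u)) / 2 = (((Q.form u u).re : ℝ) : ℂ) := by
      rw [Complex.add_conj]; push_cast; ring
    refine h' u ?_
    rw [this] at hu
    exact_mod_cast hu

/-- A densely defined form given by an operator is represented in a Hilbert space `V` as soon as it
is coercive and its numerical range lies in a sector. -/
theorem SesqForm.exists_representation.{u} {H : Type u} [NormedAddCommGroup H]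
    [InnerProductSpace ℂ H] [CompleteSpace H] (Q : SesqForm H) (K₀ : Q.domain → H)
    (hK : ∀ v u, Q.form v u = inner ℂ (v : H) (K₀ u)) {a M : ℝ} (ha : 0 < a)
    (h1 : ∀ u : Q.domain, a * ‖(u : H)‖ ^ 2 ≤ (Q.form u u).re)
    (h2 : ∀ u, ‖Q.form u u‖ ≤ M * (Q.form u u).re) :
    ∃ (V : Type u) (_ : NormedAddCommGroup V) (_ : InnerProductSpace ℂ V) (_ : CompleteSpace V)
      (e : Q.domain →ₗ[ℂ] V) (J : V →L[ℂ] H) (A : V →L[ℂ] V),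
      DenseRange e ∧ Function.Injective J ∧ (∀ u, J (e u) = u) ∧
      (∀ v u, inner ℂ (e v) (A (e u)) = Q.form v u) ∧
      (∀ x, (inner ℂ x (A x)).re = ‖x‖ ^ 2) := by
  have hnn : ∀ u : Q.domain, 0 ≤ (Q.form u u).re := fun u =>
    (by positivity : 0 ≤ a * ‖(u : H)‖ ^ 2).trans (h1 u)
  obtain ⟨V, i1, i2, i3, e, he, hin⟩ := exists_hilbert_completion (Q.realPartCore hnn (by
    intro u hu
    have := h1 u
    rw [hu] at this
    have h3 : ‖(u : H)‖ ^ 2 = 0 := le_antisymm (by nlinarith) (by positivity)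
    exact Subtype.ext (by simpa using h3)))
  have hsq : ∀ u, ‖e u‖ ^ 2 = (Q.form u u).re := by
    intro u
    rw [@norm_sq_eq_re_inner ℂ, hin]
    change ((Q.form u u + conj (Q.form u u)) / 2 : ℂ).re = _
    rw [Complex.add_conj]
    simp
  have hbd : ∀ u : Q.domain, ‖(u : H)‖ ≤ Real.sqrt a⁻¹ * ‖e u‖ := by
    intro u
    rw [← Real.sqrt_sq (norm_nonneg (e u)), ← Real.sqrt_mul (by positivity)]
    refine Real.le_sqrt_of_sq_le ?_
    rw [hsq, inv_mul_eq_div, le_div_iff₀ ha]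
    linarith [h1 u]
  have hQ : ∀ v u, ‖Q.form v u‖ ≤ 2 * M * (‖e v‖ * ‖e u‖) := by
    refine norm_sesq_le Q.form (fun u => ‖e u‖) (fun v => ?_) (fun r v => ?_) (fun v u => ?_)
      (fun u => by rw [hsq]; exact h2 u)
    · by_cases hv : e v = 0
      · right
        have := hbd v
        rw [hv, norm_zero, mul_zero] at this
        exact Subtype.ext (norm_le_zero_iff.1 this)
      · exact Or.inl (norm_pos_iff.2 hv)
    · simp only [map_smul, norm_smul]
    · simp only [map_add, map_sub]
      have := parallelogram_law_with_norm ℂ (e v) (e u)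
      nlinarith
  set J : V →L[ℂ] H := LinearMap.extendOfNorm Q.domain.subtype e with hJ
  have hJe : ∀ u, J (e u) = u := fun u => LinearMap.extendOfNorm_eq he ⟨_, hbd⟩ u
  -- By the Riesz theorem in V, the functional v ↦ conj Q(v, u), bounded by `hQ`, is represented by
  -- a vector, which becomes A (e u).
  have hex : ∀ u : Q.domain, ∃ x : V, ∀ v, inner ℂ (e v) x = Q.form v u := by
    intro u
    let F : Q.domain →ₗ[ℂ] ℂ := Q.adjoint.form u
    have hF : ∀ v, F v = conj (Q.form v u) := fun _ => rfl
    have hb : ∃ C, ∀ v, ‖F v‖ ≤ C * ‖e v‖ := by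
      refine ⟨2 * M * ‖e u‖, fun v => ?_⟩
      rw [hF, RCLike.norm_conj]
      refine (hQ v u).trans (le_of_eq (by ring))
    refine ⟨(InnerProductSpace.toDual ℂ V).symm
      (LinearMap.extendOfNorm F e), fun v => ?_⟩
    rw [← inner_conj_symm, InnerProductSpace.toDual_symm_apply]
    rw [LinearMap.extendOfNorm_eq he hb v, hF, Complex.conj_conj]
  choose A₀ hA₀ using hex
  have hext : ∀ x y : V, (∀ v, inner ℂ (e v) x = inner ℂ (e v) y) → x = y := by
    intro x y h
    refine ext_inner_left ℂ ?_
    exact isClosed_property he (isClosed_eq (by fun_prop) (by fun_prop)) h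
  let A₁ : Q.domain →ₗ[ℂ] V :=
    { toFun := A₀
      map_add' := fun u w => hext _ _ fun v => by simp [hA₀]
      map_smul' := fun r u => hext _ _ fun v => by simp [hA₀] }
  have hA₁ : ∃ C, ∀ u, ‖A₁ u‖ ≤ C * ‖e u‖ := by
    refine ⟨2 * M, fun u => ?_⟩
    have key : ∀ x : V, ‖inner ℂ x (A₀ u)‖ ≤ 2 * M * ‖e u‖ * ‖x‖ := by
      refine isClosed_property he (isClosed_le (by fun_prop) (by fun_prop)) fun v => ?_
      rw [hA₀]
      exact (hQ v u).trans (le_of_eq (by ring))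
    have h3 := key (A₀ u)
    rw [inner_self_eq_norm_sq_to_K] at h3
    by_cases h0 : A₀ u = 0
    · have h4 := hQ u u
      change ‖A₀ u‖ ≤ _
      rw [h0, norm_zero]
      by_cases hu : ‖e u‖ = 0
      · simp [hu]
      · have : 0 ≤ 2 * M * ‖e u‖ * ‖e u‖ := (norm_nonneg _).trans (h4.trans (le_of_eq (by ring)))
        exact nonneg_of_mul_nonneg_left this (lt_of_le_of_ne (norm_nonneg _) (Ne.symm hu))
    · have h5 : 0 < ‖A₀ u‖ := norm_pos_iff.2 h0
      change ‖A₀ u‖ ≤ _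
      refine le_of_mul_le_mul_right ?_ h5
      refine le_trans (le_of_eq ?_) h3
      simp [sq]
  set A : V →L[ℂ] V := LinearMap.extendOfNorm A₁ e with hA
  have hAe : ∀ u, A (e u) = A₀ u := fun u => LinearMap.extendOfNorm_eq he hA₁ u
  have hB : ∀ v u, inner ℂ (e v) (A (e u)) = Q.form v u := fun v u => by rw [hAe, hA₀]
  have hre : ∀ x, (inner ℂ x (A x)).re = ‖x‖ ^ 2 := by
    refine isClosed_property he (isClosed_eq (by fun_prop) (by fun_prop)) fun v => ?_
    rw [hB, hsq]
  refine ⟨V, i1, i2, i3, e, J, A, he, ?_, hJe, hB, hre⟩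
  -- This is where Q(v, u) = (v | K₀ u) enters: by density (y | A e(u)) = (J y | K₀ u), so J x = 0
  -- makes x orthogonal to the range of A, and ‖x‖² = Re (x | A x) = 0.
  rw [injective_iff_map_eq_zero]
  intro x hx
  have h6 : ∀ u y, inner ℂ y (A (e u)) = inner ℂ (J y) (K₀ u) := by
    intro u
    refine isClosed_property he (isClosed_eq (by fun_prop) (by fun_prop)) fun v => ?_
    rw [hB, hJe, hK]
  have h7 : ∀ y, inner ℂ x (A y) = 0 := by
    refine isClosed_property he (isClosed_eq (by fun_prop) (by fun_prop)) fun v => ?_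
    rw [h6, hx, inner_zero_left]
  have h8 := hre x
  rw [h7] at h8
  simpa using h8.symm

/-- A densely defined form given by an operator that is coercive, with numerical range in a sector,
has a closure, whose associated operator is invertible. -/
theorem SesqForm.closure_of_coercive {H : Type*} [NormedAddCommGroup H]
    [InnerProductSpace ℂ H] [CompleteSpace H] (Q : SesqForm H) (hd : Dense (Q.domain : Set H))
    (K₀ : Q.domain → H) (hK : ∀ v u, Q.form v u = inner ℂ (v : H) (K₀ u)) {a M : ℝ} (ha : 0 < a)
    (hM : 1 ≤ M) (h1 : ∀ u : Q.domain, a * ‖(u : H)‖ ^ 2 ≤ (Q.form u u).re)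
    (h2 : ∀ u, ‖Q.form u u‖ ≤ M * (Q.form u u).re) :
    Q.IsCloseable ∧ Q.adjoint.IsCloseable ∧ ∃ Qc Qc' : SesqForm H,
      Q.IsClosure Qc ∧ Q.adjoint.IsClosure Qc' ∧ Qc.IsClosed ∧ Qc'.IsClosed ∧
      Qc.IsSectorial ∧ Qc'.IsSectorial ∧ Qc'.domain = Qc.domain ∧
      ∃ K K' : H →ₗ.[ℂ] H, Qc.IsAssociated K ∧ Qc'.IsAssociated K' ∧
        Dense (K.domain : Set H) ∧ Dense (K'.domain : Set H) ∧ K.IsClosed ∧ K'.IsClosed ∧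
        (0 : ℂ) ∈ resolventSet K ∧ (0 : ℂ) ∈ resolventSet K' ∧ K.adjoint = K' := by
  obtain ⟨V, i1, i2, i3, e, J, A, he, hJ, hJe, hB, hre⟩ := Q.exists_representation K₀ hK ha h1 h2
  have hsq : ∀ x : V, ‖x‖ ^ 2 ≤ ‖inner ℂ x (A x)‖ := fun x =>
    (hre x).symm.le.trans (Complex.re_le_norm _)
  -- convergence in the form sense is convergence in `V`
  have hto : ∀ {ι : Type} (l : Filter ι) (x : ι → V),
      Tendsto (fun i => inner ℂ (x i) (A (x i))) l (𝓝 0) → Tendsto x l (𝓝 0) := by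
    intro ι l x h
    have h3 : Tendsto (fun i => ‖x i‖ ^ 2) l (𝓝 0) :=
      squeeze_zero (fun _ => by positivity) (fun i => hsq (x i))
        (tendsto_zero_iff_norm_tendsto_zero.1 h)
    rw [tendsto_zero_iff_norm_tendsto_zero]
    have h4 := (Real.continuous_sqrt.tendsto 0).comp h3
    rw [Real.sqrt_zero] at h4
    exact h4.congr fun i => Real.sqrt_sq (norm_nonneg _)
  have hlim : ∀ (x : ℕ → V) (f : H), Tendsto (fun k => J (x k)) atTop (𝓝 f) →
      Tendsto (fun p : ℕ × ℕ => inner ℂ (x p.1 - x p.2) (A (x p.1 - x p.2))) atTop (𝓝 0) →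
      ∃ y, J y = f ∧ Tendsto x atTop (𝓝 y) := by
    intro x f hf hx
    have h3 := hto _ _ hx
    have hc : CauchySeq x := by
      rw [cauchySeq_iff_tendsto, uniformity_eq_comap_nhds_zero, tendsto_comap_iff]
      have h4 := h3.neg
      rw [neg_zero] at h4
      refine h4.congr fun p => ?_
      simp
    obtain ⟨y, hy⟩ := cauchySeq_tendsto_of_complete hc
    exact ⟨y, tendsto_nhds_unique ((J.continuous.tendsto y).comp hy) hf, hy⟩
  have hinner : ∀ {ι : Type} {l : Filter ι} {x z : ι → V} {y w : V}, Tendsto x l (𝓝 y) →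
      Tendsto z l (𝓝 w) → Tendsto (fun i => inner ℂ (x i) (A (z i))) l (𝓝 (inner ℂ y (A w))) :=
    fun hx hz => hx.inner ((A.continuous.tendsto _).comp hz)
  have hQlim : ∀ (u : ℕ → Q.domain) (f : H), Q.FormTendsto u f →
      ∃ y, J y = f ∧ Tendsto (fun k => e (u k)) atTop (𝓝 y) := by
    intro u f hu
    refine hlim (fun k => e (u k)) f ?_ ?_
    · simpa only [hJe] using hu.1
    · simpa only [← map_sub, hB] using hu.2
  have hcl : Q.IsCloseable := by
    intro u hu
    obtain ⟨y, hy, hy'⟩ := hQlim u 0 hu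
    have : y = 0 := hJ (by rw [hy, map_zero])
    subst this
    have := hinner hy' hy'
    simpa only [hB, map_zero, inner_zero_left] using this
  -- The closure lives on the range of J. Identifying that range with V replaces limits of form
  -- values by continuity of (x | A y) on V × V.
  let E : V ≃ₗ[ℂ] LinearMap.range J.toLinearMap := LinearEquiv.ofInjective J.toLinearMap hJ
  have hE : ∀ g, J (E.symm g) = g := fun g => by
    conv_rhs => rw [← E.apply_symm_apply g]
    rfl
  let Qc : SesqForm H :=
    { domain := LinearMap.range J.toLinearMap
      form := LinearMap.mk₂'ₛₗ (starRingEnd ℂ) (RingHom.id ℂ)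
        (fun g f => inner ℂ (E.symm g) (A (E.symm f)))
        (by intros; simp) (by intros; simp [mul_comm]) (by intros; simp) (by intros; simp) }
  have hQc : ∀ g f : Qc.domain, Qc.form g f = inner ℂ (E.symm g) (A (E.symm f)) :=
    fun _ _ => rfl
  have hclosure : Q.IsClosure Qc := by
    refine ⟨fun f => ⟨?_, ?_⟩, ?_⟩
    · rintro ⟨y, rfl⟩
      obtain ⟨x, hx, hxy⟩ := mem_closure_iff_seq_limit.1 (he y)
      choose u hu using hx
      refine ⟨u, ?_, ?_⟩
      · have := (J.continuous.tendsto y).comp hxy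
        refine this.congr fun k => ?_
        rw [Function.comp_apply, ← hu, hJe]
      · have h3 : Tendsto (fun p : ℕ × ℕ => x p.1 - x p.2) atTop (𝓝 (y - y)) := by
          rw [← prod_atTop_atTop_eq]
          exact (hxy.comp tendsto_fst).sub (hxy.comp tendsto_snd)
        have h4 := hinner h3 h3
        rw [sub_self, inner_zero_left] at h4
        refine h4.congr fun p => ?_
        rw [← hu, ← hu, ← map_sub, hB]
    · rintro ⟨u, hu⟩
      obtain ⟨y, hy, -⟩ := hQlim u f hu
      exact ⟨y, hy⟩
    · intro v u g f hv hu
      obtain ⟨y, hy, hy'⟩ := hQlim v g hv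
      obtain ⟨z, hz, hz'⟩ := hQlim u f hu
      have e1 : E.symm g = y := hJ (by rw [hE, hy])
      have e2 : E.symm f = z := hJ (by rw [hE, hz])
      rw [hQc, e1, e2]
      simpa only [hB] using hinner hy' hz'
  have hclosed : Qc.IsClosed := by
    intro u f hu
    obtain ⟨y, hy, hy'⟩ := hlim (fun k => E.symm (u k)) f (by simpa only [hE] using hu.1)
      (by simpa only [← map_sub, ← hQc] using hu.2)
    refine ⟨⟨y, hy⟩, ?_⟩
    have e1 : E.symm ⟨f, ⟨y, hy⟩⟩ = y := hJ (by rw [hE, hy])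
    have h3 : Tendsto (fun k => E.symm (u k) - y) atTop (𝓝 0) := by
      simpa using hy'.sub_const y
    have h4 := hinner h3 h3
    rw [inner_zero_left] at h4
    refine h4.congr fun k => ?_
    rw [hQc]
    simp only [map_sub]
    rw [e1]
  have hAM : ∀ x, ‖inner ℂ x (A x)‖ ≤ M * ‖x‖ ^ 2 := by
    refine isClosed_property he (isClosed_le (by fun_prop) (by fun_prop)) fun v => ?_
    rw [← hre, hB]
    exact h2 v
  have hsec : ∀ u, ‖Qc.form u u‖ ≤ M * (Qc.form u u).re := by
    intro u
    rw [hQc, hre]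
    exact hAM _
  -- Lax–Milgram, with coercivity constant 1 because V is normed by Re Q.
  have hunit : IsUnit A := by
    refine ContinuousLinearMap.isUnit_of_forall_le_norm_inner_map A (c := 1) one_pos fun x => ?_
    rw [NNReal.coe_one, mul_one, norm_inner_symm]
    exact hsq x
  obtain ⟨⟨A', Ai, hi1, hi2⟩, hA'⟩ := hunit
  have hA'' : A' = A := hA'
  subst hA''
  have hAi1 : ∀ x, A' (Ai x) = x := fun x => by
    simpa using congrArg (fun T : V →L[ℂ] V => T x) hi1
  have hAi2 : ∀ x, Ai (A' x) = x := fun x => by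
    simpa using congrArg (fun T : V →L[ℂ] V => T x) hi2
  -- J has dense range, since it contains the dense domain of Q; hence J* is injective.
  have hJd : ∀ y, ContinuousLinearMap.adjoint J y = 0 → y = 0 := by
    intro y hy
    have h3 : ∀ u : Q.domain, inner ℂ (u : H) y = 0 := fun u => by
      rw [← hJe, ← ContinuousLinearMap.adjoint_inner_right, hy, inner_zero_right]
    have h4 : Continuous fun z : H => inner ℂ z y := by fun_prop
    have h5 := h4.ext_on hd continuous_const (fun z hz => h3 ⟨z, hz⟩)
    simpa using congrFun h5 y
  have hadj : ∀ x y, inner ℂ (ContinuousLinearMap.adjoint Ai x) (A' y) = inner ℂ x y := by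
    intro x y
    rw [ContinuousLinearMap.adjoint_inner_left, hAi2]
  have hAd1 : ∀ x, ContinuousLinearMap.adjoint A' (ContinuousLinearMap.adjoint Ai x) = x :=
    fun x => ext_inner_right ℂ fun y => by rw [ContinuousLinearMap.adjoint_inner_left, hadj]
  have hAd2 : ∀ x, ContinuousLinearMap.adjoint Ai (ContinuousLinearMap.adjoint A' x) = x :=
    fun x => ext_inner_right ℂ fun y => by
      rw [ContinuousLinearMap.adjoint_inner_left, ContinuousLinearMap.adjoint_inner_left, hAi1]
  -- For u = J x, the equation Q(v, u) = (v | w) for all v in the closed form domain reads A x = J*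
  -- w. Thus R is the solution operator w ↦ u.
  set R : H →L[ℂ] H := J ∘L Ai ∘L ContinuousLinearMap.adjoint J with hR
  have hR' : ContinuousLinearMap.adjoint R =
      J ∘L ContinuousLinearMap.adjoint Ai ∘L ContinuousLinearMap.adjoint J := by
    simp only [hR, ContinuousLinearMap.adjoint_comp, ContinuousLinearMap.adjoint_adjoint]
    rfl
  obtain ⟨K, K', hK1, hK2, hrest⟩ := exists_inverse_pair R
    ((injective_iff_map_eq_zero R).2 fun x hx => by
      refine hJd x ?_
      rw [← hAi1 (ContinuousLinearMap.adjoint J x),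
        (injective_iff_map_eq_zero J).1 hJ (Ai (ContinuousLinearMap.adjoint J x)) hx, map_zero])
    ((injective_iff_map_eq_zero _).2 fun x hx => by
      refine hJd x ?_
      rw [hR'] at hx
      rw [← hAd1 (ContinuousLinearMap.adjoint J x), (injective_iff_map_eq_zero J).1 hJ
        (ContinuousLinearMap.adjoint Ai (ContinuousLinearMap.adjoint J x)) hx, map_zero])
  let P : V → Qc.domain := fun x => ⟨J x, ⟨x, rfl⟩⟩
  have hP : ∀ x, E.symm (P x) = x := fun x => hJ (hE _)
  have hadjf : ∀ v u : Qc.domain, Qc.adjoint.form v u = inner ℂ (A' (E.symm v)) (E.symm u) :=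
    fun v u => inner_conj_symm _ _
  have hassoc : ∀ y w, (∀ v : Qc.domain, Qc.form v (P y) = inner ℂ (v : H) w) ↔
      A' y = ContinuousLinearMap.adjoint J w := by
    intro y w
    constructor
    · intro h
      refine ext_inner_left ℂ fun x => ?_
      have := h (P x)
      rw [hQc, hP, hP] at this
      rw [this, ContinuousLinearMap.adjoint_inner_right]
    · intro h v
      rw [hQc, hP, h, ContinuousLinearMap.adjoint_inner_right, hE]
  have hassoc' : ∀ y w, (∀ v : Qc.domain, Qc.adjoint.form v (P y) = inner ℂ (v : H) w) ↔
      ContinuousLinearMap.adjoint A' y = ContinuousLinearMap.adjoint J w := by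
    intro y w
    constructor
    · intro h
      refine ext_inner_left ℂ fun x => ?_
      have := h (P x)
      rw [hadjf, hP, hP] at this
      rw [ContinuousLinearMap.adjoint_inner_right, this, ContinuousLinearMap.adjoint_inner_right]
    · intro h v
      rw [hadjf, hP, ← ContinuousLinearMap.adjoint_inner_right, h,
        ContinuousLinearMap.adjoint_inner_right, hE]
  refine ⟨hcl, hcl.adjoint, Qc, Qc.adjoint, hclosure, hclosure.adjoint, hclosed, hclosed.adjoint,
    isSectorial_of_norm_le hM hsec, isSectorial_of_norm_le hM fun u => ?_, rfl, K, K', ?_, ?_,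
    hrest⟩
  · have := hsec u
    change ‖conj (Qc.form u u)‖ ≤ M * (conj (Qc.form u u)).re
    rwa [RCLike.norm_conj, Complex.conj_re]
  · intro u w
    rw [hK1]
    constructor
    · rintro rfl
      exact ⟨⟨_, rfl⟩, (hassoc (Ai (ContinuousLinearMap.adjoint J w)) w).2 (hAi1 _)⟩
    · rintro ⟨⟨y, rfl⟩, hv⟩
      change J (Ai (ContinuousLinearMap.adjoint J w)) = J y
      rw [← (hassoc y w).1 hv, hAi2]
  · intro u w
    rw [hK2, hR']
    constructor
    · rintro rfl
      exact ⟨⟨_, rfl⟩, (hassoc' (ContinuousLinearMap.adjoint Ai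
        (ContinuousLinearMap.adjoint J w)) w).2 (hAd1 _)⟩
    · rintro ⟨⟨y, rfl⟩, hv⟩
      change J (ContinuousLinearMap.adjoint Ai (ContinuousLinearMap.adjoint J w)) = J y
      rw [← (hassoc' y w).1 hv, hAd2]

/-! ### Bilinear forms of matrices, and smoothness of determinants and inverses. -/

section Matrices

variable {ι : Type*} [Fintype ι] [DecidableEq ι]

/-- The bilinear form `ξ_j M_{jk} η_k`. -/
def bil (M : Matrix ι ι ℂ) (ξ η : ι → ℂ) : ℂ := ∑ j, ∑ k, ξ j * M j k * η k

omit [DecidableEq ι] in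
theorem bil_eq_dotProduct (M : Matrix ι ι ℂ) (ξ η : ι → ℂ) :
    bil M ξ η = dotProduct ξ (M.mulVec η) := by
  simp only [bil, dotProduct, Matrix.mulVec, Finset.mul_sum, mul_assoc]

/-- The inverse of a Gram matrix is the dual form on covectors. Under a change of basis J the Gram
matrix becomes Jᵀ A J and covector components become Jᵀ ξ, so the pairing is invariant. -/
theorem bil_inv_transform (A J : Matrix ι ι ℂ) (hJ : IsUnit J.det) (ξ η : ι → ℂ) :
    bil (J.transpose * A * J)⁻¹ (J.transpose.mulVec ξ) (J.transpose.mulVec η) = bil A⁻¹ ξ η := by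
  have hJt : IsUnit J.transpose.det := by rwa [Matrix.det_transpose]
  rw [bil_eq_dotProduct, bil_eq_dotProduct, Matrix.mul_inv_rev, Matrix.mul_inv_rev]
  rw [← Matrix.mulVec_mulVec, ← Matrix.mulVec_mulVec, Matrix.mulVec_mulVec (M := J.transpose⁻¹),
    Matrix.nonsing_inv_mul _ hJt, Matrix.one_mulVec, Matrix.mulVec_transpose,
    ← Matrix.dotProduct_mulVec, Matrix.mulVec_mulVec, Matrix.mul_nonsing_inv _ hJ,
    Matrix.one_mulVec]

variable {E : Type*} [NormedAddCommGroup E] [NormedSpace ℝ E] {m : WithTop ℕ∞}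
  {𝕜 : Type*} [RCLike 𝕜]

theorem contDiffAt_det {A : E → Matrix ι ι 𝕜} {p : E}
    (hA : ∀ j k, ContDiffAt ℝ m (fun q => A q j k) p) :
    ContDiffAt ℝ m (fun q => (A q).det) p := by
  simp only [Matrix.det_apply']
  exact ContDiffAt.sum fun σ _ => contDiffAt_const.mul (contDiffAt_prod fun i _ => hA _ _)

theorem contDiffAt_inv_apply {A : E → Matrix ι ι 𝕜} {p : E}
    (hA : ∀ j k, ContDiffAt ℝ m (fun q => A q j k) p) (hd : (A p).det ≠ 0) (j k : ι) :
    ContDiffAt ℝ m (fun q => (A q)⁻¹ j k) p := by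
  simp only [Matrix.inv_def, Matrix.smul_apply, Ring.inverse_eq_inv', smul_eq_mul,
    Matrix.adjugate_apply]
  refine ((contDiffAt_det hA).inv hd).mul (contDiffAt_det fun a b => ?_)
  simp only [Matrix.updateRow_apply]
  split_ifs
  · exact contDiffAt_const
  · exact hA _ _

end Matrices

/-! ### Integration by parts and the derivative of the density |D|^{1/2}. -/

section IntegrationByParts

variable {E : Type*} [NormedAddCommGroup E] [NormedSpace ℝ E]

theorem integral_fderiv_eq_zero [MeasurableSpace E] [BorelSpace E] [FiniteDimensional ℝ E]
    (μ : Measure E) [μ.IsAddHaarMeasure] {f : E → ℂ} (hf : ContDiff ℝ 1 f)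
    (hc : HasCompactSupport f) (v : E) : ∫ x, fderiv ℝ f x v ∂μ = 0 := by
  have h := integral_mul_fderiv_eq_neg_fderiv_mul_of_integrable (μ := μ) (𝕜 := ℂ) (v := v)
    (f := fun _ : E => (1 : ℂ)) (g := f) ?_ ?_ ?_ ?_ ?_
  · simpa using h
  · simp
  · simp only [one_mul]
    exact Continuous.integrable_of_hasCompactSupport
      ((hf.continuous_fderiv one_ne_zero).clm_apply continuous_const) (hc.fderiv_apply ℝ v)
  · simp only [one_mul]
    exact hf.continuous.integrable_of_hasCompactSupport hc
  · fun_prop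
  · intro x _
    exact (hf.differentiable one_ne_zero).differentiableAt

/-- Differentiating log |D| leaves only the real part of D'/D. The modulus is rewritten as the
square root of |D|², which is differentiable wherever D is. -/
theorem fderiv_sqrt_norm {D : E → ℂ} {p : E} (hD : DifferentiableAt ℝ D p) (h0 : D p ≠ 0)
    (e : E) : fderiv ℝ (fun q => Real.sqrt ‖D q‖) p e =
      1 / 2 * (fderiv ℝ D p e / D p).re * Real.sqrt ‖D p‖ := by
  have hn : 0 < ‖D p‖ := norm_pos_iff.2 h0
  have h1 : HasFDerivAt (fun q => ‖D q‖ ^ 2) _ p := hD.hasFDerivAt.norm_sq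
  have h2 := (h1.sqrt (by positivity)).sqrt (by positivity)
  have h3 : (fun q => Real.sqrt ‖D q‖) = fun q => Real.sqrt (Real.sqrt (‖D q‖ ^ 2)) := by
    funext q
    rw [Real.sqrt_sq (norm_nonneg _)]
  rw [h3, h2.fderiv]
  simp only [Real.sqrt_sq (norm_nonneg _)]
  have h4 : (fderiv ℝ D p e / D p).re = inner ℝ (D p) (fderiv ℝ D p e) / ‖D p‖ ^ 2 := by
    rw [Complex.div_re, Complex.inner, ← Complex.normSq_eq_norm_sq]
    simp
    ring
  rw [h4]
  have h5 : Real.sqrt ‖D p‖ ^ 2 = ‖D p‖ := Real.sq_sqrt hn.le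
  have h6 : 0 < Real.sqrt ‖D p‖ := Real.sqrt_pos.2 hn
  simp
  generalize inner ℝ (D p) (fderiv ℝ D p e) = x
  generalize Real.sqrt ‖D p‖ = w at *
  rw [← h5]
  field_simp
  try ring

end IntegrationByParts

/-! ### The operator and its energy density in coordinates, and invariance of the energy. -/

section Local

variable {n : ℕ}

/-- The derivative in the direction of the first factor. -/
def dS (F : ℝ × Coord n → ℂ) (p : ℝ × Coord n) : ℂ := fderiv ℝ F p (1, 0)

/-- The partial derivatives in the directions of the second factor. -/
def dX (F : ℝ × Coord n → ℂ) (p : ℝ × Coord n) (j : Fin n) : ℂ := fderiv ℝ F p (0, stdVec j)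

/-- The Wick rotated operator in coordinates, with metric coefficients `A` and potential `q`. -/
def locK (A : ℝ × Coord n → Matrix (Fin n) (Fin n) ℂ) (q u : ℝ × Coord n → ℂ)
    (p : ℝ × Coord n) : ℂ :=
  - dS (dS u) p - 1 / 2 * (A p).det⁻¹ * dS (fun p => (A p).det) p * dS u p
  - (∑ j, ∑ k, (dX (fun p => (A p)⁻¹ j k * dX u p k) p j
      + 1 / 2 * (A p).det⁻¹ * dX (fun p => (A p).det) p j * ((A p)⁻¹ j k * dX u p k)))
  + q p * u p

/-- The imaginary part of the logarithmic derivative of the determinant along the second factor. -/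
def imX (A : ℝ × Coord n → Matrix (Fin n) (Fin n) ℂ) (p : ℝ × Coord n) (j : Fin n) : ℂ :=
  ((dX (fun p => (A p).det) p j / (A p).det).im : ℝ)

/-- The imaginary part of the logarithmic derivative of the determinant along the first factor. -/
def imS (A : ℝ × Coord n → Matrix (Fin n) (Fin n) ℂ) (p : ℝ × Coord n) : ℂ :=
  ((dS (fun p => (A p).det) p / (A p).det).im : ℝ)

/-- The energy density of the Wick rotated operator in coordinates. -/
def locE (A : ℝ × Coord n → Matrix (Fin n) (Fin n) ℂ) (q v u : ℝ × Coord n → ℂ)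
    (p : ℝ × Coord n) : ℂ :=
  conj (dS v p) * dS u p + bil (A p)⁻¹ (fun j => conj (dX v p j)) (dX u p)
  - Complex.I / 2 * conj (v p) * (imS A p * dS u p + bil (A p)⁻¹ (imX A p) (dX u p))
  + q p * conj (v p) * u p

theorem contDiffAt_fderiv_apply {E : Type*} [NormedAddCommGroup E] [NormedSpace ℝ E]
    {f : E → ℂ} {p : E} (hf : ContDiffAt ℝ ∞ f p) (e : E) :
    ContDiffAt ℝ ∞ (fun x => fderiv ℝ f x e) p :=
  (hf.fderiv_right (m := ∞) (by norm_num)).clm_apply contDiffAt_const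

theorem contDiffAt_conj {E : Type*} [NormedAddCommGroup E] [NormedSpace ℝ E]
    {f : E → ℂ} {p : E} {m : WithTop ℕ∞} (hf : ContDiffAt ℝ m f p) :
    ContDiffAt ℝ m (fun x => conj (f x)) p :=
  (Complex.conjCLE.toContinuousLinearMap.contDiff.contDiffAt (x := f p)).comp p hf

theorem contDiffAt_ofReal {E : Type*} [NormedAddCommGroup E] [NormedSpace ℝ E]
    {f : E → ℝ} {p : E} {m : WithTop ℕ∞} (hf : ContDiffAt ℝ m f p) :
    ContDiffAt ℝ m (fun x => (f x : ℂ)) p :=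
  (Complex.ofRealCLM.contDiff.contDiffAt (x := f p)).comp p hf

theorem contDiffAt_im {E : Type*} [NormedAddCommGroup E] [NormedSpace ℝ E]
    {f : E → ℂ} {p : E} {m : WithTop ℕ∞} (hf : ContDiffAt ℝ m f p) :
    ContDiffAt ℝ m (fun x => ((f x).im : ℂ)) p :=
  contDiffAt_ofReal ((Complex.imCLM.contDiff.contDiffAt (x := f p)).comp p hf)

theorem contDiffAt_sqrt_norm {E : Type*} [NormedAddCommGroup E] [NormedSpace ℝ E]
    {D : E → ℂ} {p : E} {m : WithTop ℕ∞} (hD : ContDiffAt ℝ m D p) (h0 : D p ≠ 0) :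
    ContDiffAt ℝ m (fun q => Real.sqrt ‖D q‖) p :=
  (hD.norm ℝ h0).sqrt (norm_ne_zero_iff.2 h0)

variable {A : ℝ × Coord n → Matrix (Fin n) (Fin n) ℂ} {q v u : ℝ × Coord n → ℂ}
  {p : ℝ × Coord n}

theorem contDiffAt_bil {E : Type*} [NormedAddCommGroup E] [NormedSpace ℝ E] {m : WithTop ℕ∞}
    {M : E → Matrix (Fin n) (Fin n) ℂ} {ξ η : E → Fin n → ℂ} {p : E}
    (hM : ∀ j k, ContDiffAt ℝ m (fun q => M q j k) p) (hξ : ∀ j, ContDiffAt ℝ m (fun q => ξ q j) p)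
    (hη : ∀ j, ContDiffAt ℝ m (fun q => η q j) p) :
    ContDiffAt ℝ m (fun q => bil (M q) (ξ q) (η q)) p :=
  ContDiffAt.sum fun j _ => ContDiffAt.sum fun k _ => ((hξ j).mul (hM j k)).mul (hη k)

theorem contDiffAt_locK (hA : ∀ j k, ContDiffAt ℝ ∞ (fun p => A p j k) p) (h0 : (A p).det ≠ 0)
    (hq : ContDiffAt ℝ ∞ q p) (hu : ContDiffAt ℝ ∞ u p) : ContDiffAt ℝ ∞ (locK A q u) p := by
  have hD := contDiffAt_det hA
  have hDi := hD.inv h0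
  have hB := contDiffAt_inv_apply hA h0
  have hSu : ContDiffAt ℝ ∞ (dS u) p := contDiffAt_fderiv_apply hu _
  have hSSu : ContDiffAt ℝ ∞ (dS (dS u)) p := contDiffAt_fderiv_apply hSu _
  have hSD : ContDiffAt ℝ ∞ (dS fun p => (A p).det) p := contDiffAt_fderiv_apply hD _
  have hXD : ∀ j, ContDiffAt ℝ ∞ (fun p' => dX (fun p => (A p).det) p' j) p :=
    fun j => contDiffAt_fderiv_apply hD _
  have hXu : ∀ j, ContDiffAt ℝ ∞ (fun p' => dX u p' j) p := fun j => contDiffAt_fderiv_apply hu _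
  have hXX : ∀ j k, ContDiffAt ℝ ∞ (fun p' => dX (fun p => (A p)⁻¹ j k * dX u p k) p' j) p :=
    fun j k => contDiffAt_fderiv_apply ((hB j k).mul (hXu k)) _
  refine ContDiffAt.add (ContDiffAt.sub (ContDiffAt.sub hSSu.neg ?_) ?_) (hq.mul hu)
  · exact ((contDiffAt_const.mul hDi).mul hSD).mul hSu
  · exact ContDiffAt.sum fun j _ => ContDiffAt.sum fun k _ => (hXX j k).add
      (((contDiffAt_const.mul hDi).mul (hXD j)).mul ((hB j k).mul (hXu k)))

theorem contDiffAt_imS (hA : ∀ j k, ContDiffAt ℝ ∞ (fun p => A p j k) p) (h0 : (A p).det ≠ 0) :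
    ContDiffAt ℝ ∞ (imS A) p :=
  contDiffAt_im (f := fun p => dS (fun p => (A p).det) p / (A p).det) (by
    simp only [div_eq_mul_inv]
    exact (contDiffAt_fderiv_apply (contDiffAt_det hA) _).mul ((contDiffAt_det hA).inv h0))

theorem contDiffAt_imX (hA : ∀ j k, ContDiffAt ℝ ∞ (fun p => A p j k) p) (h0 : (A p).det ≠ 0)
    (j : Fin n) : ContDiffAt ℝ ∞ (fun p => imX A p j) p :=
  contDiffAt_im (f := fun p => dX (fun p => (A p).det) p j / (A p).det) (by
    simp only [div_eq_mul_inv]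
    exact (contDiffAt_fderiv_apply (contDiffAt_det hA) _).mul ((contDiffAt_det hA).inv h0))

theorem contDiffAt_locE (hA : ∀ j k, ContDiffAt ℝ ∞ (fun p => A p j k) p) (h0 : (A p).det ≠ 0)
    (hq : ContDiffAt ℝ ∞ q p) (hv : ContDiffAt ℝ ∞ v p) (hu : ContDiffAt ℝ ∞ u p) :
    ContDiffAt ℝ ∞ (locE A q v u) p := by
  have hB := contDiffAt_inv_apply hA h0
  have hSu : ContDiffAt ℝ ∞ (dS u) p := contDiffAt_fderiv_apply hu _
  have hSv : ContDiffAt ℝ ∞ (dS v) p := contDiffAt_fderiv_apply hv _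
  have hXu : ∀ j, ContDiffAt ℝ ∞ (fun p' => dX u p' j) p := fun j => contDiffAt_fderiv_apply hu _
  have hXv : ∀ j, ContDiffAt ℝ ∞ (fun p' => dX v p' j) p := fun j => contDiffAt_fderiv_apply hv _
  refine ContDiffAt.add (ContDiffAt.sub (ContDiffAt.add ((contDiffAt_conj hSv).mul hSu) ?_) ?_)
    ((hq.mul (contDiffAt_conj hv)).mul hu)
  · exact contDiffAt_bil hB (fun j => contDiffAt_conj (hXv j)) hXu
  · exact (contDiffAt_const.mul (contDiffAt_conj hv)).mul (((contDiffAt_imS hA h0).mul hSu).add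
      (contDiffAt_bil hB (contDiffAt_imX hA h0) hXu))

/-- A product rule: with `w = |D|^{1/2}`, the derivative of `w * conj v * X`. -/
theorem fderiv_weight_mul {E : Type*} [NormedAddCommGroup E] [NormedSpace ℝ E] {D v X : E → ℂ}
    {p : E} (hD : DifferentiableAt ℝ D p) (h0 : D p ≠ 0) (hv : DifferentiableAt ℝ v p)
    (hX : DifferentiableAt ℝ X p) (e : E) :
    fderiv ℝ (fun p => (Real.sqrt ‖D p‖ : ℂ) * (conj (v p) * X p)) p e =
      Real.sqrt ‖D p‖ * (conj (fderiv ℝ v p e) * X p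
        - Complex.I / 2 * conj (v p) * (((fderiv ℝ D p e / D p).im : ℝ) * X p)
        + conj (v p) * (fderiv ℝ X p e + 1 / 2 * (D p)⁻¹ * fderiv ℝ D p e * X p)) := by
  have hw : DifferentiableAt ℝ (fun q => Real.sqrt ‖D q‖) p :=
    (hD.norm ℝ h0).sqrt (norm_ne_zero_iff.2 h0)
  have hw' : HasFDerivAt (fun q => (Real.sqrt ‖D q‖ : ℂ)) _ p :=
    (Complex.ofRealCLM.hasFDerivAt (x := Real.sqrt ‖D p‖)).comp p hw.hasFDerivAt
  have hv' : HasFDerivAt (fun x => conj (v x)) _ p :=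
    (Complex.conjCLE.toContinuousLinearMap.hasFDerivAt (x := v p)).comp p hv.hasFDerivAt
  rw [(hw'.fun_mul (hv'.fun_mul hX.hasFDerivAt)).fderiv]
  -- The weight contributes ½ Re(D'/D), whereas the operator contains ½ D'/D; the mismatch -(i/2)
  -- Im(D'/D) is the correction term in the energy density.
  have h1 : (1 / 2 * (D p)⁻¹ * fderiv ℝ D p e : ℂ) = 1 / 2 * (((fderiv ℝ D p e / D p).re : ℝ)
      + ((fderiv ℝ D p e / D p).im : ℝ) * Complex.I) := by
    rw [Complex.re_add_im]; ring
  rw [h1]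
  have h2 := fderiv_sqrt_norm hD h0 e
  simp only [add_apply, smul_apply,
    ContinuousLinearMap.comp_apply, Complex.ofRealCLM_apply, h2, smul_eq_mul,
    ContinuousLinearEquiv.coe_coe, Complex.conjCLE_apply]
  push_cast
  ring

/-- The integrand of the quadratic form and the energy density differ by a divergence. -/
theorem locE_sub_locK (hA : ∀ j k, ContDiffAt ℝ ∞ (fun p => A p j k) p) (h0 : (A p).det ≠ 0)
    (hv : ContDiffAt ℝ ∞ v p) (hu : ContDiffAt ℝ ∞ u p) :
    (Real.sqrt ‖(A p).det‖ : ℂ) * locE A q v u p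
      - (Real.sqrt ‖(A p).det‖ : ℂ) * (conj (v p) * locK A q u p) =
    dS (fun p => (Real.sqrt ‖(A p).det‖ : ℂ) * (conj (v p) * dS u p)) p
    + ∑ j, ∑ k, dX (fun p => (Real.sqrt ‖(A p).det‖ : ℂ) *
        (conj (v p) * ((A p)⁻¹ j k * dX u p k))) p j := by
  have hD := (contDiffAt_det hA).differentiableAt (by simp)
  have hB := contDiffAt_inv_apply hA h0
  have hv' := hv.differentiableAt (by simp)
  have hSu : ContDiffAt ℝ ∞ (dS u) p := contDiffAt_fderiv_apply hu _
  have hXu : ∀ j, ContDiffAt ℝ ∞ (fun p' => dX u p' j) p := fun j => contDiffAt_fderiv_apply hu _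
  have e1 : dS (fun p => (Real.sqrt ‖(A p).det‖ : ℂ) * (conj (v p) * dS u p)) p =
      Real.sqrt ‖(A p).det‖ * (conj (dS v p) * dS u p
        - Complex.I / 2 * conj (v p) * (imS A p * dS u p)
        + conj (v p) * (dS (dS u) p + 1 / 2 * (A p).det⁻¹ * dS (fun p => (A p).det) p * dS u p)) :=
    fderiv_weight_mul hD h0 hv' (hSu.differentiableAt (by simp)) (1, 0)
  have e2 := fun j k => fderiv_weight_mul hD h0 hv'
    (((hB j k).mul (hXu k)).differentiableAt (by simp)) (0, stdVec j)
  have e3 : ∀ j k, dX (fun p => (Real.sqrt ‖(A p).det‖ : ℂ) *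
      (conj (v p) * ((A p)⁻¹ j k * dX u p k))) p j = _ := e2
  rw [e1]
  simp only [e3]
  rw [show (∑ j, ∑ k, (Real.sqrt ‖(A p).det‖ : ℂ) * (conj (fderiv ℝ v p (0, stdVec j)) *
      ((A p)⁻¹ j k * dX u p k) - Complex.I / 2 * conj (v p) *
        (((fderiv ℝ (fun p => (A p).det) p (0, stdVec j) / (A p).det).im : ℝ) *
          ((A p)⁻¹ j k * dX u p k)) + conj (v p) *
        (fderiv ℝ (fun p => (A p)⁻¹ j k * dX u p k) p (0, stdVec j) + 1 / 2 * (A p).det⁻¹ *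
          fderiv ℝ (fun p => (A p).det) p (0, stdVec j) * ((A p)⁻¹ j k * dX u p k)))) =
      (Real.sqrt ‖(A p).det‖ : ℂ) * (bil (A p)⁻¹ (fun j => conj (dX v p j)) (dX u p)
        - Complex.I / 2 * conj (v p) * bil (A p)⁻¹ (imX A p) (dX u p) + conj (v p) *
        ∑ j, ∑ k, (dX (fun p => (A p)⁻¹ j k * dX u p k) p j
          + 1 / 2 * (A p).det⁻¹ * dX (fun p => (A p).det) p j * ((A p)⁻¹ j k * dX u p k))) by
    simp only [bil, imX, Finset.mul_sum, ← Finset.sum_add_distrib, ← Finset.sum_sub_distrib]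
    refine Finset.sum_congr rfl fun j _ => Finset.sum_congr rfl fun k _ => ?_
    simp only [dX]
    ring]
  simp only [locE, locK]
  ring

/-- The coefficients are smooth only on part of the coordinate space. A factor supported there makes
products globally smooth, as required to integrate divergences over the whole space. -/
theorem contDiff_of_tsupport_subset {E F : Type*} [NormedAddCommGroup E] [NormedSpace ℝ E]
    [NormedAddCommGroup F] [NormedSpace ℝ F] {f : E → F} {m : WithTop ℕ∞} {O K : Set E}
    (hK : IsClosed K) (hf : ∀ p ∈ O, ContDiffAt ℝ m f p) (h0 : ∀ p ∉ K, f p = 0) (hKO : K ⊆ O) :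
    ContDiff ℝ m f := by
  refine contDiff_iff_contDiffAt.2 fun p => ?_
  by_cases hp : p ∈ K
  · exact hf p (hKO hp)
  · refine (contDiffAt_const (c := (0 : F))).congr_of_eventuallyEq ?_
    filter_upwards [hK.isOpen_compl.mem_nhds hp] with q hq using h0 q hq

instance isAddHaarMeasure_volume_prod_coord :
    (volume : Measure (ℝ × Coord n)).IsAddHaarMeasure := by
  rw [Measure.volume_eq_prod]
  infer_instance

/-- Multiplication by conj v cuts all integrands down to a compact subset of O, and by
`locE_sub_locK` the two differ by a sum of derivatives of compactly supported functions, which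
integrate to zero. -/
theorem integral_locK_eq {O : Set (ℝ × Coord n)}
    (hA : ∀ p ∈ O, ∀ j k, ContDiffAt ℝ ∞ (fun p => A p j k) p)
    (h0 : ∀ p ∈ O, (A p).det ≠ 0) (hq : ∀ p ∈ O, ContDiffAt ℝ ∞ q p)
    (hu : ∀ p ∈ O, ContDiffAt ℝ ∞ u p)
    (hv : ContDiff ℝ ∞ v) (hvc : HasCompactSupport v) (hvO : tsupport v ⊆ O) :
    ∫ p, (Real.sqrt ‖(A p).det‖ : ℂ) * (conj (v p) * locK A q u p) =
      ∫ p, (Real.sqrt ‖(A p).det‖ : ℂ) * locE A q v u p := by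
  have hv0 : ∀ p ∉ tsupport v, v p = 0 := fun p hp => image_eq_zero_of_notMem_tsupport hp
  have hdv0 : ∀ e, ∀ p ∉ tsupport v, fderiv ℝ v p e = 0 := fun e p hp => by
    rw [fderiv_of_notMem_tsupport ℝ hp]; rfl
  have hS0 : ∀ p ∉ tsupport v, dS v p = 0 := hdv0 (1, 0)
  have hX0 : ∀ p ∉ tsupport v, ∀ j, dX v p j = 0 := fun p hp j => hdv0 (0, stdVec j) p hp
  have hw : ∀ p ∈ O, ContDiffAt ℝ ∞ (fun p => (Real.sqrt ‖(A p).det‖ : ℂ)) p := fun p hp =>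
    contDiffAt_ofReal (contDiffAt_sqrt_norm (contDiffAt_det (hA p hp)) (h0 p hp))
  have hB := fun p hp => contDiffAt_inv_apply (hA p hp) (h0 p hp)
  have hSu : ∀ p ∈ O, ContDiffAt ℝ ∞ (dS u) p := fun p hp => contDiffAt_fderiv_apply (hu p hp) _
  have hXu : ∀ p ∈ O, ∀ j, ContDiffAt ℝ ∞ (fun p' => dX u p' j) p :=
    fun p hp j => contDiffAt_fderiv_apply (hu p hp) _
  have hcv : ∀ p, ContDiffAt ℝ ∞ (fun p => conj (v p)) p := fun p => contDiffAt_conj hv.contDiffAt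
  have hcs : ∀ f : ℝ × Coord n → ℂ, (∀ p ∉ tsupport v, f p = 0) → HasCompactSupport f :=
    fun f hf => HasCompactSupport.intro hvc hf
  have key : ∀ f : ℝ × Coord n → ℂ, (∀ p ∈ O, ContDiffAt ℝ ∞ f p) →
      (∀ p ∉ tsupport v, f p = 0) → ContDiff ℝ ∞ f :=
    fun f h1 h2 => contDiff_of_tsupport_subset (isClosed_tsupport v) h1 h2 hvO
  have hint : ∀ f : ℝ × Coord n → ℂ, (∀ p ∈ O, ContDiffAt ℝ ∞ f p) →
      (∀ p ∉ tsupport v, f p = 0) → Integrable f :=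
    fun f h1 h2 => (key f h1 h2).continuous.integrable_of_hasCompactSupport (hcs f h2)
  have hdint : ∀ f : ℝ × Coord n → ℂ, (∀ p ∈ O, ContDiffAt ℝ ∞ f p) →
      (∀ p ∉ tsupport v, f p = 0) → ∀ e, Integrable (fun p => fderiv ℝ f p e) ∧
        ∫ p, fderiv ℝ f p e = 0 := by
    intro f h1 h2 e
    have h3 := key f h1 h2
    refine ⟨Continuous.integrable_of_hasCompactSupport
      ((h3.continuous_fderiv (by simp)).clm_apply continuous_const) ((hcs f h2).fderiv_apply ℝ e),
      integral_fderiv_eq_zero volume (h3.of_le (by simp)) (hcs f h2) e⟩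
  have iK := hint (fun p => (Real.sqrt ‖(A p).det‖ : ℂ) * (conj (v p) * locK A q u p))
    (fun p hp => (hw p hp).mul ((hcv p).mul (contDiffAt_locK (hA p hp) (h0 p hp) (hq p hp)
      (hu p hp)))) (fun p hp => by simp [hv0 p hp])
  have iE := hint (fun p => (Real.sqrt ‖(A p).det‖ : ℂ) * locE A q v u p)
    (fun p hp => (hw p hp).mul (contDiffAt_locE (hA p hp) (h0 p hp) (hq p hp) hv.contDiffAt
      (hu p hp))) (fun p hp => by simp [locE, bil, hv0 p hp, hS0 p hp, hX0 p hp])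
  have d1 := hdint (fun p => (Real.sqrt ‖(A p).det‖ : ℂ) * (conj (v p) * dS u p))
    (fun p hp => (hw p hp).mul ((hcv p).mul (hSu p hp))) (fun p hp => by simp [hv0 p hp]) (1, 0)
  have d2 := fun j k => hdint (fun p => (Real.sqrt ‖(A p).det‖ : ℂ) *
        (conj (v p) * ((A p)⁻¹ j k * dX u p k)))
    (fun p hp => (hw p hp).mul ((hcv p).mul ((hB p hp j k).mul (hXu p hp k))))
    (fun p hp => by simp [hv0 p hp]) (0, stdVec j)
  symm
  rw [← sub_eq_zero, ← integral_sub iE iK]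
  have heq : ∀ p, (Real.sqrt ‖(A p).det‖ : ℂ) * locE A q v u p
      - (Real.sqrt ‖(A p).det‖ : ℂ) * (conj (v p) * locK A q u p) =
    dS (fun p => (Real.sqrt ‖(A p).det‖ : ℂ) * (conj (v p) * dS u p)) p
    + ∑ j, ∑ k, dX (fun p => (Real.sqrt ‖(A p).det‖ : ℂ) *
        (conj (v p) * ((A p)⁻¹ j k * dX u p k))) p j := by
    intro p
    by_cases hp : p ∈ tsupport v
    · exact locE_sub_locK (hA p (hvO hp)) (h0 p (hvO hp)) hv.contDiffAt (hu p (hvO hp))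
    · have hz : ∀ g : ℝ × Coord n → ℂ, ∀ e,
          fderiv ℝ (fun p => (Real.sqrt ‖(A p).det‖ : ℂ) * (conj (v p) * g p)) p e = 0 := by
        intro g e
        have : (fun p => (Real.sqrt ‖(A p).det‖ : ℂ) * (conj (v p) * g p)) =ᶠ[𝓝 p] fun _ => 0 := by
          filter_upwards [(isClosed_tsupport v).isOpen_compl.mem_nhds hp] with p' hp'
          simp [hv0 p' hp']
        rw [this.fderiv_eq]
        simp
      have hz1 : dS (fun p => (Real.sqrt ‖(A p).det‖ : ℂ) * (conj (v p) * dS u p)) p = 0 :=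
        hz _ _
      have hz2 : ∀ j k, dX (fun p => (Real.sqrt ‖(A p).det‖ : ℂ) *
        (conj (v p) * ((A p)⁻¹ j k * dX u p k))) p j = 0 := fun j k => hz _ _
      simp only [hz1, hz2]
      simp [locE, bil, hv0 p hp, hS0 p hp, hX0 p hp]
  have i1 : Integrable
      (fun p => dS (fun p => (Real.sqrt ‖(A p).det‖ : ℂ) * (conj (v p) * dS u p)) p) := d1.1
  have i2 : ∀ j k, Integrable (fun p => dX (fun p => (Real.sqrt ‖(A p).det‖ : ℂ) *
        (conj (v p) * ((A p)⁻¹ j k * dX u p k))) p j) := fun j k => (d2 j k).1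
  have e1 : ∫ p, dS (fun p => (Real.sqrt ‖(A p).det‖ : ℂ) * (conj (v p) * dS u p)) p = 0 := d1.2
  have i3 := fun j => integrable_finsetSum Finset.univ fun k _ => i2 j k
  simp only [heq]
  rw [integral_add i1 (integrable_finsetSum _ fun j _ => i3 j),
    integral_finsetSum _ fun j _ => i3 j, e1, zero_add]
  refine Finset.sum_eq_zero fun j _ => ?_
  rw [integral_finsetSum _ fun k _ => i2 j k]
  exact Finset.sum_eq_zero fun k _ => (d2 j k).2

/-- The Jacobian matrix of a map of the coordinate space. -/
def jac (τ : Coord n → Coord n) (x : Coord n) : Matrix (Fin n) (Fin n) ℝ :=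
  fun l j => fderiv ℝ τ x (stdVec j) l

theorem sum_smul_stdVec (x : Coord n) : ∑ l, x l • stdVec l = x := by
  have := (EuclideanSpace.basisFun (Fin n) ℝ).sum_repr x
  simpa [stdVec] using this

theorem det_jac (τ : Coord n → Coord n) (x : Coord n) : (jac τ x).det = (fderiv ℝ τ x).det := by
  have : jac τ x = LinearMap.toMatrix (EuclideanSpace.basisFun (Fin n) ℝ).toBasis
      (EuclideanSpace.basisFun (Fin n) ℝ).toBasis (fderiv ℝ τ x).toLinearMap := by
    ext l j
    simp [jac, LinearMap.toMatrix_apply, stdVec]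
  rw [this, LinearMap.det_toMatrix]

/-- The map `(s, x) ↦ (s, τ x)`. -/
def idProd (τ : Coord n → Coord n) (p : ℝ × Coord n) : ℝ × Coord n := (p.1, τ p.2)

theorem hasFDerivAt_idProd {τ : Coord n → Coord n} (hτ : DifferentiableAt ℝ τ p.2) :
    HasFDerivAt (idProd τ) ((ContinuousLinearMap.id ℝ ℝ).prodMap (fderiv ℝ τ p.2)) p :=
  HasFDerivAt.prodMap p (hasFDerivAt_id p.1) hτ.hasFDerivAt

theorem dS_comp_idProd {τ : Coord n → Coord n} (hτ : DifferentiableAt ℝ τ p.2)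
    (hu : DifferentiableAt ℝ u (idProd τ p)) : dS (u ∘ idProd τ) p = dS u (idProd τ p) := by
  rw [dS, (hu.hasFDerivAt.comp p (hasFDerivAt_idProd hτ)).fderiv]
  simp [dS]

theorem dX_comp_idProd {τ : Coord n → Coord n} (hτ : DifferentiableAt ℝ τ p.2)
    (hu : DifferentiableAt ℝ u (idProd τ p)) : dX (u ∘ idProd τ) p =
      ((jac τ p.2).map Complex.ofReal).transpose.mulVec (dX u (idProd τ p)) := by
  funext j
  rw [dX, (hu.hasFDerivAt.comp p (hasFDerivAt_idProd hτ)).fderiv]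
  simp only [ContinuousLinearMap.comp_apply, Matrix.mulVec, dotProduct,
    Matrix.transpose_apply, Matrix.map_apply, jac]
  have h : ((0 : ℝ), fderiv ℝ τ p.2 (stdVec j)) =
      ∑ l, (fderiv ℝ τ p.2 (stdVec j) l) • ((0 : ℝ), stdVec l) := by
    conv_lhs => rw [← sum_smul_stdVec (fderiv ℝ τ p.2 (stdVec j))]
    ext <;> simp [Prod.fst_sum, Prod.snd_sum]
  change fderiv ℝ u (idProd τ p) ((0 : ℝ), fderiv ℝ τ p.2 (stdVec j)) = _
  rw [h, map_sum]
  refine Finset.sum_congr rfl fun l _ => ?_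
  rw [map_smul, Complex.real_smul]
  rfl

variable {A₁ A₂ : ℝ × Coord n → Matrix (Fin n) (Fin n) ℂ} {τ : Coord n → Coord n}

theorem conj_mulVec_map (J : Matrix (Fin n) (Fin n) ℝ) (ξ : Fin n → ℂ) :
    (fun j => conj ((J.map Complex.ofReal).mulVec ξ j)) =
      (J.map Complex.ofReal).mulVec (fun j => conj (ξ j)) := by
  funext j
  simp [Matrix.mulVec, dotProduct]

theorem contDiffAt_jac (hτ : ContDiffAt ℝ ∞ τ p.2) (j k : Fin n) :
    ContDiffAt ℝ ∞ (fun p : ℝ × Coord n => jac τ p.2 j k) p := by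
  have h1 : ContDiffAt ℝ ∞ (fun x => fderiv ℝ τ x (stdVec k)) p.2 :=
    (hτ.fderiv_right (m := ∞) (by norm_num)).clm_apply contDiffAt_const
  have h2 : ContDiffAt ℝ ∞ (fun x => jac τ x j k) p.2 :=
    contDiffAt_euclidean.1 h1 j
  exact h2.comp p contDiffAt_snd

/-- The imaginary part of a logarithmic derivative ignores real factors. -/
theorem im_fderiv_div {E : Type*} [NormedAddCommGroup E] [NormedSpace ℝ E] {δ : E → ℝ}
    {D : E → ℂ} {p : E} (hδ : DifferentiableAt ℝ δ p) (hδ0 : δ p ≠ 0) (hD : DifferentiableAt ℝ D p)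
    (h0 : D p ≠ 0) (e : E) :
    (fderiv ℝ (fun p => (δ p : ℂ) * D p) p e / ((δ p : ℂ) * D p)).im =
      (fderiv ℝ D p e / D p).im := by
  have h1 : HasFDerivAt (fun q => (δ q : ℂ)) _ p :=
    (Complex.ofRealCLM.hasFDerivAt (x := δ p)).comp p hδ.hasFDerivAt
  rw [(h1.fun_mul hD.hasFDerivAt).fderiv]
  have h2 : (δ p : ℂ) ≠ 0 := by exact_mod_cast hδ0
  have h3 : (((δ p : ℂ) • fderiv ℝ D p + D p • Complex.ofRealCLM.comp (fderiv ℝ δ p)) e) /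
      ((δ p : ℂ) * D p) = fderiv ℝ D p e / D p + ((fderiv ℝ δ p e / δ p : ℝ) : ℂ) := by
    simp only [add_apply, smul_apply, smul_eq_mul, ContinuousLinearMap.comp_apply,
      Complex.ofRealCLM_apply]
    push_cast
    field_simp
  rw [h3, Complex.add_im, Complex.ofReal_im, add_zero]

/-- The energy density is invariant under coordinate changes. -/
theorem locE_idProd {q₁ q₂ u₁ u₂ v₁ v₂ : ℝ × Coord n → ℂ} (hτ : ContDiffAt ℝ ∞ τ p.2)
    (hJ : (jac τ p.2).det ≠ 0)
    (hA : ∀ᶠ p' in 𝓝 p, A₁ p' = ((jac τ p'.2).map Complex.ofReal).transpose * A₂ (idProd τ p') *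
      (jac τ p'.2).map Complex.ofReal)
    (hA₂ : ∀ j k, ContDiffAt ℝ ∞ (fun p => A₂ p j k) (idProd τ p)) (h0 : (A₂ (idProd τ p)).det ≠ 0)
    (hq : q₁ p = q₂ (idProd τ p)) (hu : u₁ =ᶠ[𝓝 p] u₂ ∘ idProd τ)
    (hv : v₁ =ᶠ[𝓝 p] v₂ ∘ idProd τ) (hu₂ : DifferentiableAt ℝ u₂ (idProd τ p))
    (hv₂ : DifferentiableAt ℝ v₂ (idProd τ p)) :
    locE A₁ q₁ v₁ u₁ p = locE A₂ q₂ v₂ u₂ (idProd τ p) := by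
  have hτd : DifferentiableAt ℝ τ p.2 := hτ.differentiableAt (by simp)
  have hSu : dS u₁ p = dS u₂ (idProd τ p) := by
    rw [dS, hu.fderiv_eq]; exact dS_comp_idProd hτd hu₂
  have hSv : dS v₁ p = dS v₂ (idProd τ p) := by
    rw [dS, hv.fderiv_eq]; exact dS_comp_idProd hτd hv₂
  have hXu : dX u₁ p = ((jac τ p.2).map Complex.ofReal).transpose.mulVec (dX u₂ (idProd τ p)) := by
    rw [← dX_comp_idProd hτd hu₂]
    funext j
    rw [dX, hu.fderiv_eq]; rfl
  have hXv : dX v₁ p = ((jac τ p.2).map Complex.ofReal).transpose.mulVec (dX v₂ (idProd τ p)) := by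
    rw [← dX_comp_idProd hτd hv₂]
    funext j
    rw [dX, hv.fderiv_eq]; rfl
  -- The two determinants differ by the real factor (det J)², whose logarithmic derivative is real.
  -- So Im d log det transforms as an honest covector, although log det itself is not a scalar.
  have hdet : (fun p => (A₁ p).det) =ᶠ[𝓝 p] fun p =>
      (((jac τ p.2).det ^ 2 : ℝ) : ℂ) * ((fun p => (A₂ p).det) ∘ idProd τ) p := by
    filter_upwards [hA] with p' hp'
    rw [hp', Matrix.det_mul, Matrix.det_mul, Matrix.det_transpose]
    have : ((jac τ p'.2).map Complex.ofReal).det = ((jac τ p'.2).det : ℂ) :=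
      (RingHom.map_det Complex.ofRealHom _).symm
    rw [this]
    simp only [Function.comp_apply]
    push_cast
    ring
  have hδ : DifferentiableAt ℝ (fun p : ℝ × Coord n => (jac τ p.2).det ^ 2) p :=
    ((contDiffAt_det (contDiffAt_jac hτ)).differentiableAt (by simp)).pow 2
  have hD₂ : DifferentiableAt ℝ (fun p => (A₂ p).det) (idProd τ p) :=
    (contDiffAt_det hA₂).differentiableAt (by simp)
  have hD₂' := hD₂.comp p (hasFDerivAt_idProd hτd).differentiableAt
  have him : ∀ e, (fderiv ℝ (fun p => (A₁ p).det) p e / (A₁ p).det).im =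
      (fderiv ℝ ((fun p => (A₂ p).det) ∘ idProd τ) p e / (A₂ (idProd τ p)).det).im := by
    intro e
    rw [hdet.fderiv_eq, hdet.eq_of_nhds]
    exact im_fderiv_div hδ (pow_ne_zero 2 hJ) hD₂' h0 e
  have hiS : imS A₁ p = imS A₂ (idProd τ p) := by
    simp only [imS]
    rw [← dS_comp_idProd hτd hD₂, dS, him]
    rfl
  have hiX : imX A₁ p =
      ((jac τ p.2).map Complex.ofReal).transpose.mulVec (imX A₂ (idProd τ p)) := by
    funext j
    simp only [imX]
    rw [dX, him]
    have := congrFun (dX_comp_idProd hτd hD₂) j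
    rw [dX] at this
    rw [this]
    simp only [Matrix.mulVec, dotProduct, Matrix.transpose_apply, Matrix.map_apply,
      Finset.sum_div, mul_div_assoc]
    rw [Complex.im_sum, Complex.ofReal_sum]
    refine Finset.sum_congr rfl fun l _ => ?_
    rw [Complex.im_ofReal_mul]
    push_cast
    rfl
  have hJu : IsUnit ((jac τ p.2).map Complex.ofReal).det := by
    rw [show ((jac τ p.2).map Complex.ofReal).det = ((jac τ p.2).det : ℂ) from
      (RingHom.map_det Complex.ofRealHom _).symm]
    exact isUnit_iff_ne_zero.2 (by exact_mod_cast hJ)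
  have hXv' : (fun j => conj (dX v₁ p j)) = ((jac τ p.2).map Complex.ofReal).transpose.mulVec
      (fun j => conj (dX v₂ (idProd τ p) j)) := by
    rw [hXv]
    exact conj_mulVec_map (jac τ p.2).transpose _
  simp only [locE]
  rw [hSu, hSv, hXu, hXv', hiS, hiX, hA.self_of_nhds, bil_inv_transform _ _ hJu,
    bil_inv_transform _ _ hJu, hq, hu.eq_of_nhds, hv.eq_of_nhds]
  rfl

end Local

/-! ### Changes of charts and the transformation law of Gram matrices. -/

section Charts

variable {n : ℕ} {S : Type*} [TopologicalSpace S] [ChartedSpace (Coord n) S]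

/-- The change of coordinates between two charts. -/
def trans (c c' : S) (x : Coord n) : Coord n := chart c' ((chart c).symm x)

/-- The map from coordinates to the manifold. -/
def toMfd (n : ℕ) {S : Type*} [TopologicalSpace S] [ChartedSpace (Coord n) S] (c : S)
    (p : ℝ × Coord n) : ℝ × S := (p.1, (chart c).symm p.2)

/-- The map from the manifold to coordinates. -/
def toCoord (n : ℕ) {S : Type*} [TopologicalSpace S] [ChartedSpace (Coord n) S] (c : S)
    (q : ℝ × S) : ℝ × Coord n := (q.1, chart c q.2)

theorem isOpen_source (c : S) : IsOpen (chart (n := n) c).source := isOpen_extChartAt_source c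

theorem isOpen_target (c : S) : IsOpen (chart (n := n) c).target := isOpen_extChartAt_target c

theorem continuousAt_symm {c : S} {x : Coord n} (hx : x ∈ (chart c).target) :
    ContinuousAt (chart c).symm x :=
  continuousAt_extChartAt_symm'' hx

theorem continuousAt_toMfd {c : S} {p : ℝ × Coord n} (hp : p.2 ∈ (chart c).target) :
    ContinuousAt (toMfd n c) p :=
  continuousAt_fst.prodMk ((continuousAt_symm hp).comp continuousAt_snd)

theorem continuousAt_toCoord {c : S} {q : ℝ × S} (hq : q.2 ∈ (chart (n := n) c).source) :
    ContinuousAt (toCoord n c) q :=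
  continuousAt_fst.prodMk
    (((continuousOn_extChartAt c).continuousAt ((isOpen_source c).mem_nhds hq)).comp
      continuousAt_snd)

theorem toMfd_toCoord {c : S} {q : ℝ × S} (hq : q.2 ∈ (chart (n := n) c).source) :
    toMfd n c (toCoord n c q) = q :=
  Prod.ext rfl ((chart c).left_inv hq)

theorem toCoord_toMfd {c : S} {p : ℝ × Coord n} (hp : p.2 ∈ (chart c).target) :
    toCoord n c (toMfd n c p) = p :=
  Prod.ext rfl ((chart c).right_inv hp)

theorem eventually_mem_overlap {c c' : S} {x : Coord n} (hx : x ∈ (chart c).target)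
    (hx' : (chart c).symm x ∈ (chart (n := n) c').source) :
    ∀ᶠ z in 𝓝 x, z ∈ (chart c).target ∧ (chart c).symm z ∈ (chart (n := n) c').source :=
  ((isOpen_target c).mem_nhds hx |> fun h => Filter.eventually_of_mem h fun _ h => h).and
    ((continuousAt_symm hx).eventually ((isOpen_source c').mem_nhds hx'))

theorem trans_mem_target {c c' : S} {x : Coord n}
    (hx' : (chart c).symm x ∈ (chart (n := n) c').source) : trans c c' x ∈ (chart c').target :=
  (chart c').map_source hx'

theorem symm_trans {c c' : S} {x : Coord n}
    (hx' : (chart c).symm x ∈ (chart (n := n) c').source) :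
    (chart c').symm (trans c c' x) = (chart c).symm x :=
  (chart c').left_inv hx'

/-- The derivative of the inverse of a chart, with tangent spaces identified with the coordinate
space. -/
def dSymm (c : S) (x : Coord n) : Coord n →L[ℝ] Coord n :=
  mfderiv 𝓘(ℝ, Coord n) (𝓡 n) (chart (n := n) c).symm x

/-- A field of bilinear forms, with tangent spaces identified with the coordinate space. -/
def formAt {F : Type*} [AddCommGroup F] [Module ℝ F]
    (b : ∀ y : S, TangentSpace (𝓡 n) y →ₗ[ℝ] TangentSpace (𝓡 n) y →ₗ[ℝ] F) (y : S) :
    Coord n →ₗ[ℝ] Coord n →ₗ[ℝ] F := b y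

theorem gram_eq_formAt {F : Type*} [AddCommGroup F] [Module ℝ F]
    (b : ∀ y : S, TangentSpace (𝓡 n) y →ₗ[ℝ] TangentSpace (𝓡 n) y →ₗ[ℝ] F) (c : S) (x : Coord n)
    (j k : Fin n) : gram b c x j k =
      formAt b ((chart c).symm x) (dSymm c x (stdVec j)) (dSymm c x (stdVec k)) := rfl

variable [IsManifold (𝓡 n) ω S]

theorem contDiffAt_trans {c c' : S} {x : Coord n} (hx : x ∈ (chart c).target)
    (hx' : (chart c).symm x ∈ (chart (n := n) c').source) : ContDiffAt ℝ ω (trans c c') x := by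
  have h := contDiffWithinAt_ext_coord_change (I := 𝓡 n) (n := ω) c' c (y := x) (by
    rw [PartialEquiv.trans_source]
    exact ⟨hx, hx'⟩)
  rw [modelWithCornersSelf_coe, Set.range_id, contDiffWithinAt_univ] at h
  exact h

theorem differentiableAt_trans {c c' : S} {x : Coord n} (hx : x ∈ (chart c).target)
    (hx' : (chart c).symm x ∈ (chart (n := n) c').source) :
    DifferentiableAt ℝ (trans c c') x :=
  (contDiffAt_trans hx hx').differentiableAt (by simp)

/-- The tangent space at a point is modelled on the preferred chart there, so in these terms the
derivative of an inverse chart is that of the transition map into the chart around the image point.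
-/
theorem dSymm_eq {c : S} {x : Coord n} (hx : x ∈ (chart c).target) :
    dSymm c x = fderiv ℝ (trans c ((chart c).symm x)) x := by
  have h : MDifferentiableAt 𝓘(ℝ, Coord n) (𝓡 n) (chart (n := n) c).symm x :=
    ((contMDiffOn_extChartAt_symm (n := ω) c).contMDiffAt
      ((isOpen_target c).mem_nhds hx)).mdifferentiableAt (by simp)
  refine Eq.trans (b := (fderivWithin ℝ (writtenInExtChartAt 𝓘(ℝ, Coord n) (𝓡 n) x
    (chart (n := n) c).symm) (range 𝓘(ℝ, Coord n)) (extChartAt 𝓘(ℝ, Coord n) x x)))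
    h.mfderiv ?_
  simp only [writtenInExtChartAt, extChartAt_model_space_eq_id, PartialEquiv.refl_coe,
    modelWithCornersSelf_coe, Set.range_id, fderivWithin_univ, id]
  rfl

/-- Chain rule for transition maps, with the preferred chart at the common image point as target of
both sides. -/
theorem dSymm_eq_comp {c c' : S} {x : Coord n} (hx : x ∈ (chart c).target)
    (hx' : (chart c).symm x ∈ (chart (n := n) c').source) :
    dSymm c x = (dSymm c' (trans c c' x)).comp (fderiv ℝ (trans c c') x) := by
  set y := (chart c).symm x with hy
  have hyy : y ∈ (chart (n := n) y).source := mem_extChartAt_source y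
  rw [dSymm_eq hx, dSymm_eq (trans_mem_target hx'), symm_trans hx', ← hy]
  rw [← fderiv_comp x (differentiableAt_trans (trans_mem_target hx') (by
    rw [symm_trans hx']; exact hyy)) (differentiableAt_trans hx hx')]
  refine Filter.EventuallyEq.fderiv_eq ?_
  filter_upwards [eventually_mem_overlap hx hx'] with z hz
  simp only [Function.comp_apply, trans]
  rw [(chart c').left_inv hz.2]

theorem gram_eq_sum {F : Type*} [AddCommGroup F] [Module ℝ F]
    (b : ∀ y : S, TangentSpace (𝓡 n) y →ₗ[ℝ] TangentSpace (𝓡 n) y →ₗ[ℝ] F)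
    {c c' : S} {x : Coord n} (hx : x ∈ (chart c).target)
    (hx' : (chart c).symm x ∈ (chart (n := n) c').source) (j k : Fin n) :
    gram b c x j k = ∑ l, ∑ m, jac (trans c c') x l j •
      jac (trans c c') x m k • gram b c' (trans c c' x) l m := by
  have h1 : ∀ j, dSymm c x (stdVec j) =
      ∑ l, jac (trans c c') x l j • dSymm c' (trans c c' x) (stdVec l) := by
    intro j
    rw [dSymm_eq_comp hx hx', ContinuousLinearMap.comp_apply]
    conv_lhs => rw [← sum_smul_stdVec (fderiv ℝ (trans c c') x (stdVec j))]
    simp only [map_sum, map_smul, jac]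
  simp only [gram_eq_formAt, h1]
  rw [symm_trans hx']
  simp only [map_sum, LinearMap.sum_apply, map_smul, LinearMap.smul_apply, Finset.smul_sum]
  rw [Finset.sum_comm]
  exact Finset.sum_congr rfl fun l _ => Finset.sum_congr rfl fun m _ => smul_comm _ _ _

theorem gram_real_eq (b : ∀ y : S, TangentSpace (𝓡 n) y →ₗ[ℝ] TangentSpace (𝓡 n) y →ₗ[ℝ] ℝ)
    {c c' : S} {x : Coord n} (hx : x ∈ (chart c).target)
    (hx' : (chart c).symm x ∈ (chart (n := n) c').source) :
    gram b c x = (jac (trans c c') x).transpose * gram b c' (trans c c' x) *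
      jac (trans c c') x := by
  ext j k
  rw [gram_eq_sum b hx hx', Matrix.mul_apply, Finset.sum_comm]
  refine Finset.sum_congr rfl fun m _ => ?_
  rw [Matrix.mul_apply, Finset.sum_mul]
  refine Finset.sum_congr rfl fun l _ => ?_
  simp only [smul_eq_mul, Matrix.transpose_apply]
  ring

theorem gram_complex_eq (b : ∀ y : S, TangentSpace (𝓡 n) y →ₗ[ℝ] TangentSpace (𝓡 n) y →ₗ[ℝ] ℂ)
    {c c' : S} {x : Coord n} (hx : x ∈ (chart c).target)
    (hx' : (chart c).symm x ∈ (chart (n := n) c').source) :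
    gram b c x = ((jac (trans c c') x).map Complex.ofReal).transpose *
      gram b c' (trans c c' x) * (jac (trans c c') x).map Complex.ofReal := by
  ext j k
  rw [gram_eq_sum b hx hx', Matrix.mul_apply, Finset.sum_comm]
  refine Finset.sum_congr rfl fun m _ => ?_
  rw [Matrix.mul_apply, Finset.sum_mul]
  refine Finset.sum_congr rfl fun l _ => ?_
  simp only [Complex.real_smul, Matrix.transpose_apply, Matrix.map_apply]
  ring

/-- The transition maps in the two directions are mutually inverse near the point, so their Jacobian
determinants multiply to 1. -/
theorem det_jac_trans_ne_zero {c c' : S} {x : Coord n} (hx : x ∈ (chart c).target)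
    (hx' : (chart c).symm x ∈ (chart (n := n) c').source) : (jac (trans c c') x).det ≠ 0 := by
  have h1 : trans c' c ∘ trans c c' =ᶠ[𝓝 x] id := by
    filter_upwards [eventually_mem_overlap hx hx'] with z hz
    simp only [Function.comp_apply, trans, id]
    rw [(chart c').left_inv hz.2, (chart c).right_inv hz.1]
  have hτ : DifferentiableAt ℝ (trans c c') x :=
    differentiableAt_trans hx hx'
  have hτ' : DifferentiableAt ℝ (trans c' c) (trans c c' x) :=
    (contDiffAt_trans (trans_mem_target hx') (by
      rw [symm_trans hx']; exact (chart c).map_target hx)).differentiableAt (by simp)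
  have h2 := h1.fderiv_eq (𝕜 := ℝ)
  rw [fderiv_comp x hτ' hτ, fderiv_id] at h2
  have h3 : (fderiv ℝ (trans c' c) (trans c c' x)).det * (fderiv ℝ (trans c c') x).det = 1 := by
    have h4 := congrArg ContinuousLinearMap.det h2
    refine Eq.trans (LinearMap.det_comp _ _).symm (h4.trans ?_)
    simp [ContinuousLinearMap.det]
  rw [det_jac]
  exact right_ne_zero_of_mul_eq_one h3

theorem sum_dSymm_ne_zero {c : S} {x : Coord n} (hx : x ∈ (chart c).target) {a : Fin n → ℝ}
    (ha : a ≠ 0) : dSymm c x (∑ j, a j • stdVec j) ≠ 0 := by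
  intro h
  have hd := det_jac_trans_ne_zero hx (mem_extChartAt_source (I := 𝓡 n) ((chart c).symm x))
  rw [det_jac, ← dSymm_eq hx] at hd
  have h3 : (∑ j, a j • stdVec j : Coord n) = 0 :=
    (LinearMap.equivOfDetNeZero (dSymm c x : Coord n →ₗ[ℝ] Coord n) hd).injective (by
      rw [map_zero]; exact h)
  apply ha
  funext k
  have := congrArg (fun v : Coord n => v k) h3
  simpa [stdVec, Pi.single_apply] using this

end Charts

/-! ### Bounds for the inverse of a positive definite matrix. -/

section MatrixEstimates

variable {ι : Type*} [Fintype ι] [DecidableEq ι]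

omit [DecidableEq ι] in
theorem norm_bil_le (M : Matrix ι ι ℂ) {ξ η : ι → ℂ} {r r' : ℝ} (hξ : ∀ j, ‖ξ j‖ ≤ r)
    (hη : ∀ j, ‖η j‖ ≤ r') (hr : 0 ≤ r) : ‖bil M ξ η‖ ≤ (∑ j, ∑ k, ‖M j k‖) * (r * r') := by
  rw [Finset.sum_mul]
  refine (norm_sum_le _ _).trans (Finset.sum_le_sum fun j _ => ?_)
  rw [Finset.sum_mul]
  refine (norm_sum_le _ _).trans (Finset.sum_le_sum fun k _ => ?_)
  rw [norm_mul, norm_mul, mul_comm ‖ξ j‖, mul_assoc]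
  exact mul_le_mul_of_nonneg_left (mul_le_mul (hξ j) (hη k) (norm_nonneg _) hr) (norm_nonneg _)

/-- H ≤ L implies H⁻¹ ≥ 1/L. This is read off from the positivity of H⁻¹ at a - L⁻¹ H a, which gives
a·H⁻¹a - 2 L⁻¹ a·a + L⁻² a·Ha ≥ 0, together with a·Ha ≤ L a·a. -/
theorem sq_le_mul_inv_form {H : Matrix ι ι ℝ} (hH : H.PosDef) {L : ℝ} (hL0 : 0 < L)
    (hL : ∑ j, ∑ k, |H j k| ≤ L) (a : ι → ℝ) :
    dotProduct a a ≤ L * dotProduct a (H⁻¹.mulVec a) := by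
  have hu : IsUnit H.det := (Matrix.isUnit_iff_isUnit_det H).1 hH.isUnit
  have hsym : H.transpose = H := by simpa using hH.1.eq
  have h1 : dotProduct a (H.mulVec a) ≤ L * dotProduct a a := by
    have hle : ∀ j k, a j * (H j k * a k) ≤ |H j k| * dotProduct a a := by
      intro j k
      have hj : a j * a j ≤ dotProduct a a :=
        Finset.single_le_sum (f := fun j => a j * a j) (fun i _ => mul_self_nonneg _)
          (Finset.mem_univ j)
      have hk : a k * a k ≤ dotProduct a a :=
        Finset.single_le_sum (f := fun j => a j * a j) (fun i _ => mul_self_nonneg _)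
          (Finset.mem_univ k)
      have h2 : |a j * a k| ≤ dotProduct a a := by
        rw [abs_le]; constructor <;> nlinarith [sq_nonneg (a j - a k), sq_nonneg (a j + a k)]
      calc a j * (H j k * a k) = H j k * (a j * a k) := by ring
        _ ≤ |H j k| * |a j * a k| := (le_abs_self _).trans (abs_mul _ _).le
        _ ≤ _ := mul_le_mul_of_nonneg_left h2 (abs_nonneg _)
    calc dotProduct a (H.mulVec a) = ∑ j, ∑ k, a j * (H j k * a k) := by
          simp only [dotProduct, Matrix.mulVec, Finset.mul_sum]
      _ ≤ ∑ j, ∑ k, |H j k| * dotProduct a a :=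
          Finset.sum_le_sum fun j _ => Finset.sum_le_sum fun k _ => hle j k
      _ = (∑ j, ∑ k, |H j k|) * dotProduct a a := by simp only [Finset.sum_mul]
      _ ≤ _ := mul_le_mul_of_nonneg_right hL
        (Finset.sum_nonneg fun i _ => mul_self_nonneg _)
  have h2 := hH.inv.posSemidef.dotProduct_mulVec_nonneg (a - L⁻¹ • H.mulVec a)
  have h3 : H⁻¹.mulVec (H.mulVec a) = a := by
    rw [Matrix.mulVec_mulVec, Matrix.nonsing_inv_mul _ hu, Matrix.one_mulVec]
  have h4 : dotProduct (H.mulVec a) (H⁻¹.mulVec a) = dotProduct a a := by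
    rw [← Matrix.vecMul_transpose, hsym, ← Matrix.dotProduct_mulVec, Matrix.mulVec_mulVec,
      Matrix.mul_nonsing_inv _ hu, Matrix.one_mulVec]
  rw [star_trivial, Matrix.mulVec_sub, Matrix.mulVec_smul, h3, sub_dotProduct, dotProduct_sub,
    dotProduct_sub, smul_dotProduct, smul_dotProduct, dotProduct_smul, dotProduct_smul, h4,
    dotProduct_comm (H.mulVec a) a] at h2
  simp only [smul_eq_mul] at h2
  have h5 : L⁻¹ * (L⁻¹ * dotProduct a (H.mulVec a)) ≤ L⁻¹ * dotProduct a a := by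
    refine mul_le_mul_of_nonneg_left ?_ (by positivity)
    rw [inv_mul_le_iff₀ hL0]
    exact h1
  have h6 : L⁻¹ * dotProduct a a ≤ dotProduct a (H⁻¹.mulVec a) := by linarith
  rwa [inv_mul_le_iff₀ hL0] at h6

/-- The hermitian form of a real symmetric matrix. -/
theorem bil_conj_eq {M : Matrix ι ι ℝ} (hM : M.transpose = M) (ξ : ι → ℂ) :
    bil (M.map Complex.ofReal) (fun j => conj (ξ j)) ξ =
      ((dotProduct (fun j => (ξ j).re) (M.mulVec fun j => (ξ j).re) +
        dotProduct (fun j => (ξ j).im) (M.mulVec fun j => (ξ j).im) : ℝ) : ℂ) := by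
  have h1 : ∑ j, ∑ k, M j k * ((ξ j).re * (ξ k).im - (ξ j).im * (ξ k).re) = 0 := by
    have h2 : ∑ j, ∑ k, M j k * ((ξ j).re * (ξ k).im - (ξ j).im * (ξ k).re) =
        - ∑ j, ∑ k, M j k * ((ξ j).re * (ξ k).im - (ξ j).im * (ξ k).re) := by
      conv_lhs => rw [Finset.sum_comm]
      simp only [← Finset.sum_neg_distrib]
      refine Finset.sum_congr rfl fun j _ => Finset.sum_congr rfl fun k _ => ?_
      rw [show M k j = M j k from congrFun (congrFun hM j) k]
      ring
    linarith
  have h3 : bil (M.map Complex.ofReal) (fun j => conj (ξ j)) ξ =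
      ((∑ j, ∑ k, M j k * ((ξ j).re * (ξ k).re + (ξ j).im * (ξ k).im) : ℝ) : ℂ) +
      ((∑ j, ∑ k, M j k * ((ξ j).re * (ξ k).im - (ξ j).im * (ξ k).re) : ℝ) : ℂ) * Complex.I := by
    push_cast
    simp only [bil, Finset.sum_mul, ← Finset.sum_add_distrib]
    refine Finset.sum_congr rfl fun j _ => Finset.sum_congr rfl fun k _ => ?_
    have e1 := (Complex.re_add_im (ξ k)).symm
    have e2 : conj (ξ j) = (ξ j).re - (ξ j).im * Complex.I := by
      apply Complex.ext <;> simp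
    rw [e2, Matrix.map_apply]
    conv_lhs => rw [e1]
    linear_combination (-(M j k : ℂ) * (ξ j).im * (ξ k).im) * Complex.I_sq
  rw [h3, h1]
  simp only [Complex.ofReal_zero, zero_mul, add_zero]
  congr 1
  simp only [dotProduct, Matrix.mulVec, Finset.mul_sum, ← Finset.sum_add_distrib]
  refine Finset.sum_congr rfl fun j _ => Finset.sum_congr rfl fun k _ => ?_
  ring

/-- A real symmetric matrix acts separately on real and imaginary parts, so the real estimate
`sq_le_mul_inv_form` is applied to each. -/
theorem bil_inv_conj {H : Matrix ι ι ℝ} (hH : H.PosDef) {L : ℝ} (hL0 : 0 < L)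
    (hL : ∑ j, ∑ k, |H j k| ≤ L) (ξ : ι → ℂ) :
    (bil (H⁻¹.map Complex.ofReal) (fun j => conj (ξ j)) ξ).im = 0 ∧
    ∀ j, ‖ξ j‖ ^ 2 ≤ L * (bil (H⁻¹.map Complex.ofReal) (fun j => conj (ξ j)) ξ).re := by
  have hsym : H⁻¹.transpose = H⁻¹ := by simpa using hH.inv.1.eq
  rw [bil_conj_eq hsym]
  refine ⟨Complex.ofReal_im _, fun j => ?_⟩
  rw [Complex.ofReal_re, mul_add, ← Complex.normSq_eq_norm_sq, Complex.normSq_apply]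
  refine add_le_add ?_ ?_
  · exact (Finset.single_le_sum (f := fun j => (ξ j).re * (ξ j).re)
      (fun i _ => mul_self_nonneg _) (Finset.mem_univ j)).trans
      (sq_le_mul_inv_form hH hL0 hL fun j => (ξ j).re)
  · exact (Finset.single_le_sum (f := fun j => (ξ j).im * (ξ j).im)
      (fun i _ => mul_self_nonneg _) (Finset.mem_univ j)).trans
      (sq_le_mul_inv_form hH hL0 hL fun j => (ξ j).im)

theorem map_inv_ofReal (H : Matrix ι ι ℝ) :
    (H.map Complex.ofReal)⁻¹ = H⁻¹.map Complex.ofReal := by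
  by_cases h : IsUnit H.det
  · refine Matrix.inv_eq_left_inv ?_
    have := congrArg (fun M : Matrix ι ι ℝ => M.map Complex.ofReal) (Matrix.nonsing_inv_mul H h)
    have e : (H⁻¹ * H).map Complex.ofReal = H⁻¹.map Complex.ofReal * H.map Complex.ofReal :=
      Matrix.map_mul (f := Complex.ofRealHom)
    simp only [e] at this
    rw [this]
    exact Matrix.map_one _ Complex.ofReal_zero Complex.ofReal_one
  · have h' : ¬ IsUnit (H.map Complex.ofReal).det := by
      rw [show (H.map Complex.ofReal).det = (H.det : ℂ) from (RingHom.map_det Complex.ofRealHom _).symm]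
      simpa [isUnit_iff_ne_zero] using h
    rw [Matrix.nonsing_inv_apply_not_isUnit _ h, Matrix.nonsing_inv_apply_not_isUnit _ h']
    ext
    simp

end MatrixEstimates

/-! ### Regularity of the metric coefficients in charts, and the ratio of the two densities. -/

section Smoothness

variable {n : ℕ} {S : Type*} [TopologicalSpace S] [ChartedSpace (Coord n) S]
  [IsManifold (𝓡 n) ω S]

theorem contMDiffAt_toMfd {c : S} {p : ℝ × Coord n} (hp : p.2 ∈ (chart c).target) :
    ContMDiffAt 𝓘(ℝ, ℝ × Coord n) (𝓘(ℝ, ℝ).prod (𝓡 n)) ω (toMfd n c) p := by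
  have h1 : ContMDiffAt 𝓘(ℝ, Coord n) (𝓡 n) ω (chart (n := n) c).symm p.2 :=
    (contMDiffOn_extChartAt_symm (n := ω) c).contMDiffAt ((isOpen_target c).mem_nhds hp)
  have h2 : ContMDiffAt 𝓘(ℝ, ℝ × Coord n) 𝓘(ℝ, Coord n) ω (Prod.snd : ℝ × Coord n → Coord n) p :=
    contDiffAt_snd.contMDiffAt
  have h3 : ContMDiffAt 𝓘(ℝ, ℝ × Coord n) 𝓘(ℝ, ℝ) ω (Prod.fst : ℝ × Coord n → ℝ) p :=
    contDiffAt_fst.contMDiffAt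
  exact h3.prodMk (h1.comp p h2)

theorem contDiffAt_comp_toMfd {u : ℝ × S → ℂ}
    (hu : ContMDiff (𝓘(ℝ, ℝ).prod (𝓡 n)) 𝓘(ℝ, ℂ) ∞ u) {c : S} {p : ℝ × Coord n}
    (hp : p.2 ∈ (chart c).target) : ContDiffAt ℝ ∞ (u ∘ toMfd n c) p :=
  contMDiffAt_iff_contDiffAt.1
    ((hu.contMDiffAt).comp p ((contMDiffAt_toMfd hp).of_le le_top))

variable {G : AnalyticKGData n S}

/-- The matrix of the metric at time `0`, in coordinates. -/
def gram0 (G : AnalyticKGData n S) (c : S) (p : ℝ × Coord n) : Matrix (Fin n) (Fin n) ℝ :=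
  gram (G.metric 0) c p.2

/-- The matrix of the Wick rotated metric, in coordinates. -/
def gramW (W : HolExtension G) (c : S) (p : ℝ × Coord n) : Matrix (Fin n) (Fin n) ℂ :=
  gram (W.metric (Complex.I * (p.1 : ℂ))) c p.2

/-- The Wick rotated potential, in coordinates. -/
def potW (W : HolExtension G) (c : S) (p : ℝ × Coord n) : ℂ :=
  W.potential (Complex.I * (p.1 : ℂ), (chart c).symm p.2)

theorem isOpen_wickDom (W : HolExtension G) : IsOpen W.wickDom :=
  W.isOpen_dom.preimage (by fun_prop)

omit [IsManifold (𝓡 n) ω S] in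
theorem gram0_posDef (G : AnalyticKGData n S) [IsManifold (𝓡 n) ω S] {c : S} {p : ℝ × Coord n}
    (hp : p.2 ∈ (chart c).target) : (gram0 G c p).PosDef := by
  set y := (chart c).symm p.2 with hy
  have hsym : ∀ v w : Coord n, formAt (G.metric 0) y v w = formAt (G.metric 0) y w v :=
    G.metric_symm 0 y (G.zero_mem y)
  have hpos : ∀ v : Coord n, v ≠ 0 → 0 < formAt (G.metric 0) y v v :=
    G.metric_pos 0 y (G.zero_mem y)
  refine Matrix.PosDef.of_dotProduct_mulVec_pos ?_ fun a ha => ?_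
  · ext j k
    simp only [Matrix.conjTranspose_apply, star_trivial, gram0, gram_eq_formAt]
    exact hsym _ _
  · have h := hpos _ (sum_dSymm_ne_zero hp ha)
    simp only [map_sum, map_smul, LinearMap.sum_apply, LinearMap.smul_apply, smul_eq_mul] at h
    simp only [Finset.mul_sum] at h
    simp only [star_trivial, dotProduct, Matrix.mulVec, Finset.mul_sum, gram0, gram_eq_formAt]
    refine h.trans_le (le_of_eq ?_)
    refine Finset.sum_congr rfl fun j _ => Finset.sum_congr rfl fun k _ => ?_
    rw [hsym]
    ring

theorem contDiffAt_gram0 (G : AnalyticKGData n S) {c : S} {p : ℝ × Coord n}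
    (hp : p.2 ∈ (chart c).target) (j k : Fin n) :
    ContDiffAt ℝ ∞ (fun p => gram0 G c p j k) p := by
  have h1 := (G.metric_analytic c j k (0, p.2) ⟨hp, G.zero_mem _⟩).contDiffAt (n := ∞)
  have h2 : ContDiffAt ℝ ∞ (fun p : ℝ × Coord n => ((0 : ℝ), p.2)) p :=
    contDiffAt_const.prodMk contDiffAt_snd
  exact ContDiffAt.comp (x := p) (g := fun p : ℝ × Coord n => gram (G.metric p.1) c p.2 j k) h1 h2

theorem contDiff_wick {E : Type*} [NormedAddCommGroup E] [NormedSpace ℝ E] {m : WithTop ℕ∞} :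
    ContDiff ℝ m (fun p : ℝ × E => (Complex.I * (p.1 : ℂ), p.2)) :=
  (contDiff_const.mul (Complex.ofRealCLM.contDiff.comp contDiff_fst)).prodMk contDiff_snd

theorem contDiffAt_gramW (W : HolExtension G) {c : S} {p : ℝ × Coord n}
    (hp : p.2 ∈ (chart c).target) (hpW : toMfd n c p ∈ W.wickDom) (j k : Fin n) :
    ContDiffAt ℝ ∞ (fun p => gramW W c p j k) p := by
  have h1 := (W.metric_analytic c j k (Complex.I * (p.1 : ℂ), p.2) ⟨hp, hpW⟩).contDiffAt (n := ∞)
  exact ContDiffAt.comp (x := p) (g := fun p : ℂ × Coord n => gram (W.metric p.1) c p.2 j k) h1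
    contDiff_wick.contDiffAt

theorem contDiffAt_potW (W : HolExtension G) {c : S} {p : ℝ × Coord n}
    (hp : p.2 ∈ (chart c).target) (hpW : toMfd n c p ∈ W.wickDom) :
    ContDiffAt ℝ ∞ (potW W c) p := by
  have h1 : ContMDiffAt 𝓘(ℝ, Coord n) (𝓡 n) ω (chart (n := n) c).symm p.2 :=
    (contMDiffOn_extChartAt_symm (n := ω) c).contMDiffAt ((isOpen_target c).mem_nhds hp)
  have h2 : ContMDiffAt 𝓘(ℝ, ℝ × Coord n) 𝓘(ℝ, Coord n) ω (Prod.snd : ℝ × Coord n → Coord n) p :=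
    contDiffAt_snd.contMDiffAt
  have h3 : ContMDiffAt 𝓘(ℝ, ℝ × Coord n) 𝓘(ℝ, ℂ) ω
      (fun p : ℝ × Coord n => Complex.I * (p.1 : ℂ)) p :=
    (contDiff_fst.comp contDiff_wick).contDiffAt.contMDiffAt
  have h4 : ContMDiffAt (𝓘(ℝ, ℂ).prod (𝓡 n)) 𝓘(ℝ, ℂ) ω W.potential
      (Complex.I * (p.1 : ℂ), (chart c).symm p.2) :=
    W.potential_analytic.contMDiffAt (W.isOpen_dom.mem_nhds hpW)
  exact (contMDiffAt_iff_contDiffAt.1 (h4.comp p (h3.prodMk (h1.comp p h2)))).of_le le_top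

theorem det_map_ofReal {ι : Type*} [Fintype ι] [DecidableEq ι] (J : Matrix ι ι ℝ) :
    (J.map Complex.ofReal).det = (J.det : ℂ) :=
  (RingHom.map_det Complex.ofRealHom _).symm

/-- Nondegeneracy is postulated only in the chart around the point itself; the invertible Jacobian
carries it to any other chart. -/
theorem gramW_det_ne_zero (W : HolExtension G) {c : S} {p : ℝ × Coord n}
    (hp : p.2 ∈ (chart c).target) (hpW : toMfd n c p ∈ W.wickDom) : (gramW W c p).det ≠ 0 := by
  have hx' := mem_extChartAt_source (I := 𝓡 n) ((chart c).symm p.2)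
  rw [gramW, gram_complex_eq _ hp hx', Matrix.det_mul, Matrix.det_mul, Matrix.det_transpose,
    det_map_ofReal]
  have h1 : ((jac (trans c ((chart c).symm p.2)) p.2).det : ℂ) ≠ 0 := by
    exact_mod_cast det_jac_trans_ne_zero hp hx'
  exact mul_ne_zero (mul_ne_zero h1 (W.metric_nondegenerate _ _ hpW)) h1

/-- The base point of the perturbation argument: at s = 0 the rotated and the original times
coincide. -/
theorem gramW_zero (W : HolExtension G) (c : S) (x : Coord n) :
    gramW W c (0, x) = (gram0 G c (0, x)).map Complex.ofReal := by
  ext j k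
  have h := W.metric_extends 0 ((chart c).symm x) (G.zero_mem _) (by
    simpa using W.zero_mem ((chart c).symm x))
  simp only [gramW, gram0, Matrix.map_apply, gram, Complex.ofReal_zero, mul_zero] at *
  exact h _ _

/-- The ratio of the densities `|ĥ_s|^{1/2}` and `|h_0|^{1/2}`. -/
def theta (W : HolExtension G) (q : ℝ × S) : ℝ :=
  Real.sqrt (‖(gramW W q.2 (toCoord n q.2 q)).det‖ / (gram0 G q.2 (toCoord n q.2 q)).det)

/-- Both determinants acquire the square of the same Jacobian, up to modulus, so their ratio may be
computed in any chart. -/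
theorem theta_toMfd (W : HolExtension G) {c : S} {p : ℝ × Coord n}
    (hp : p.2 ∈ (chart c).target) :
    theta W (toMfd n c p) = Real.sqrt (‖(gramW W c p).det‖ / (gram0 G c p).det) := by
  have hx' := mem_extChartAt_source (I := 𝓡 n) ((chart c).symm p.2)
  have h0 := det_jac_trans_ne_zero hp hx'
  have e1 : (gramW W c p).det = ((jac (trans c ((chart c).symm p.2)) p.2).det : ℂ) *
      (gramW W ((chart c).symm p.2) (toCoord n ((chart c).symm p.2) (toMfd n c p))).det *
      ((jac (trans c ((chart c).symm p.2)) p.2).det : ℂ) := by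
    rw [gramW, gram_complex_eq _ hp hx', Matrix.det_mul, Matrix.det_mul, Matrix.det_transpose,
      det_map_ofReal]
    rfl
  have e2 : (gram0 G c p).det = (jac (trans c ((chart c).symm p.2)) p.2).det *
      (gram0 G ((chart c).symm p.2) (toCoord n ((chart c).symm p.2) (toMfd n c p))).det *
      (jac (trans c ((chart c).symm p.2)) p.2).det := by
    rw [gram0, gram_real_eq _ hp hx', Matrix.det_mul, Matrix.det_mul, Matrix.det_transpose]
    rfl
  have haux : ∀ d N M : ℝ, d ≠ 0 → |d| * N * |d| / (d * M * d) = N / M := by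
    intro d N M hd
    rw [mul_right_comm, abs_mul_abs_self, show d * M * d = d * d * M by ring,
      mul_div_mul_left _ _ (mul_ne_zero hd hd)]
  rw [e1, e2, norm_mul, norm_mul, Complex.norm_real, Real.norm_eq_abs, haux _ _ _ h0]
  rfl

/-- A function on the product is continuous if its expressions in charts are. -/
theorem continuousAt_of_toMfd {X : Type*} [TopologicalSpace X] {F : ℝ × S → X} {q : ℝ × S} {c : S}
    (hq : q.2 ∈ (chart (n := n) c).source) {f : ℝ × Coord n → X}
    (hf : ContinuousAt f (toCoord n c q))
    (h : ∀ p : ℝ × Coord n, p.2 ∈ (chart c).target → F (toMfd n c p) = f p) :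
    ContinuousAt F q := by
  have h1 : ContinuousAt (f ∘ toCoord n c) q := hf.comp (continuousAt_toCoord hq)
  refine h1.congr ?_
  have h2 : ∀ᶠ q' : ℝ × S in 𝓝 q, q'.2 ∈ (chart (n := n) c).source :=
    continuousAt_snd.eventually ((isOpen_source c).mem_nhds hq)
  filter_upwards [h2] with q' hq'
  rw [Function.comp_apply, ← h _ ((chart c).map_source hq'), toMfd_toCoord hq']

theorem continuousAt_theta (W : HolExtension G) {q : ℝ × S} (hq : q ∈ W.wickDom) :
    ContinuousAt (theta W) q := by
  have hs := mem_extChartAt_source (I := 𝓡 n) q.2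
  have ht := (chart (n := n) q.2).map_source hs
  refine continuousAt_of_toMfd (c := q.2) hs ?_ fun p hp => theta_toMfd W hp
  have hq' : toMfd n q.2 (toCoord n q.2 q) ∈ W.wickDom := by rwa [toMfd_toCoord hs]
  have h1 := (contDiffAt_det (contDiffAt_gramW W (p := toCoord n q.2 q) ht hq')).continuousAt
  have h2 := (contDiffAt_det (contDiffAt_gram0 G (p := toCoord n q.2 q) ht)).continuousAt
  exact (h1.norm.div h2 (gram0_posDef G (p := toCoord n q.2 q) ht).det_pos.ne').sqrt

end Smoothness

/-! ### Measures given by densities, independently of the chart cover. -/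

section Measures

variable {n : ℕ} {S : Type*} [TopologicalSpace S] [ChartedSpace (Coord n) S]
  [IsManifold (𝓡 n) ω S] [SecondCountableTopology S] [MeasurableSpace S] [BorelSpace S]

/-- Positive continuous functions in the charts that transform as densities. -/
structure IsDensity (r : S → ℝ × Coord n → ℝ) : Prop where
  cont : ∀ c p, p.2 ∈ (chart (n := n) c).target → ContinuousAt (r c) p
  pos : ∀ c p, p.2 ∈ (chart (n := n) c).target → 0 < r c p
  transform : ∀ c c' p, p.2 ∈ (chart (n := n) c).target →
    (chart c).symm p.2 ∈ (chart (n := n) c').source →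
    r c p = |(jac (trans c c') p.2).det| * r c' (idProd (trans c c') p)

/-- The points whose second component lies in a coordinate patch. -/
def patch (n : ℕ) {S : Type*} [TopologicalSpace S] [ChartedSpace (Coord n) S] (c : S) :
    Set (ℝ × S) := {q | q.2 ∈ (chart (n := n) c).source}

/-- The coordinates of the points of a patch. -/
def cpatch (n : ℕ) {S : Type*} [TopologicalSpace S] [ChartedSpace (Coord n) S] (c : S) :
    Set (ℝ × Coord n) := {p | p.2 ∈ (chart (n := n) c).target}

theorem isOpen_patch (c : S) : IsOpen (patch n c) := (isOpen_source c).preimage continuous_snd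

theorem isOpen_cpatch (c : S) : IsOpen (cpatch n c) := (isOpen_target c).preimage continuous_snd

theorem measurableSet_cpatch_inter (c : S) {T : Set (ℝ × S)} (hT : MeasurableSet T) :
    MeasurableSet (cpatch n c ∩ toMfd n c ⁻¹' T) := by
  have h1 : ContinuousOn (toMfd n c) (cpatch n c) := fun p hp =>
    (continuousAt_toMfd hp).continuousWithinAt
  have h2 := (continuousOn_iff_continuous_domRestrict.1 h1).measurable hT
  have h3 := MeasurableSet.subtype_image (isOpen_cpatch c).measurableSet h2
  convert h3 using 1
  ext p
  simp only [mem_inter_iff, mem_preimage, mem_image, Subtype.exists, Set.domRestrict_apply,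
    exists_and_right, exists_eq_right]
  exact ⟨fun ⟨h, h'⟩ => ⟨h, h'⟩, fun ⟨h, h'⟩ => ⟨h, h'⟩⟩

/-- The measure with density `r c` in the coordinates of the chart around `c`. -/
def patchMeasure (r : S → ℝ × Coord n → ℝ) (c : S) : Measure (ℝ × S) :=
  Measure.map (toMfd n c)
    ((volume.restrict (cpatch n c)).withDensity fun p => ENNReal.ofReal (r c p))

variable {r : S → ℝ × Coord n → ℝ}

theorem aemeasurable_toMfd (c : S) (f : ℝ × Coord n → ℝ≥0∞) :
    AEMeasurable (toMfd n c) ((volume.restrict (cpatch n c)).withDensity f) := by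
  have h1 : ContinuousOn (toMfd n c) (cpatch n c) := fun p hp =>
    (continuousAt_toMfd hp).continuousWithinAt
  exact (h1.aemeasurable (isOpen_cpatch c).measurableSet).mono_ac
    (withDensity_absolutelyContinuous _ _)

theorem patchMeasure_apply (c : S) {T : Set (ℝ × S)} (hT : MeasurableSet T) :
    patchMeasure r c T = ∫⁻ p in cpatch n c ∩ toMfd n c ⁻¹' T, ENNReal.ofReal (r c p) := by
  rw [patchMeasure, Measure.map_apply_of_aemeasurable (aemeasurable_toMfd c _) hT]
  have h1 : ((volume.restrict (cpatch n c)).withDensity fun p => ENNReal.ofReal (r c p))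
      (toMfd n c ⁻¹' T) =
      ((volume.restrict (cpatch n c)).withDensity fun p => ENNReal.ofReal (r c p))
      (cpatch n c ∩ toMfd n c ⁻¹' T) := by
    refine measure_congr ?_
    have h2 : ∀ᵐ p ∂((volume.restrict (cpatch n c)).withDensity fun p => ENNReal.ofReal (r c p)),
        p ∈ cpatch n c := (withDensity_absolutelyContinuous _ _).ae_le
          (ae_restrict_mem (isOpen_cpatch c).measurableSet)
    filter_upwards [h2] with p hp
    exact propext ⟨fun h => ⟨hp, h⟩, fun h => h.2⟩
  rw [h1, withDensity_apply _ (measurableSet_cpatch_inter c hT),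
    Measure.restrict_restrict (measurableSet_cpatch_inter c hT), inter_right_comm, inter_self]

/-- The change of variables formula on the overlap: the Jacobian of the transition map is exactly
the factor in the transformation law of densities. -/
theorem patchMeasure_restrict_patch (hr : IsDensity r) (c c' : S) :
    (patchMeasure r c).restrict (patch n c') = (patchMeasure r c').restrict (patch n c) := by
  ext T hT
  rw [Measure.restrict_apply hT, Measure.restrict_apply hT,
    patchMeasure_apply c (hT.inter (isOpen_patch c').measurableSet),
    patchMeasure_apply c' (hT.inter (isOpen_patch c).measurableSet)]
  set B := cpatch n c ∩ toMfd n c ⁻¹' (T ∩ patch n c') with hB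
  have hmem : ∀ p ∈ B, p.2 ∈ (chart (n := n) c).target ∧
      (chart c).symm p.2 ∈ (chart (n := n) c').source := fun p hp => ⟨hp.1, hp.2.2⟩
  have himage : cpatch n c' ∩ toMfd n c' ⁻¹' (T ∩ patch n c) = idProd (trans c c') '' B := by
    ext p
    constructor
    · rintro ⟨h1, h2, h3⟩
      have hs : (chart c').symm p.2 ∈ (chart (n := n) c).source := h3
      have e1 : (chart c).symm (trans c' c p.2) = (chart c').symm p.2 := symm_trans hs
      refine ⟨idProd (trans c' c) p, ⟨trans_mem_target hs, ?_, ?_⟩, ?_⟩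
      · have e2 : toMfd n c (idProd (trans c' c) p) = toMfd n c' p := Prod.ext rfl e1
        rw [e2]; exact h2
      · change (chart c).symm (trans c' c p.2) ∈ (chart (n := n) c').source
        rw [e1]; exact (chart c').map_target h1
      · refine Prod.ext rfl ?_
        change chart c' ((chart c).symm (trans c' c p.2)) = p.2
        rw [e1, (chart c').right_inv h1]
    · rintro ⟨p, hp, rfl⟩
      have hs := (hmem p hp).2
      have e1 : (chart c').symm (trans c c' p.2) = (chart c).symm p.2 := symm_trans hs
      have e2 : toMfd n c' (idProd (trans c c') p) = toMfd n c p := Prod.ext rfl e1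
      refine ⟨trans_mem_target hs, ?_⟩
      rw [mem_preimage, e2]
      exact ⟨hp.2.1, (chart c).map_target hp.1⟩
  rw [himage, lintegral_image_eq_lintegral_abs_det_fderiv_mul volume
    (f' := fun p => (ContinuousLinearMap.id ℝ ℝ).prodMap (fderiv ℝ (trans c c') p.2))
    (measurableSet_cpatch_inter c (hT.inter (isOpen_patch c').measurableSet))
    (fun p hp => (hasFDerivAt_idProd
      (differentiableAt_trans (hmem p hp).1 (hmem p hp).2)).hasFDerivWithinAt)]
  · refine setLIntegral_congr_fun
      (measurableSet_cpatch_inter c (hT.inter (isOpen_patch c').measurableSet)) fun p hp => ?_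
    have hdet : ((ContinuousLinearMap.id ℝ ℝ).prodMap (fderiv ℝ (trans c c') p.2)).det =
        (jac (trans c c') p.2).det := by
      rw [det_jac]
      refine (LinearMap.det_prodMap _ _).trans ?_
      simp [ContinuousLinearMap.det]
    simp only [hdet]
    rw [← ENNReal.ofReal_mul (abs_nonneg _), ← hr.transform c c' p (hmem p hp).1 (hmem p hp).2]
  · intro p hp p' hp' h
    have h1 := congrArg Prod.fst h
    have h2 := congrArg (fun z => (chart c').symm (Prod.snd z)) h
    simp only [idProd] at h1 h2
    rw [symm_trans (hmem p hp).2, symm_trans (hmem p' hp').2] at h2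
    exact Prod.ext h1 ((chart c).symm.injOn (hmem p hp).1 (hmem p' hp').1 h2)

theorem patchMeasure_compl (c : S) : patchMeasure r c (patch n c)ᶜ = 0 := by
  rw [patchMeasure_apply c (isOpen_patch c).measurableSet.compl]
  have : cpatch n c ∩ toMfd n c ⁻¹' (patch n c)ᶜ = ∅ := by
    ext p
    simp only [mem_inter_iff, mem_preimage, mem_compl_iff, mem_empty_iff_false, iff_false, not_and,
      not_not]
    exact fun hp => (chart c).map_target hp
  rw [this]
  simp

variable [Nonempty S]

/-- This removes the arbitrary cover from the construction: on each patch the glued measure is the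
coordinate one, so integrals of functions supported in a patch can be computed there. -/
theorem densityMeasure_restrict_patch (hr : IsDensity r) (c : S) :
    (densityMeasure fun c p => ENNReal.ofReal (r c p)).restrict (patch n c) =
      patchMeasure r c := by
  set d : ℕ → S := (exists_chart_cover n S).choose with hd
  have hcov : ⋃ i, (chart (n := n) (d i)).source = univ := (exists_chart_cover n S).choose_spec
  set A : ℕ → Set (ℝ × S) := disjointed fun i => patch n (d i) with hA
  have hAm : ∀ i, MeasurableSet (A i) :=
    MeasurableSet.disjointed fun i => (isOpen_patch (d i)).measurableSet
  have hAmem : ∀ i q, q ∈ A i ↔ q ∈ patch n (d i) ∧ ∀ j < i, q ∉ patch n (d j) := by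
    intro i q
    rw [hA, disjointed_eq_inter_compl]
    simp
  have hAu : ⋃ i, A i = univ := by
    rw [iUnion_disjointed]
    ext q
    have := mem_univ q.2
    rw [← hcov] at this
    simpa [patch] using this
  have hpiece : ∀ i, Measure.map (fun p : ℝ × Coord n => (p.1, (chart (d i)).symm p.2))
      (((volume : Measure (ℝ × Coord n)).restrict
        {p | p.2 ∈ (chart (n := n) (d i)).target ∧
          ∀ j < i, (chart (d i)).symm p.2 ∉ (chart (n := n) (d j)).source}).withDensity
          (fun p => ENNReal.ofReal (r (d i) p))) = (patchMeasure r (d i)).restrict (A i) := by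
    intro i
    have h1 : {p : ℝ × Coord n | p.2 ∈ (chart (n := n) (d i)).target ∧
        ∀ j < i, (chart (d i)).symm p.2 ∉ (chart (n := n) (d j)).source} =
        cpatch n (d i) ∩ toMfd n (d i) ⁻¹' (A i) := by
      ext p
      simp only [mem_inter_iff, mem_preimage, hAmem]
      exact ⟨fun h => ⟨h.1, (chart (d i)).map_target h.1, h.2⟩, fun h => ⟨h.1, h.2.2⟩⟩
    have hm := measurableSet_cpatch_inter (n := n) (d i) (hAm i)
    rw [h1, patchMeasure, Measure.restrict_map_of_aemeasurable (aemeasurable_toMfd _ _) (hAm i)]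
    change Measure.map (toMfd n (d i)) _ = _
    congr 1
    have h2 : ((volume.restrict (cpatch n (d i))).withDensity
        fun p => ENNReal.ofReal (r (d i) p)).restrict (toMfd n (d i) ⁻¹' A i) =
        ((volume.restrict (cpatch n (d i))).withDensity
        fun p => ENNReal.ofReal (r (d i) p)).restrict (cpatch n (d i) ∩ toMfd n (d i) ⁻¹' A i) := by
      refine Measure.restrict_congr_set ?_
      have h2 : ∀ᵐ p ∂((volume.restrict (cpatch n (d i))).withDensity
          fun p => ENNReal.ofReal (r (d i) p)), p ∈ cpatch n (d i) :=
        (withDensity_absolutelyContinuous _ _).ae_le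
          (ae_restrict_mem (isOpen_cpatch (d i)).measurableSet)
      filter_upwards [h2] with p hp
      exact propext ⟨fun h => ⟨hp, h⟩, fun h => h.2⟩
    rw [h2, restrict_withDensity hm, Measure.restrict_restrict hm, inter_right_comm, inter_self]
  have h0 : (densityMeasure fun c p => ENNReal.ofReal (r c p)) =
      Measure.sum fun i => (patchMeasure r (d i)).restrict (A i) := by
    rw [densityMeasure]
    congr 1
    funext i
    exact hpiece i
  have hown : ∀ c, (patchMeasure r c).restrict (patch n c) = patchMeasure r c := fun c =>
    Measure.restrict_eq_self_of_ae_mem (by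
      rw [ae_iff]
      exact patchMeasure_compl c)
  rw [h0, Measure.restrict_sum _ (isOpen_patch c).measurableSet]
  -- The i-th piece lies in the patch of `d i`, where the measures of `d i` and of `c` agree on the
  -- overlap.
  have h3 : ∀ i, ((patchMeasure r (d i)).restrict (A i)).restrict (patch n c) =
      (patchMeasure r c).restrict (A i) := by
    intro i
    rw [Measure.restrict_comm (isOpen_patch c).measurableSet, patchMeasure_restrict_patch hr,
      Measure.restrict_restrict (hAm i), inter_eq_left.2 fun q hq => ((hAmem i q).1 hq).1]
  simp only [h3]
  rw [← Measure.restrict_iUnion (disjoint_disjointed _) hAm, hAu, Measure.restrict_univ]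

/-- A change of the density by a factor on an open set. -/
theorem densityMeasure_restrict_eq_withDensity (hr : IsDensity r) {ρ : S → ℝ × Coord n → ℝ≥0∞}
    {θ : ℝ × S → ℝ≥0∞} (hθ : Measurable θ) {Ω : Set (ℝ × S)} (hΩ : MeasurableSet Ω)
    (h : ∀ c, ∀ p ∈ cpatch n c, toMfd n c p ∈ Ω →
      ρ c p = θ (toMfd n c p) * ENNReal.ofReal (r c p)) :
    (densityMeasure ρ).restrict Ω =
      ((densityMeasure fun c p => ENNReal.ofReal (r c p)).restrict Ω).withDensity θ := by
  -- Both measures are glued from the same pieces of the same cover, so they are compared piece by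
  -- piece; ρ itself need not transform as a density.
  rw [densityMeasure, densityMeasure, Measure.restrict_sum _ hΩ, Measure.restrict_sum _ hΩ,
    withDensity_sum]
  congr 1
  funext i
  set d : ℕ → S := (exists_chart_cover n S).choose with hd
  have hB : MeasurableSet {p : ℝ × Coord n | p.2 ∈ (chart (n := n) (d i)).target ∧
      ∀ j < i, (chart (d i)).symm p.2 ∉ (chart (n := n) (d j)).source} := by
    have h1 : MeasurableSet {q : ℝ × S | ∀ j < i, q.2 ∉ (chart (n := n) (d j)).source} := by
      simp only [Set.ofPred_forall]
      exact MeasurableSet.iInter fun j => MeasurableSet.iInter fun _ =>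
        (isOpen_patch (n := n) (d j)).measurableSet.compl
    exact measurableSet_cpatch_inter (n := n) (d i) h1
  set B := {p : ℝ × Coord n | p.2 ∈ (chart (n := n) (d i)).target ∧
      ∀ j < i, (chart (d i)).symm p.2 ∉ (chart (n := n) (d j)).source} with hBdef
  have hBsub : B ⊆ cpatch n (d i) := fun p hp => hp.1
  have hf : AEMeasurable (toMfd n (d i)) (volume.restrict B) := by
    have h1 : ContinuousOn (toMfd n (d i)) B := fun p hp =>
      (continuousAt_toMfd hp.1).continuousWithinAt
    exact h1.aemeasurable hB
  have hrm : AEMeasurable (fun p => ENNReal.ofReal (r (d i) p)) (volume.restrict B) := by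
    have h1 : ContinuousOn (r (d i)) B := fun p hp => (hr.cont _ _ hp.1).continuousWithinAt
    exact (h1.aemeasurable hB).ennreal_ofReal
  have hf' : ∀ f, AEMeasurable (toMfd n (d i)) ((volume.restrict B).withDensity f) := fun f =>
    hf.mono_ac (withDensity_absolutelyContinuous _ _)
  have hm : ∀ {T : Set (ℝ × S)}, MeasurableSet T →
      MeasurableSet (B ∩ toMfd n (d i) ⁻¹' T) := by
    intro T hT
    have := hB.inter (measurableSet_cpatch_inter (n := n) (d i) hT)
    rwa [← inter_assoc, inter_eq_left.2 hBsub] at this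
  have hnull : ∀ f : ℝ × Coord n → ℝ≥0∞, ∀ T : Set (ℝ × S), MeasurableSet T →
      ((volume.restrict B).withDensity f).restrict (toMfd n (d i) ⁻¹' T) =
        (volume.restrict (B ∩ toMfd n (d i) ⁻¹' T)).withDensity f := by
    intro f T hT
    have h2 : ∀ᵐ p ∂((volume.restrict B).withDensity f), p ∈ B :=
      (withDensity_absolutelyContinuous _ _).ae_le (ae_restrict_mem hB)
    have h3 : toMfd n (d i) ⁻¹' T =ᵐ[(volume.restrict B).withDensity f]
        (B ∩ toMfd n (d i) ⁻¹' T : Set _) := by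
      filter_upwards [h2] with p hp
      exact propext ⟨fun h => ⟨hp, h⟩, fun h => h.2⟩
    rw [Measure.restrict_congr_set h3, restrict_withDensity (hm hT),
      Measure.restrict_restrict (hm hT), inter_right_comm, inter_self]
  ext T hT
  change ((Measure.map (toMfd n (d i)) _).restrict Ω) T =
    (((Measure.map (toMfd n (d i)) _).restrict Ω).withDensity θ) T
  rw [Measure.restrict_apply hT, Measure.map_apply_of_aemeasurable (hf' _) (hT.inter hΩ),
    withDensity_apply _ hT, Measure.restrict_restrict hT,
    Measure.restrict_map_of_aemeasurable (hf' _) (hT.inter hΩ), hnull _ _ (hT.inter hΩ)]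
  have hle : (volume.restrict (B ∩ toMfd n (d i) ⁻¹' (T ∩ Ω))) ≤ volume.restrict B :=
    Measure.restrict_mono inter_subset_left le_rfl
  rw [lintegral_map' hθ.aemeasurable ((hf.mono_measure hle).mono_ac
      (withDensity_absolutelyContinuous _ _)),
    lintegral_withDensity_eq_lintegral_mul₀ (g := fun a => θ (toMfd n (d i) a))
      (hrm.mono_measure hle) (hθ.comp_aemeasurable (hf.mono_measure hle))]
  have h5 := congrArg (fun μ => μ univ) (hnull (ρ (d i)) _ (hT.inter hΩ))
  simp only [Measure.restrict_apply_univ] at h5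
  rw [h5, withDensity_apply _ MeasurableSet.univ, Measure.restrict_univ]
  refine setLIntegral_congr_fun (hm (hT.inter hΩ)) fun p hp => ?_
  rw [h _ _ hp.1.1 hp.2.2]
  exact mul_comm _ _

/-- Integration in coordinates. -/
theorem integral_densityMeasure_eq (hr : IsDensity r) {E : Type*} [NormedAddCommGroup E]
    [NormedSpace ℝ E] (c : S) {F : ℝ × S → E}
    (hF : AEStronglyMeasurable F (densityMeasure fun c p => ENNReal.ofReal (r c p)))
    (h0 : ∀ q ∉ patch n c, F q = 0) :
    ∫ q, F q ∂(densityMeasure fun c p => ENNReal.ofReal (r c p)) =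
      ∫ p in cpatch n c, r c p • F (toMfd n c p) := by
  rw [← setIntegral_eq_integral_of_forall_compl_eq_zero h0, densityMeasure_restrict_patch hr]
  have hF' : AEStronglyMeasurable F (patchMeasure r c) := by
    rw [← densityMeasure_restrict_patch hr]
    exact hF.restrict
  have hrm : AEMeasurable (fun p => ENNReal.ofReal (r c p)) (volume.restrict (cpatch n c)) := by
    have h1 : ContinuousOn (r c) (cpatch n c) := fun p hp =>
      (hr.cont _ _ hp).continuousWithinAt
    exact (h1.aemeasurable (isOpen_cpatch c).measurableSet).ennreal_ofReal
  rw [patchMeasure] at hF' ⊢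
  rw [integral_map (aemeasurable_toMfd c _) hF',
    integral_withDensity_eq_integral_toReal_smul₀ hrm (by simp)]
  refine setIntegral_congr_fun (isOpen_cpatch c).measurableSet fun p hp => ?_
  simp only [ENNReal.toReal_ofReal (hr.pos c p hp).le]

theorem isLocallyFiniteMeasure_densityMeasure (hr : IsDensity r) :
    IsLocallyFiniteMeasure (densityMeasure (S := S) fun c p => ENNReal.ofReal (r c p)) := by
  refine ⟨fun q => ?_⟩
  set c := q.2
  have hs : c ∈ (chart (n := n) c).source := mem_extChartAt_source c
  have ht : (toCoord n c q).2 ∈ (chart (n := n) c).target := (chart c).map_source hs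
  obtain ⟨δ, hδ, hb⟩ := Metric.eventually_nhds_iff_ball.1
    ((hr.cont c _ ht).eventually (eventually_lt_nhds (lt_add_one (r c (toCoord n c q)))))
  refine ⟨patch n c ∩ toCoord n c ⁻¹' Metric.ball (toCoord n c q) δ,
    inter_mem ((isOpen_patch c).mem_nhds hs)
      ((continuousAt_toCoord hs).preimage_mem_nhds (Metric.ball_mem_nhds _ hδ)), ?_⟩
  have hm : MeasurableSet (patch n c ∩ toCoord n c ⁻¹' Metric.ball (toCoord n c q) δ) := by
    refine IsOpen.measurableSet (ContinuousOn.isOpen_inter_preimage (fun q hq => ?_)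
      (isOpen_patch c) Metric.isOpen_ball)
    exact (continuousAt_toCoord hq).continuousWithinAt
  have h1 : (densityMeasure fun c p => ENNReal.ofReal (r c p))
      (patch n c ∩ toCoord n c ⁻¹' Metric.ball (toCoord n c q) δ) =
      patchMeasure r c (patch n c ∩ toCoord n c ⁻¹' Metric.ball (toCoord n c q) δ) := by
    rw [← densityMeasure_restrict_patch hr, Measure.restrict_apply hm, inter_right_comm, inter_self]
  rw [h1, patchMeasure_apply c hm]
  refine lt_of_le_of_lt (b := ∫⁻ _ in Metric.ball (toCoord n c q) δ,
    ENNReal.ofReal (r c (toCoord n c q) + 1)) ?_ ?_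
  · have hsub : cpatch n c ∩ toMfd n c ⁻¹' (patch n c ∩
        toCoord n c ⁻¹' Metric.ball (toCoord n c q) δ) ⊆ Metric.ball (toCoord n c q) δ := by
      rintro p ⟨hp, -, h⟩
      rwa [mem_preimage, toCoord_toMfd hp] at h
    refine (setLIntegral_mono_ae aemeasurable_const (ae_of_all _ fun p hp => ?_)).trans
      (lintegral_mono_set hsub)
    exact ENNReal.ofReal_le_ofReal (hb p (hsub hp)).le
  · rw [setLIntegral_const]
    exact ENNReal.mul_lt_top ENNReal.ofReal_lt_top measure_ball_lt_top

theorem isOpenPosMeasure_densityMeasure (hr : IsDensity r) :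
    (densityMeasure (S := S) fun c p => ENNReal.ofReal (r c p)).IsOpenPosMeasure := by
  refine ⟨fun U hU ⟨q, hq⟩ h0 => ?_⟩
  set c := q.2
  have hs : c ∈ (chart (n := n) c).source := mem_extChartAt_source c
  have ht : (toCoord n c q).2 ∈ (chart (n := n) c).target := (chart c).map_source hs
  have h1 : patchMeasure r c U = 0 := by
    rw [← densityMeasure_restrict_patch hr]
    exact le_antisymm ((Measure.restrict_apply_le _ _).trans h0.le) bot_le
  rw [patchMeasure_apply c hU.measurableSet] at h1
  have hB : IsOpen (cpatch n c ∩ toMfd n c ⁻¹' U) :=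
    ContinuousOn.isOpen_inter_preimage
      (fun p hp => (continuousAt_toMfd hp).continuousWithinAt) (isOpen_cpatch c) hU
  have hcont : ContinuousOn (r c) (cpatch n c ∩ toMfd n c ⁻¹' U) := fun p hp =>
    (hr.cont _ _ hp.1).continuousWithinAt
  rw [lintegral_eq_zero_iff' (hcont.aemeasurable hB.measurableSet).ennreal_ofReal] at h1
  have h2 : ∀ᵐ p ∂(volume.restrict (cpatch n c ∩ toMfd n c ⁻¹' U)), False := by
    filter_upwards [h1, ae_restrict_mem hB.measurableSet] with p hp hpB
    exact absurd (ENNReal.ofReal_eq_zero.1 hp) (not_le.2 (hr.pos c p hpB.1))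
  have h3 : volume (cpatch n c ∩ toMfd n c ⁻¹' U) = 0 := by
    simpa [ae_iff] using h2
  refine (hB.measure_ne_zero volume ⟨toCoord n c q, ht, ?_⟩) h3
  rw [mem_preimage, toMfd_toCoord hs]
  exact hq

/-- The density of the metric at time zero, in coordinates. -/
def dens0 (G : AnalyticKGData n S) (c : S) (p : ℝ × Coord n) : ℝ := Real.sqrt (gram0 G c p).det

theorem isDensity_dens0 (G : AnalyticKGData n S) : IsDensity (dens0 G) where
  cont c p hp := Real.continuous_sqrt.continuousAt.comp
    (contDiffAt_det (fun j k => contDiffAt_gram0 G hp j k)).continuousAt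
  pos c p hp := Real.sqrt_pos.2 (gram0_posDef G hp).det_pos
  transform c c' p hp hp' := by
    rw [dens0, gram0, gram_real_eq _ hp hp', Matrix.det_mul, Matrix.det_mul,
      Matrix.det_transpose, mul_right_comm, Real.sqrt_mul (mul_self_nonneg _),
      Real.sqrt_mul_self_eq_abs]
    rfl

instance isLocallyFiniteMeasure_measure0 (G : AnalyticKGData n S) :
    IsLocallyFiniteMeasure (measure0 G) :=
  isLocallyFiniteMeasure_densityMeasure (isDensity_dens0 G)

instance isOpenPosMeasure_measure0 (G : AnalyticKGData n S) :
    (measure0 G).IsOpenPosMeasure :=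
  isOpenPosMeasure_densityMeasure (isDensity_dens0 G)

theorem integral_measure0_eq (G : AnalyticKGData n S) {E : Type*} [NormedAddCommGroup E]
    [NormedSpace ℝ E] (c : S) {F : ℝ × S → E} (hF : AEStronglyMeasurable F (measure0 G))
    (h0 : ∀ q ∉ patch n c, F q = 0) :
    ∫ q, F q ∂(measure0 G) = ∫ p in cpatch n c, dens0 G c p • F (toMfd n c p) :=
  integral_densityMeasure_eq (isDensity_dens0 G) c hF h0

variable {G : AnalyticKGData n S}

theorem dens0_mul_theta (W : HolExtension G) {c : S} {p : ℝ × Coord n}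
    (hp : p.2 ∈ (chart c).target) :
    dens0 G c p * theta W (toMfd n c p) = Real.sqrt ‖(gramW W c p).det‖ := by
  have h := (gram0_posDef G hp).det_pos
  rw [theta_toMfd W hp, dens0, ← Real.sqrt_mul h.le, mul_div_cancel₀ _ h.ne']

theorem wickMeasure_restrict (W : HolExtension G) {Ω : Set (ℝ × S)} (hΩ : IsOpen Ω)
    (hW : Ω ⊆ W.wickDom) :
    (wickMeasure W).restrict Ω =
      ((measure0 G).restrict Ω).withDensity fun q => ENNReal.ofReal (theta W q) := by
  -- θ is controlled only on `W.wickDom`. Cutting it off there yields a globally measurable factor,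
  -- and changes nothing on Ω.
  have hθ : Measurable (fun q => ENNReal.ofReal (W.wickDom.indicator (theta W) q)) := by
    refine Measurable.ennreal_ofReal ?_
    have h1 : ContinuousOn (theta W) W.wickDom := fun q hq =>
      (continuousAt_theta W hq).continuousWithinAt
    classical
    exact h1.measurable_piecewise (g := fun _ => (0 : ℝ)) continuousOn_const
      (isOpen_wickDom W).measurableSet
  rw [wickMeasure, densityMeasure_restrict_eq_withDensity (isDensity_dens0 G) hθ hΩ.measurableSet]
  · refine withDensity_congr_ae ?_
    filter_upwards [ae_restrict_mem hΩ.measurableSet] with q hq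
    rw [indicator_of_mem (hW hq)]
  · intro c p hp hpΩ
    have h1 : 0 ≤ theta W (toMfd n c p) := Real.sqrt_nonneg _
    rw [indicator_of_mem (hW hpΩ), ← ENNReal.ofReal_mul h1, mul_comm (theta W _), dens0_mul_theta W hp]
    rfl

end Measures

/-! ### The operator on the manifold: energy identity in a patch and chart independence. -/

section Operator

variable {n : ℕ} {S : Type*} [TopologicalSpace S] [ChartedSpace (Coord n) S]
  [IsManifold (𝓡 n) ω S] {G : AnalyticKGData n S}

/-- Smooth functions on `ℝ × S`. -/
abbrev IsSmooth (n : ℕ) {S : Type*} [TopologicalSpace S] [ChartedSpace (Coord n) S]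
    (u : ℝ × S → ℂ) : Prop := ContMDiff (𝓘(ℝ, ℝ).prod (𝓡 n)) 𝓘(ℝ, ℂ) ∞ u

/-- The Wick rotated operator in the coordinates of the chart around `c`. -/
def opKc (W : HolExtension G) (c : S) (u : ℝ × S → ℂ) (q : ℝ × S) : ℂ :=
  locK (gramW W c) (potW W c) (u ∘ toMfd n c) (toCoord n c q)

/-- The energy density of the Wick rotated operator. -/
def energy (W : HolExtension G) (v u : ℝ × S → ℂ) (q : ℝ × S) : ℂ :=
  locE (gramW W q.2) (potW W q.2) (v ∘ toMfd n q.2) (u ∘ toMfd n q.2) (toCoord n q.2 q)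

/-- The energy at q is defined in the chart around q, which varies with q. Invariance allows one
fixed chart to be used nearby, which makes continuity and integration accessible. -/
theorem energy_toMfd (W : HolExtension G) {v u : ℝ × S → ℂ} (hv : IsSmooth n v)
    (hu : IsSmooth n u) {c : S} {p : ℝ × Coord n} (hp : p ∈ cpatch n c)
    (hpW : toMfd n c p ∈ W.wickDom) :
    energy W v u (toMfd n c p) =
      locE (gramW W c) (potW W c) (v ∘ toMfd n c) (u ∘ toMfd n c) p := by
  set y := (chart c).symm p.2 with hy
  have hx' : (chart c).symm p.2 ∈ (chart (n := n) y).source := mem_extChartAt_source y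
  have ht : (idProd (trans c y) p).2 ∈ (chart (n := n) y).target := trans_mem_target hx'
  have hcomp : ∀ p' : ℝ × Coord n, (chart c).symm p'.2 ∈ (chart (n := n) y).source →
      toMfd n y (idProd (trans c y) p') = toMfd n c p' := fun p' h => Prod.ext rfl (symm_trans h)
  have hW' : toMfd n y (idProd (trans c y) p) ∈ W.wickDom := by rwa [hcomp p hx']
  have hev : ∀ᶠ p' in 𝓝 p, p'.2 ∈ (chart c).target ∧
      (chart c).symm p'.2 ∈ (chart (n := n) y).source :=
    continuousAt_snd.eventually (eventually_mem_overlap hp hx')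
  refine (locE_idProd (τ := trans c y) ((contDiffAt_trans hp hx').of_le le_top)
    (det_jac_trans_ne_zero hp hx') ?_ (fun j k => contDiffAt_gramW W ht hW' j k)
    (gramW_det_ne_zero W ht hW') ?_ ?_ ?_ ((contDiffAt_comp_toMfd hu ht).differentiableAt (by simp))
    ((contDiffAt_comp_toMfd hv ht).differentiableAt (by simp))).symm
  · filter_upwards [hev] with p' hp'
    exact gram_complex_eq _ hp'.1 hp'.2
  · simp only [potW]
    exact congrArg (fun z => W.potential (Complex.I * (p.1 : ℂ), z)) (symm_trans hx').symm
  · filter_upwards [hev] with p' hp'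
    simp only [Function.comp_apply, hcomp p' hp'.2]
  · filter_upwards [hev] with p' hp'
    simp only [Function.comp_apply, hcomp p' hp'.2]

theorem eventually_patch {c : S} {q : ℝ × S} (hq : q ∈ patch n c) {O : Set (ℝ × S)}
    (hO : IsOpen O) (hqO : q ∈ O) : ∀ᶠ q' in 𝓝 q, q' ∈ patch n c ∧ q' ∈ O :=
  (((isOpen_source c).preimage continuous_snd).eventually_mem hq).and (hO.eventually_mem hqO)

theorem continuousAt_energy (W : HolExtension G) {v u : ℝ × S → ℂ} (hv : IsSmooth n v)
    (hu : IsSmooth n u) {q : ℝ × S} (hq : q ∈ W.wickDom) : ContinuousAt (energy W v u) q := by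
  have hs : q ∈ patch n q.2 := mem_extChartAt_source (I := 𝓡 n) q.2
  have ht : (toCoord n q.2 q).2 ∈ (chart q.2).target := (chart (n := n) q.2).map_source hs
  have hW : toMfd n q.2 (toCoord n q.2 q) ∈ W.wickDom := by rwa [toMfd_toCoord hs]
  have h1 : ContinuousAt (locE (gramW W q.2) (potW W q.2) (v ∘ toMfd n q.2) (u ∘ toMfd n q.2))
      (toCoord n q.2 q) :=
    (contDiffAt_locE (fun j k => contDiffAt_gramW W ht hW j k) (gramW_det_ne_zero W ht hW)
      (contDiffAt_potW W ht hW) (contDiffAt_comp_toMfd hv ht)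
      (contDiffAt_comp_toMfd hu ht)).continuousAt
  refine (h1.comp (continuousAt_toCoord hs)).congr ?_
  filter_upwards [eventually_patch hs (isOpen_wickDom W) hq] with q' hq'
  have e := energy_toMfd W hv hu (c := q.2) (p := toCoord n q.2 q')
    ((chart q.2).map_source hq'.1) (by rw [toMfd_toCoord hq'.1]; exact hq'.2)
  rw [toMfd_toCoord hq'.1] at e
  exact e.symm

theorem continuousAt_opKc (W : HolExtension G) {u : ℝ × S → ℂ}
    (hu : IsSmooth n u) {c : S} {q : ℝ × S} (hs : q ∈ patch n c) (hq : q ∈ W.wickDom) :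
    ContinuousAt (opKc W c u) q := by
  have ht : (toCoord n c q).2 ∈ (chart c).target := (chart (n := n) c).map_source hs
  have hW : toMfd n c (toCoord n c q) ∈ W.wickDom := by rwa [toMfd_toCoord hs]
  exact (contDiffAt_locK (fun j k => contDiffAt_gramW W ht hW j k) (gramW_det_ne_zero W ht hW)
    (contDiffAt_potW W ht hW) (contDiffAt_comp_toMfd hu ht)).continuousAt.comp
      (continuousAt_toCoord hs)

theorem continuous_of_zero_off {X E : Type*} [TopologicalSpace X] [TopologicalSpace E] [Zero E]
    {f : X → E} {O K : Set X} (hK : IsClosed K) (hf : ∀ p ∈ O, ContinuousAt f p)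
    (h0 : ∀ p ∉ K, f p = 0) (hKO : K ⊆ O) : Continuous f := by
  refine continuous_iff_continuousAt.2 fun p => ?_
  by_cases hp : p ∈ K
  · exact hf p (hKO hp)
  · refine (continuousAt_const (y := (0 : E))).congr ?_
    filter_upwards [hK.isOpen_compl.mem_nhds hp] with q hq using (h0 q hq).symm

theorem locE_eq_zero {A : ℝ × Coord n → Matrix (Fin n) (Fin n) ℂ} {q v u : ℝ × Coord n → ℂ}
    {p : ℝ × Coord n} (hp : p ∉ tsupport v) : locE A q v u p = 0 := by
  have h1 : v p = 0 := image_eq_zero_of_notMem_tsupport hp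
  have h2 : fderiv ℝ v p = 0 := fderiv_of_notMem_tsupport ℝ hp
  simp [locE, dS, dX, h1, h2, bil]

theorem locE_congr {A : ℝ × Coord n → Matrix (Fin n) (Fin n) ℂ} {q v v' u u' : ℝ × Coord n → ℂ}
    {p : ℝ × Coord n} (h : v =ᶠ[𝓝 p] v') (h' : u =ᶠ[𝓝 p] u') :
    locE A q v u p = locE A q v' u' p := by
  unfold locE dS dX
  rw [h.fderiv_eq, h.eq_of_nhds, h'.fderiv_eq, h'.eq_of_nhds]

theorem energy_eq_zero (W : HolExtension G) {v u : ℝ × S → ℂ} {q : ℝ × S} (hq : q ∉ tsupport v) :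
    energy W v u q = 0 := by
  have hs : q ∈ patch n q.2 := mem_extChartAt_source (I := 𝓡 n) q.2
  have ht : (toCoord n q.2 q).2 ∈ (chart q.2).target := (chart (n := n) q.2).map_source hs
  have h1 : v ∘ toMfd n q.2 =ᶠ[𝓝 (toCoord n q.2 q)] 0 := by
    have h2 : ∀ᶠ p in 𝓝 (toCoord n q.2 q), toMfd n q.2 p ∈ (tsupport v)ᶜ :=
      (continuousAt_toMfd ht).eventually
        (by rw [toMfd_toCoord hs]; exact (isClosed_tsupport v).isOpen_compl.mem_nhds hq)
    filter_upwards [h2] with p hp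
    exact image_eq_zero_of_notMem_tsupport (f := v) hp
  rw [energy, locE_congr h1 (EventuallyEq.refl _ _)]
  refine locE_eq_zero ?_
  simp [tsupport]

variable [SecondCountableTopology S] [MeasurableSpace S] [BorelSpace S] [T2Space S]

/-- A test function supported in a patch, in coordinates. -/
theorem testFn_coord {v : ℝ × S → ℂ} {c : S} {O : Set (ℝ × S)}
    (hv : v ∈ TestFn n (patch n c ∩ O)) :
    ContDiff ℝ ∞ ((cpatch n c).indicator (v ∘ toMfd n c)) ∧
    HasCompactSupport ((cpatch n c).indicator (v ∘ toMfd n c)) ∧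
    tsupport ((cpatch n c).indicator (v ∘ toMfd n c)) ⊆ cpatch n c ∩ toMfd n c ⁻¹' O := by
  obtain ⟨hv1, hv2, hv3⟩ := hv
  have hcont : ContinuousOn (toCoord n c) (tsupport v) := fun q hq =>
    (continuousAt_toCoord (hv3 hq).1).continuousWithinAt
  have hK : IsCompact (toCoord n c '' tsupport v) := IsCompact.image_of_continuousOn hv2 hcont
  have hsub : toCoord n c '' tsupport v ⊆ cpatch n c ∩ toMfd n c ⁻¹' O := by
    rintro _ ⟨q, hq, rfl⟩
    refine ⟨(chart c).map_source (hv3 hq).1, ?_⟩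
    rw [mem_preimage, toMfd_toCoord (hv3 hq).1]
    exact (hv3 hq).2
  have h0 : ∀ p ∉ toCoord n c '' tsupport v, (cpatch n c).indicator (v ∘ toMfd n c) p = 0 := by
    intro p hp
    by_cases hpc : p ∈ cpatch n c
    · rw [indicator_of_mem hpc]
      exact image_eq_zero_of_notMem_tsupport (f := v) fun h => hp ⟨_, h, toCoord_toMfd hpc⟩
    · exact indicator_of_notMem hpc _
  refine ⟨contDiff_of_tsupport_subset (O := cpatch n c) hK.isClosed (fun p hp => ?_) h0
    (hsub.trans inter_subset_left), HasCompactSupport.intro hK h0, ?_⟩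
  · refine (contDiffAt_comp_toMfd hv1 hp).congr_of_eventuallyEq ?_
    filter_upwards [(isOpen_cpatch c).mem_nhds hp] with p' hp'
    exact indicator_of_mem hp' _
  · refine (closure_minimal ?_ hK.isClosed).trans hsub
    intro p hp
    by_contra h
    exact hp (h0 p h)

variable [Nonempty S]

/-- The coordinate identity `integral_locK_eq` transported to the manifold. The right-hand side no
longer mentions the chart c, which is what forces chart independence of the operator. -/
theorem integral_opKc_eq (W : HolExtension G) {v u : ℝ × S → ℂ} {c : S}
    (hv : v ∈ TestFn n (patch n c ∩ W.wickDom)) (hu : IsSmooth n u) :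
    ∫ q, theta W q * (conj (v q) * opKc W c u q) ∂(measure0 G) =
      ∫ q, theta W q * energy W v u q ∂(measure0 G) := by
  have h0 : ∀ q ∉ tsupport v, v q = 0 := fun q hq => image_eq_zero_of_notMem_tsupport hq
  have hθ : ∀ q ∈ patch n c ∩ W.wickDom, ContinuousAt (fun q => (theta W q : ℂ)) q := fun q hq =>
    Complex.continuous_ofReal.continuousAt.comp (continuousAt_theta W hq.2)
  have hF1 : Continuous fun q => theta W q * (conj (v q) * opKc W c u q) := by
    refine continuous_of_zero_off (isClosed_tsupport v) (fun q hq => (hθ q hq).mul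
      ((Complex.continuous_conj.comp hv.1.continuous).continuousAt.mul
        (continuousAt_opKc W hu hq.1 hq.2))) (fun q hq => by simp [h0 q hq]) hv.2.2
  have hF2 : Continuous fun q => theta W q * energy W v u q :=
    continuous_of_zero_off (isClosed_tsupport v) (fun q hq => (hθ q hq).mul
      (continuousAt_energy W hv.1 hu hq.2)) (fun q hq => by simp [energy_eq_zero W hq]) hv.2.2
  have hout : ∀ q ∉ patch n c, q ∉ tsupport v := fun q hq h => hq (hv.2.2 h).1
  rw [integral_measure0_eq G c hF1.aestronglyMeasurable
      (fun q hq => by simp [h0 q (hout q hq)]),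
    integral_measure0_eq G c hF2.aestronglyMeasurable
      (fun q hq => by simp [energy_eq_zero W (hout q hq)])]
  obtain ⟨hv1, hv2, hv3⟩ := testFn_coord hv
  -- The inverse chart has no meaning off its target; extension by zero gives a genuine test
  -- function on the coordinate space.
  set v' := (cpatch n c).indicator (v ∘ toMfd n c) with hv'
  have hloc := integral_locK_eq (O := cpatch n c ∩ toMfd n c ⁻¹' W.wickDom) (q := potW W c)
    (fun p hp j k => contDiffAt_gramW W hp.1 hp.2 j k) (fun p hp => gramW_det_ne_zero W hp.1 hp.2)
    (fun p hp => contDiffAt_potW W hp.1 hp.2) (fun p hp => contDiffAt_comp_toMfd hu hp.1)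
    hv1 hv2 hv3
  have hvz : ∀ p ∉ cpatch n c, p ∉ tsupport v' := fun p hp h => hp (hv3 h).1
  have e1 : ∫ p, (Real.sqrt ‖(gramW W c p).det‖ : ℂ) *
      (conj (v' p) * locK (gramW W c) (potW W c) (u ∘ toMfd n c) p) =
      ∫ p in cpatch n c, dens0 G c p • ((theta W (toMfd n c p) : ℂ) *
        (conj (v (toMfd n c p)) * opKc W c u (toMfd n c p))) := by
    rw [← setIntegral_eq_integral_of_forall_compl_eq_zero (s := cpatch n c) fun p hp => by
      simp [image_eq_zero_of_notMem_tsupport (hvz p hp)]]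
    refine setIntegral_congr_fun (isOpen_cpatch c).measurableSet fun p hp => ?_
    simp only [Complex.real_smul]
    rw [← dens0_mul_theta W hp, opKc, toCoord_toMfd hp, hv', indicator_of_mem hp,
      Function.comp_apply]
    push_cast
    ring
  have e2 : ∫ p, (Real.sqrt ‖(gramW W c p).det‖ : ℂ) *
      locE (gramW W c) (potW W c) v' (u ∘ toMfd n c) p =
      ∫ p in cpatch n c, dens0 G c p • ((theta W (toMfd n c p) : ℂ) *
        energy W v u (toMfd n c p)) := by
    rw [← setIntegral_eq_integral_of_forall_compl_eq_zero (s := cpatch n c) fun p hp => by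
      simp [locE_eq_zero (hvz p hp)]]
    refine setIntegral_congr_fun (isOpen_cpatch c).measurableSet fun p hp => ?_
    have hev : v' =ᶠ[𝓝 p] v ∘ toMfd n c := by
      filter_upwards [(isOpen_cpatch c).mem_nhds hp] with p' hp'
      exact indicator_of_mem hp' _
    by_cases hpW : toMfd n c p ∈ W.wickDom
    · simp only [Complex.real_smul]
      rw [energy_toMfd W hv.1 hu hp hpW, ← dens0_mul_theta W hp,
        locE_congr hev (EventuallyEq.refl _ _)]
      push_cast
      ring
    · have h1 : toMfd n c p ∉ tsupport v := fun h => hpW (hv.2.2 h).2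
      have h2 : p ∉ tsupport v' := fun h => hpW (hv3 h).2
      simp only [energy_eq_zero W h1, locE_eq_zero h2, mul_zero, smul_zero]
  exact e1.symm.trans (hloc.trans e2)

/-- The fundamental lemma of the calculus of variations gives vanishing almost everywhere;
continuity and the positivity of the measure on open sets give it everywhere. -/
theorem eqOn_zero_of_integral_testFn {N : Set (ℝ × S)} (hN : IsOpen N) {f : ℝ × S → ℂ}
    (hf : ContinuousOn f N)
    (h : ∀ v ∈ TestFn n N, ∫ q, conj (v q) * f q ∂(measure0 G) = 0) : ∀ q ∈ N, f q = 0 := by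
  have : LocallyCompactSpace S := ChartedSpace.locallyCompactSpace (Coord n) S
  have h1 : ∀ᵐ q ∂(measure0 G), q ∈ N → f q = 0 := by
    refine hN.ae_eq_zero_of_integral_contMDiff_smul_eq_zero (𝓘(ℝ, ℝ).prod (𝓡 n))
      (hf.locallyIntegrableOn hN.measurableSet) fun g hg hgc hgN => ?_
    have hmem : (fun q => (g q : ℂ)) ∈ TestFn n N := by
      refine ⟨(Complex.ofRealCLM.contDiff (n := ∞)).contMDiff.comp hg,
        hgc.comp_left (g := Complex.ofReal) Complex.ofReal_zero, ?_⟩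
      refine (closure_mono fun q hq => ?_).trans hgN
      exact fun h0 => hq (by simp [h0])
    simpa [Complex.real_smul] using h _ hmem
  have h2 : f =ᵐ[(measure0 G).restrict N] fun _ => 0 := by
    rw [EventuallyEq, ae_restrict_iff' hN.measurableSet]
    exact h1
  exact Measure.eqOn_open_of_ae_eq h2 hN hf continuousOn_const

theorem continuous_testFn_mul {O : Set (ℝ × S)} {v f : ℝ × S → ℂ} (hv : v ∈ TestFn n O)
    (hf : ∀ q ∈ O, ContinuousAt f q) : Continuous fun q => conj (v q) * f q :=
  continuous_of_zero_off (isClosed_tsupport v)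
    (fun q hq => (Complex.continuous_conj.comp hv.1.continuous).continuousAt.mul (hf q hq))
    (fun q hq => by simp [image_eq_zero_of_notMem_tsupport hq]) hv.2.2

theorem integrable_testFn_mul {O : Set (ℝ × S)} {v f : ℝ × S → ℂ} (hv : v ∈ TestFn n O)
    (hf : ∀ q ∈ O, ContinuousAt f q) : Integrable (fun q => conj (v q) * f q) (measure0 G) :=
  (continuous_testFn_mul hv hf).integrable_of_hasCompactSupport
    (HasCompactSupport.intro hv.2.1 fun q hq => by simp [image_eq_zero_of_notMem_tsupport hq])

theorem theta_pos (W : HolExtension G) {q : ℝ × S} (hq : q ∈ W.wickDom) : 0 < theta W q := by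
  have hs : q.2 ∈ (chart (n := n) q.2).source := mem_extChartAt_source q.2
  have ht := (chart (n := n) q.2).map_source hs
  have hW : toMfd n q.2 (toCoord n q.2 q) ∈ W.wickDom := by rwa [toMfd_toCoord hs]
  exact Real.sqrt_pos.2 (div_pos
    (norm_pos_iff.2 (gramW_det_ne_zero W (p := toCoord n q.2 q) ht hW))
    (gram0_posDef G (p := toCoord n q.2 q) ht).det_pos)

/-- The operator does not depend on the chart in which it is computed. -/
theorem opKc_eq_opKc (W : HolExtension G) {u : ℝ × S → ℂ} (hu : IsSmooth n u) {c c' : S}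
    {q : ℝ × S} (hq : q ∈ patch n c) (hq' : q ∈ patch n c') (hqW : q ∈ W.wickDom) :
    opKc W c u q = opKc W c' u q := by
  set N := patch n c ∩ patch n c' ∩ W.wickDom with hN
  have hNo : IsOpen N := ((isOpen_patch c).inter (isOpen_patch c')).inter (isOpen_wickDom W)
  have hθ : ∀ q ∈ N, ContinuousAt (fun q => (theta W q : ℂ)) q := fun q hq =>
    Complex.continuous_ofReal.continuousAt.comp (continuousAt_theta W hq.2)
  have hc : ∀ q ∈ N, ContinuousAt (fun q => theta W q * opKc W c u q) q := fun q hq =>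
    (hθ q hq).mul (continuousAt_opKc W hu hq.1.1 hq.2)
  have hc' : ∀ q ∈ N, ContinuousAt (fun q => theta W q * opKc W c' u q) q := fun q hq =>
    (hθ q hq).mul (continuousAt_opKc W hu hq.1.2 hq.2)
  -- No transformation law of second derivatives is computed: tested against any v supported in both
  -- patches, the two expressions give the same energy integral, and both are continuous.
  have h := eqOn_zero_of_integral_testFn (G := G) hNo
    (f := fun q => theta W q * opKc W c u q - theta W q * opKc W c' u q)
    (fun q hq => ((hc q hq).sub (hc' q hq)).continuousWithinAt) fun v hv => ?_
  · have h1 := h q ⟨⟨hq, hq'⟩, hqW⟩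
    rw [← mul_sub] at h1
    have h2 : (theta W q : ℂ) ≠ 0 := by exact_mod_cast (theta_pos W hqW).ne'
    exact sub_eq_zero.1 ((mul_eq_zero.1 h1).resolve_left h2)
  · simp only [mul_sub]
    rw [integral_sub (integrable_testFn_mul hv hc) (integrable_testFn_mul hv hc'), sub_eq_zero]
    have hv1 : v ∈ TestFn n (patch n c ∩ W.wickDom) :=
      ⟨hv.1, hv.2.1, hv.2.2.trans fun q hq => ⟨hq.1.1, hq.2⟩⟩
    have hv2 : v ∈ TestFn n (patch n c' ∩ W.wickDom) :=
      ⟨hv.1, hv.2.1, hv.2.2.trans fun q hq => ⟨hq.1.2, hq.2⟩⟩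
    have e := (integral_opKc_eq W hv1 hu).trans (integral_opKc_eq W hv2 hu).symm
    simpa only [mul_left_comm] using e

end Operator

/-! ### Derivatives along the two factors as derivatives of slices. -/

section Slices

variable {n : ℕ} {F : ℝ × Coord n → ℂ}

theorem dS_eq_deriv {p : ℝ × Coord n} (hF : DifferentiableAt ℝ F p) :
    dS F p = deriv (fun s => F (s, p.2)) p.1 := by
  have h1 : HasFDerivAt (fun s : ℝ => (s, p.2)) _ p.1 := hasFDerivAt_prodMk_left (𝕜 := ℝ) p.1 p.2
  have h2 := (hF.hasFDerivAt.comp p.1 h1).hasDerivAt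
  rw [show (fun s => F (s, p.2)) = F ∘ fun s => (s, p.2) from rfl, h2.deriv]
  simp [dS]

theorem dX_eq_fderiv {p : ℝ × Coord n} (hF : DifferentiableAt ℝ F p) (j : Fin n) :
    dX F p j = fderiv ℝ (fun x => F (p.1, x)) p.2 (stdVec j) := by
  have h1 : HasFDerivAt (fun x : Coord n => (p.1, x)) _ p.2 := hasFDerivAt_prodMk_right (𝕜 := ℝ) p.1 p.2
  have h2 := hF.hasFDerivAt.comp p.2 h1
  rw [show (fun x => F (p.1, x)) = F ∘ fun x => (p.1, x) from rfl, h2.fderiv]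
  simp [dX]

end Slices

/-! ### The operator in its original form, and the global energy identity. -/

section Operator

variable {n : ℕ} {S : Type*} [TopologicalSpace S] [ChartedSpace (Coord n) S]
  [IsManifold (𝓡 n) ω S] {G : AnalyticKGData n S}

theorem opK_eq_opKc_self (W : HolExtension G) {u : ℝ × S → ℂ} (hu : IsSmooth n u)
    {q : ℝ × S} (hq : q ∈ W.wickDom) : W.opK u q = opKc W q.2 u q := by
  obtain ⟨s, y⟩ := q
  have hs : y ∈ (chart (n := n) y).source := mem_extChartAt_source y
  have ht : chart y y ∈ (chart (n := n) y).target := (chart y).map_source hs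
  have hsy : (chart (n := n) y).symm (chart y y) = y := (chart y).left_inv hs
  have hW : toMfd n y (s, chart y y) ∈ W.wickDom := by
    rw [show toMfd n y (s, chart y y) = (s, y) from Prod.ext rfl hsy]; exact hq
  have hU : ∀ p ∈ cpatch n y, ContDiffAt ℝ ∞ (u ∘ toMfd n y) p := fun p hp =>
    contDiffAt_comp_toMfd hu hp
  have hA : ∀ j k, ContDiffAt ℝ ∞ (fun p => gramW W y p j k) (s, chart y y) := fun j k =>
    contDiffAt_gramW W ht hW j k
  have hD0 := gramW_det_ne_zero W (p := (s, chart y y)) ht hW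
  have hD := (contDiffAt_det hA).differentiableAt (by simp)
  have hu1 : ∀ s', dS (u ∘ toMfd n y) (s', chart y y) = deriv (fun s => u (s, y)) s' := fun s' => by
    rw [dS_eq_deriv ((hU _ ht).differentiableAt (by simp))]
    simp only [Function.comp_apply, toMfd, hsy]
  have hu2 : dS (dS (u ∘ toMfd n y)) (s, chart y y) = iteratedDeriv 2 (fun s => u (s, y)) s := by
    have h1 : ContDiffAt ℝ ∞ (dS (u ∘ toMfd n y)) (s, chart y y) :=
      contDiffAt_fderiv_apply (hU _ ht) _
    rw [dS_eq_deriv (h1.differentiableAt (by simp)), iteratedDeriv_succ, iteratedDeriv_one]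
    simp only [hu1]
  have hx1 : ∀ x ∈ (chart (n := n) y).target, ∀ k, dX (u ∘ toMfd n y) (s, x) k =
      fderiv ℝ (fun x' => u (s, (chart y).symm x')) x (stdVec k) := fun x hx k => by
    rw [dX_eq_fderiv ((hU (s, x) hx).differentiableAt (by simp))]
    rfl
  have hx2 : ∀ j k, dX (fun p => (gramW W y p)⁻¹ j k * dX (u ∘ toMfd n y) p k) (s, chart y y) j =
      fderiv ℝ (fun x : Coord n => (gram (W.metric (Complex.I * (s : ℂ))) y x)⁻¹ j k *
        fderiv ℝ (fun x' => u (s, (chart y).symm x')) x (stdVec k)) (chart y y) (stdVec j) := by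
    intro j k
    have h1 : ContDiffAt ℝ ∞ (fun p => (gramW W y p)⁻¹ j k * dX (u ∘ toMfd n y) p k)
        (s, chart y y) :=
      (contDiffAt_inv_apply hA hD0 j k).mul (contDiffAt_fderiv_apply (hU _ ht) _)
    rw [dX_eq_fderiv (h1.differentiableAt (by simp))]
    congr 1
    refine EventuallyEq.fderiv_eq ?_
    filter_upwards [(isOpen_target y).mem_nhds ht] with x hx
    simp only [hx1 x hx]
    rfl
  have hx3 : ∀ j, dX (fun p => (gramW W y p).det) (s, chart y y) j =
      fderiv ℝ (fun x : Coord n => (gram (W.metric (Complex.I * (s : ℂ))) y x).det) (chart y y)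
        (stdVec j) := fun j => dX_eq_fderiv hD j
  -- By holomorphy, differentiating det h along z = is gives i times the complex derivative, so -i r
  -- ∂_s is -½ (∂_s log det) ∂_s, the term appearing in `locK`.
  have hr : dS (fun p => (gramW W y p).det) (s, chart y y) = Complex.I *
      deriv (fun z => (gram (W.metric z) y (chart y y)).det) (Complex.I * (s : ℂ)) := by
    have hent : ∀ j k, DifferentiableAt ℂ (fun z => gram (W.metric z) y (chart y y) j k)
        (Complex.I * (s : ℂ)) := by
      intro j k
      have hopen : IsOpen {z : ℂ | (z, (chart (n := n) y).symm (chart y y)) ∈ W.dom} :=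
        W.isOpen_dom.preimage (by fun_prop)
      exact (W.metric_holomorphic _ _ _).differentiableAt (hopen.mem_nhds hW)
    have hdet : DifferentiableAt ℂ (fun z => (gram (W.metric z) y (chart y y)).det)
        (Complex.I * (s : ℂ)) := by
      simp only [Matrix.det_apply']
      exact DifferentiableAt.fun_sum fun σ _ => (differentiableAt_const _).mul
        (DifferentiableAt.fun_finsetProd fun i _ => hent _ _)
    have h1 : HasDerivAt (fun z : ℂ => Complex.I * z) Complex.I (s : ℂ) := by
      simpa using (hasDerivAt_id (s : ℂ)).const_mul Complex.I
    have h2 := (hdet.hasDerivAt.comp (s : ℂ) h1).comp_ofReal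
    rw [dS_eq_deriv hD, mul_comm]
    exact h2.deriv
  change - iteratedDeriv 2 (fun s : ℝ => u (s, y)) s
    - Complex.I * W.coeffR (Complex.I * (s : ℂ)) y * deriv (fun s : ℝ => u (s, y)) s
    + W.opA (Complex.I * (s : ℂ)) (fun y => u (s, y)) y =
    locK (gramW W y) (potW W y) (u ∘ toMfd n y) (s, chart y y)
  have hg : gramW W y (s, chart y y) = gram (W.metric (Complex.I * (s : ℂ))) y (chart y y) := rfl
  have hpot : potW W y (s, chart y y) = W.potential (Complex.I * (s : ℂ), y) := by
    simp only [potW, hsy]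
  have hu0 : (u ∘ toMfd n y) (s, chart y y) = u (s, y) := by
    simp only [Function.comp_apply, toMfd, hsy]
  simp only [locK, hu2, hu1, hx1 _ ht, hx2, hx3, hr, HolExtension.coeffR, HolExtension.opA,
    hg, hpot, hu0]
  ring

variable [SecondCountableTopology S] [MeasurableSpace S] [BorelSpace S] [T2Space S] [Nonempty S]

theorem opK_eq_opKc (W : HolExtension G) {u : ℝ × S → ℂ} (hu : IsSmooth n u) {c : S}
    {q : ℝ × S} (hq : q ∈ patch n c) (hqW : q ∈ W.wickDom) : W.opK u q = opKc W c u q :=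
  (opK_eq_opKc_self W hu hqW).trans
    (opKc_eq_opKc W hu (mem_extChartAt_source (I := 𝓡 n) q.2) hq hqW)

theorem continuousAt_opK (W : HolExtension G) {u : ℝ × S → ℂ} (hu : IsSmooth n u)
    {q : ℝ × S} (hq : q ∈ W.wickDom) : ContinuousAt (W.opK u) q := by
  have hs : q ∈ patch n q.2 := mem_extChartAt_source (I := 𝓡 n) q.2
  refine (continuousAt_opKc W hu hs hq).congr ?_
  filter_upwards [eventually_patch hs (isOpen_wickDom W) hq] with q' hq'
  exact (opK_eq_opKc W hu hq'.1 hq'.2).symm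

/-- The test functions as a linear space. -/
def testSub (n : ℕ) {S : Type*} [TopologicalSpace S] [ChartedSpace (Coord n) S]
    (Ω : Set (ℝ × S)) : Submodule ℂ (ℝ × S → ℂ) where
  carrier := TestFn n Ω
  zero_mem' := ⟨contMDiff_const, HasCompactSupport.zero, by simp [tsupport]⟩
  add_mem' := fun hv hw => ⟨hv.1.add hw.1, hv.2.1.add hw.2.1,
    (tsupport_add _ _).trans (union_subset hv.2.2 hw.2.2)⟩
  smul_mem' := fun a v hv => ⟨(contDiff_const.mul contDiff_id : ContDiff ℝ ∞ fun z : ℂ => a * z).contMDiff.comp hv.1,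
    hv.2.1.smul_left (f := fun _ => a),
    (tsupport_smul_subset_right (fun _ => a) v).trans hv.2.2⟩

/-- Localization of statements on test functions to coordinate patches. -/
theorem testFn_induction {O : Set (ℝ × S)} {P : (ℝ × S → ℂ) → Prop} (h0 : P 0)
    (hadd : ∀ v ∈ TestFn n O, ∀ w ∈ TestFn n O, P v → P w → P (v + w))
    (hloc : ∀ c, ∀ v ∈ TestFn n (patch n c ∩ O), P v) : ∀ v ∈ TestFn n O, P v := by
  intro v hv
  have : LocallyCompactSpace S := ChartedSpace.locallyCompactSpace (Coord n) S
  obtain ⟨f, hf⟩ := SmoothPartitionOfUnity.exists_isSubordinate (𝓘(ℝ, ℝ).prod (𝓡 n))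
    (isClosed_univ (X := ℝ × S)) (fun c : S => patch n c) (fun c => isOpen_patch c)
    (fun q _ => mem_iUnion.2 ⟨q.2, mem_extChartAt_source (I := 𝓡 n) q.2⟩)
  -- Local finiteness and compact support leave only finitely many pieces of the partition of unity,
  -- so additivity of the statement is enough.
  have hfin := f.locallyFinite.finite_nonempty_inter_compact hv.2.1
  have hpiece : ∀ c, (fun q => (f c q : ℂ) * v q) ∈ TestFn n (patch n c ∩ O) := by
    intro c
    refine ⟨by simp only [← Complex.real_smul]; exact (f c).contMDiff.smul hv.1,
      hv.2.1.mul_left, subset_inter ?_ ((tsupport_mul_subset_right).trans hv.2.2)⟩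
    refine (tsupport_mul_subset_left).trans ((closure_mono fun q hq => ?_).trans (hf c))
    exact fun h0 => hq (by simp [h0])
  have hsum : ∀ J : Finset S, (∑ c ∈ J, fun q => (f c q : ℂ) * v q) ∈ TestFn n O ∧
      P (∑ c ∈ J, fun q => (f c q : ℂ) * v q) := by
    classical
    intro J
    induction J using Finset.induction_on with
    | empty => exact ⟨(testSub n O).zero_mem, h0⟩
    | insert c J hc ih =>
      rw [Finset.sum_insert hc]
      have h1 : (fun q => (f c q : ℂ) * v q) ∈ TestFn n O :=
        ⟨(hpiece c).1, (hpiece c).2.1, (hpiece c).2.2.trans inter_subset_right⟩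
      exact ⟨(testSub n O).add_mem h1 ih.1, hadd _ h1 _ ih.1 (hloc c _ (hpiece c)) ih.2⟩
  have hv' : (∑ c ∈ hfin.toFinset, fun q => (f c q : ℂ) * v q) = v := by
    funext q
    rw [Finset.sum_apply, ← Finset.sum_mul]
    by_cases hq : q ∈ tsupport v
    · have h1 := f.sum_eq_one (mem_univ q)
      rw [finsum_eq_sum_of_support_subset (s := hfin.toFinset)] at h1
      · rw [← Complex.ofReal_sum, h1]; simp
      · intro c hc
        simp only [Finite.coe_toFinset, mem_ofPred_eq]
        exact ⟨q, hc, hq⟩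
    · simp [image_eq_zero_of_notMem_tsupport hq]
  rw [← hv']
  exact (hsum _).2

theorem energy_add_left (W : HolExtension G) {v w u : ℝ × S → ℂ} (hv : IsSmooth n v)
    (hw : IsSmooth n w) (q : ℝ × S) : energy W (v + w) u q = energy W v u q + energy W w u q := by
  have hs : q ∈ patch n q.2 := mem_extChartAt_source (I := 𝓡 n) q.2
  have ht : (toCoord n q.2 q).2 ∈ (chart q.2).target := (chart (n := n) q.2).map_source hs
  have h1 := (contDiffAt_comp_toMfd hv ht).differentiableAt (by simp)
  have h2 := (contDiffAt_comp_toMfd hw ht).differentiableAt (by simp)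
  have e : fderiv ℝ ((v + w) ∘ toMfd n q.2) (toCoord n q.2 q) =
      fderiv ℝ (v ∘ toMfd n q.2) (toCoord n q.2 q) +
        fderiv ℝ (w ∘ toMfd n q.2) (toCoord n q.2 q) := fderiv_add h1 h2
  simp only [energy, locE, dS, dX, e, bil, add_apply, map_add, Function.comp_apply, Pi.add_apply,
    add_mul, Finset.sum_add_distrib]
  ring

/-- The quadratic form of the Wick rotated operator is the integral of the energy density. -/
theorem integral_opK_eq (W : HolExtension G) {u : ℝ × S → ℂ} (hu : IsSmooth n u) :
    ∀ v ∈ TestFn n W.wickDom, ∫ q, theta W q * (conj (v q) * W.opK u q) ∂(measure0 G) =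
      ∫ q, theta W q * energy W v u q ∂(measure0 G) := by
  have hθ : ∀ q ∈ W.wickDom, ContinuousAt (fun q => (theta W q : ℂ)) q := fun q hq =>
    Complex.continuous_ofReal.continuousAt.comp (continuousAt_theta W hq)
  have hK : ∀ v ∈ TestFn n W.wickDom,
      Integrable (fun q => theta W q * (conj (v q) * W.opK u q)) (measure0 G) := fun v hv => by
    have := integrable_testFn_mul (G := G) hv (f := fun q => theta W q * W.opK u q) fun q hq =>
      (hθ q hq).mul (continuousAt_opK W hu hq)
    simpa only [mul_left_comm] using this
  have hE : ∀ v ∈ TestFn n W.wickDom,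
      Integrable (fun q => theta W q * energy W v u q) (measure0 G) := fun v hv =>
    (continuous_of_zero_off (isClosed_tsupport v) (fun q hq => (hθ q hq).mul
      (continuousAt_energy W hv.1 hu hq)) (fun q hq => by simp [energy_eq_zero W hq])
      hv.2.2).integrable_of_hasCompactSupport
    (HasCompactSupport.intro hv.2.1 fun q hq => by simp [energy_eq_zero W hq])
  refine testFn_induction ?_ ?_ ?_
  · have h1 : ∀ q, energy W 0 u q = 0 := fun q => energy_eq_zero W (by simp [tsupport])
    simp [h1]
  · intro v hv w hw h1 h2
    simp only [energy_add_left W hv.1 hw.1, Pi.add_apply, map_add, add_mul, mul_add]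
    rw [integral_add (hK v hv) (hK w hw), integral_add (hE v hv) (hE w hw), h1, h2]
  · intro c v hv
    rw [← integral_opKc_eq W hv hu]
    congr 1
    funext q
    by_cases hq : q ∈ tsupport v
    · rw [opK_eq_opKc W hu (hv.2.2 hq).1 (hv.2.2 hq).2]
    · simp [image_eq_zero_of_notMem_tsupport hq]

end Operator

/-! ### The kinetic density and the perturbation estimate. -/

section Kinetic

variable {n : ℕ} {S : Type*} [TopologicalSpace S] [ChartedSpace (Coord n) S]
  [IsManifold (𝓡 n) ω S] {G : AnalyticKGData n S}

/-- The derivative along the first factor. -/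
def dsf (u : ℝ × S → ℂ) (q : ℝ × S) : ℂ := deriv (fun s => u (s, q.2)) q.1

theorem dsf_toMfd {u : ℝ × S → ℂ} (hu : IsSmooth n u) {c : S} {p : ℝ × Coord n}
    (hp : p ∈ cpatch n c) : dsf u (toMfd n c p) = dS (u ∘ toMfd n c) p :=
  (dS_eq_deriv ((contDiffAt_comp_toMfd hu hp).differentiableAt (by simp))).symm

theorem continuous_dsf {u : ℝ × S → ℂ} (hu : IsSmooth n u) : Continuous (dsf u) := by
  refine continuous_iff_continuousAt.2 fun q => ?_
  have hs : q ∈ patch n q.2 := mem_extChartAt_source (I := 𝓡 n) q.2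
  have ht : (toCoord n q.2 q).2 ∈ (chart q.2).target := (chart (n := n) q.2).map_source hs
  exact continuousAt_of_toMfd hs
    (contDiffAt_fderiv_apply (contDiffAt_comp_toMfd hu ht) (1, 0)).continuousAt
    fun p hp => dsf_toMfd hu hp

theorem dsf_eq_zero {u : ℝ × S → ℂ} {q : ℝ × S} (hq : q ∉ tsupport u) : dsf u q = 0 := by
  have h : (fun s => u (s, q.2)) =ᶠ[𝓝 q.1] fun _ => 0 := by
    have h1 : ContinuousAt (fun s : ℝ => (s, q.2)) q.1 := by fun_prop
    filter_upwards [h1.eventually ((isClosed_tsupport u).isOpen_compl.mem_nhds hq)] with s hs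
    exact image_eq_zero_of_notMem_tsupport (f := u) hs
  rw [dsf, h.deriv_eq, deriv_const]

/-- The energy density of the unperturbed operator, in the coordinates of the chart around `c`. -/
def kinC (G : AnalyticKGData n S) (c : S) (u : ℝ × S → ℂ) (p : ℝ × Coord n) : ℂ :=
  conj (dS (u ∘ toMfd n c) p) * dS (u ∘ toMfd n c) p +
    bil ((gram0 G c p).map Complex.ofReal)⁻¹ (fun j => conj (dX (u ∘ toMfd n c) p j))
      (dX (u ∘ toMfd n c) p)

/-- The determinant of the real matrix h_0 has real logarithmic derivative, so the correction terms
vanish. Thus the invariance and regularity arguments for `locE` cover the kinetic density as well.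
-/
theorem kinC_eq_locE (G : AnalyticKGData n S) {c : S} (u : ℝ × S → ℂ) {p : ℝ × Coord n}
    (hp : p ∈ cpatch n c) : kinC G c u p =
      locE (fun p => (gram0 G c p).map Complex.ofReal) (fun _ => 0) (u ∘ toMfd n c)
        (u ∘ toMfd n c) p := by
  have hd := (contDiffAt_det fun j k => contDiffAt_gram0 G hp j k).differentiableAt
    (n := ∞) (by simp)
  have h1 : ∀ e, (fderiv ℝ (fun p => ((gram0 G c p).map Complex.ofReal).det) p e /
      ((gram0 G c p).map Complex.ofReal).det).im = 0 := by
    intro e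
    have := im_fderiv_div (D := fun _ => (1 : ℂ)) hd (gram0_posDef G hp).det_pos.ne'
      (differentiableAt_const _) one_ne_zero e
    simpa [det_map_ofReal] using this
  have h2 : imS (fun p => (gram0 G c p).map Complex.ofReal) p = 0 := by
    simp only [imS, dS, h1, Complex.ofReal_zero]
  have h3 : imX (fun p => (gram0 G c p).map Complex.ofReal) p = 0 := by
    funext j
    simp only [imX, dX, h1, Complex.ofReal_zero, Pi.zero_apply]
  simp [kinC, locE, h2, h3, bil]

theorem kinC_eq_kinC (G : AnalyticKGData n S) {u : ℝ × S → ℂ} (hu : IsSmooth n u) {c : S}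
    {p : ℝ × Coord n} (hp : p ∈ cpatch n c) {y : S}
    (hx' : (chart c).symm p.2 ∈ (chart (n := n) y).source) :
    kinC G c u p = kinC G y u (idProd (trans c y) p) := by
  have ht : idProd (trans c y) p ∈ cpatch n y := trans_mem_target hx'
  have hcomp : ∀ p' : ℝ × Coord n, (chart c).symm p'.2 ∈ (chart (n := n) y).source →
      toMfd n y (idProd (trans c y) p') = toMfd n c p' := fun p' h => Prod.ext rfl (symm_trans h)
  have hev : ∀ᶠ p' in 𝓝 p, p'.2 ∈ (chart c).target ∧
      (chart c).symm p'.2 ∈ (chart (n := n) y).source :=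
    continuousAt_snd.eventually (eventually_mem_overlap hp hx')
  rw [kinC_eq_locE G u hp, kinC_eq_locE G u ht]
  refine locE_idProd (τ := trans c y) ((contDiffAt_trans hp hx').of_le le_top)
    (det_jac_trans_ne_zero hp hx') ?_
    (fun j k => contDiffAt_ofReal (contDiffAt_gram0 G ht j k)) ?_ rfl ?_ ?_
    ((contDiffAt_comp_toMfd hu ht).differentiableAt (by simp))
    ((contDiffAt_comp_toMfd hu ht).differentiableAt (by simp))
  · filter_upwards [hev] with p' hp'
    rw [gram0, gram_real_eq _ hp'.1 hp'.2]
    ext j k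
    simp [Matrix.mul_apply, gram0, idProd]
  · rw [det_map_ofReal]
    exact_mod_cast (gram0_posDef G ht).det_pos.ne'
  · filter_upwards [hev] with p' hp'
    simp only [Function.comp_apply, hcomp p' hp'.2]
  · filter_upwards [hev] with p' hp'
    simp only [Function.comp_apply, hcomp p' hp'.2]

/-- The kinetic part of the density of the `H¹` norm. -/
def kin (G : AnalyticKGData n S) (u : ℝ × S → ℂ) (q : ℝ × S) : ℝ := h1Density G u q - ‖u q‖ ^ 2

theorem kin_self (G : AnalyticKGData n S) {u : ℝ × S → ℂ} (hu : IsSmooth n u) (q : ℝ × S) :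
    kin G u q = (kinC G q.2 u (toCoord n q.2 q)).re := by
  have hs : q ∈ patch n q.2 := mem_extChartAt_source (I := 𝓡 n) q.2
  have ht : toCoord n q.2 q ∈ cpatch n q.2 := (chart (n := n) q.2).map_source hs
  have hd := (contDiffAt_comp_toMfd hu ht).differentiableAt (n := ∞) (by simp)
  have h1 : dS (u ∘ toMfd n q.2) (toCoord n q.2 q) = deriv (fun s => u (s, q.2)) q.1 := by
    rw [← dsf_toMfd hu ht, toMfd_toCoord hs, dsf]
  have h2 : ∀ j, dX (u ∘ toMfd n q.2) (toCoord n q.2 q) j =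
      fderiv ℝ (fun x => u (q.1, (chart q.2).symm x)) (chart q.2 q.2) (stdVec j) := fun j =>
    dX_eq_fderiv hd j
  simp only [kin, h1Density, kinC, h1, h2, map_inv_ofReal, bil, Matrix.map_apply,
    Complex.add_re, add_sub_cancel_right]
  simp only [gram0, toCoord]
  rw [← Complex.normSq_eq_conj_mul_self, Complex.normSq_eq_norm_sq, Complex.ofReal_re]

theorem kin_toMfd (G : AnalyticKGData n S) {u : ℝ × S → ℂ} (hu : IsSmooth n u) {c : S}
    {p : ℝ × Coord n} (hp : p ∈ cpatch n c) : kin G u (toMfd n c p) = (kinC G c u p).re := by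
  rw [kin_self G hu, kinC_eq_kinC G hu hp
    (mem_extChartAt_source (I := 𝓡 n) ((chart c).symm p.2))]
  rfl

theorem contDiffAt_kinC (G : AnalyticKGData n S) {u : ℝ × S → ℂ} (hu : IsSmooth n u) {c : S}
    {p : ℝ × Coord n} (hp : p ∈ cpatch n c) : ContDiffAt ℝ ∞ (kinC G c u) p := by
  have hU := contDiffAt_comp_toMfd hu hp
  have hS : ContDiffAt ℝ ∞ (dS (u ∘ toMfd n c)) p := contDiffAt_fderiv_apply hU _
  have hX : ∀ j, ContDiffAt ℝ ∞ (fun p => dX (u ∘ toMfd n c) p j) p := fun j =>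
    contDiffAt_fderiv_apply hU _
  refine ((contDiffAt_conj hS).mul hS).add (contDiffAt_bil (contDiffAt_inv_apply
    (fun j k => contDiffAt_ofReal (contDiffAt_gram0 G hp j k)) ?_)
    (fun j => contDiffAt_conj (hX j)) hX)
  rw [det_map_ofReal]
  exact_mod_cast (gram0_posDef G hp).det_pos.ne'

theorem continuous_kin (G : AnalyticKGData n S) {u : ℝ × S → ℂ} (hu : IsSmooth n u) :
    Continuous (kin G u) := by
  refine continuous_iff_continuousAt.2 fun q => ?_
  have hs : q ∈ patch n q.2 := mem_extChartAt_source (I := 𝓡 n) q.2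
  have ht : (toCoord n q.2 q).2 ∈ (chart q.2).target := (chart (n := n) q.2).map_source hs
  exact continuousAt_of_toMfd hs
    (Complex.continuous_re.continuousAt.comp (contDiffAt_kinC G hu ht).continuousAt)
    fun p hp => kin_toMfd G hu hp

theorem kin_eq_zero (G : AnalyticKGData n S) {u : ℝ × S → ℂ} (hu : IsSmooth n u) {q : ℝ × S}
    (hq : q ∉ tsupport u) : kin G u q = 0 := by
  have hs : q ∈ patch n q.2 := mem_extChartAt_source (I := 𝓡 n) q.2
  have ht : (toCoord n q.2 q).2 ∈ (chart q.2).target := (chart (n := n) q.2).map_source hs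
  have h1 : u ∘ toMfd n q.2 =ᶠ[𝓝 (toCoord n q.2 q)] 0 := by
    have h2 : ∀ᶠ p in 𝓝 (toCoord n q.2 q), toMfd n q.2 p ∈ (tsupport u)ᶜ :=
      (continuousAt_toMfd ht).eventually
        (by rw [toMfd_toCoord hs]; exact (isClosed_tsupport u).isOpen_compl.mem_nhds hq)
    filter_upwards [h2] with p hp
    exact image_eq_zero_of_notMem_tsupport (f := u) hp
  rw [kin_self G hu, kinC]
  simp [dS, dX, h1.fderiv_eq, bil]

theorem exists_entry_bound {ι : Type*} [Fintype ι] (H : Matrix ι ι ℝ) :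
    ∃ L : ℝ, 0 < L ∧ ∑ j, ∑ k, |H j k| < L :=
  ⟨∑ j, ∑ k, |H j k| + 1, by positivity, lt_add_one _⟩

/-- A bound L on the entries of h_0 bounds the inverse metric from below by 1/L, so the kinetic
density controls every coordinate derivative; its two summands are real and nonnegative. -/
theorem kinC_bounds (G : AnalyticKGData n S) (u : ℝ × S → ℂ) {c : S} {p : ℝ × Coord n}
    (hp : p ∈ cpatch n c) {L : ℝ} (hL0 : 0 < L) (hL : ∑ j, ∑ k, |gram0 G c p j k| ≤ L) :
    (kinC G c u p).im = 0 ∧ ‖dS (u ∘ toMfd n c) p‖ ^ 2 ≤ (kinC G c u p).re ∧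
    ∀ j, ‖dX (u ∘ toMfd n c) p j‖ ^ 2 ≤ L * (kinC G c u p).re := by
  obtain ⟨h1, h2⟩ := bil_inv_conj (gram0_posDef G hp) hL0 hL (dX (u ∘ toMfd n c) p)
  have h3 : 0 ≤ (bil ((gram0 G c p)⁻¹.map Complex.ofReal)
      (fun j => conj (dX (u ∘ toMfd n c) p j)) (dX (u ∘ toMfd n c) p)).re := by
    rw [bil_conj_eq (by simpa using (gram0_posDef G hp).inv.1.eq), Complex.ofReal_re]
    have := (gram0_posDef G hp).inv.posSemidef
    exact add_nonneg (by simpa using this.dotProduct_mulVec_nonneg _)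
      (by simpa using this.dotProduct_mulVec_nonneg _)
  have e : kinC G c u p = ((‖dS (u ∘ toMfd n c) p‖ ^ 2 : ℝ) : ℂ) +
      bil ((gram0 G c p)⁻¹.map Complex.ofReal)
      (fun j => conj (dX (u ∘ toMfd n c) p j)) (dX (u ∘ toMfd n c) p) := by
    rw [kinC, map_inv_ofReal, ← Complex.normSq_eq_conj_mul_self, Complex.normSq_eq_norm_sq]
  rw [e, Complex.add_im, Complex.add_re, Complex.ofReal_im, Complex.ofReal_re, h1]
  refine ⟨by simp, le_add_of_nonneg_right h3, fun j => (h2 j).trans ?_⟩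
  exact mul_le_mul_of_nonneg_left (le_add_of_nonneg_left (by positivity)) hL0.le

theorem norm_dsf_sq_le_kin (G : AnalyticKGData n S) {u : ℝ × S → ℂ} (hu : IsSmooth n u)
    (q : ℝ × S) : ‖dsf u q‖ ^ 2 ≤ kin G u q := by
  have hs : q ∈ patch n q.2 := mem_extChartAt_source (I := 𝓡 n) q.2
  have ht : toCoord n q.2 q ∈ cpatch n q.2 := (chart (n := n) q.2).map_source hs
  obtain ⟨L, hL0, hL⟩ := exists_entry_bound (gram0 G q.2 (toCoord n q.2 q))
  rw [kin_self G hu]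
  have := (kinC_bounds G u ht hL0 hL.le).2.1
  rwa [← dsf_toMfd hu ht, toMfd_toCoord hs] at this

theorem kin_nonneg (G : AnalyticKGData n S) {u : ℝ × S → ℂ} (hu : IsSmooth n u) (q : ℝ × S) :
    0 ≤ kin G u q := (by positivity : (0 : ℝ) ≤ ‖dsf u q‖ ^ 2).trans (norm_dsf_sq_le_kin G hu q)

/-- The perturbation estimate in coordinates. -/
theorem norm_locE_sub_le (W : HolExtension G) (u : ℝ × S → ℂ) {c : S} {p : ℝ × Coord n}
    (hp : p ∈ cpatch n c) {L b m : ℝ} (hL1 : 1 ≤ L) (hL : ∑ j, ∑ k, |gram0 G c p j k| ≤ L)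
    (hA : (∑ j, ∑ k, ‖((gramW W c p)⁻¹ - ((gram0 G c p).map Complex.ofReal)⁻¹) j k‖) * L ≤ 1 / 8)
    (hb : ∑ j, ∑ k, ‖(gramW W c p)⁻¹ j k‖ ≤ b) (hS : ‖imS (gramW W c) p‖ ≤ m)
    (hX : ∀ j, ‖imX (gramW W c) p j‖ ≤ m) (hq : ‖potW W c p‖ ≤ m) :
    ‖locE (gramW W c) (potW W c) (u ∘ toMfd n c) (u ∘ toMfd n c) p - kinC G c u p‖ ≤
      (kinC G c u p).re / 4 + ((m * (1 + b * L)) ^ 2 + m) * ‖u (toMfd n c p)‖ ^ 2 := by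
  obtain ⟨-, h1, h2⟩ := kinC_bounds G u hp (by linarith) hL
  set T := (kinC G c u p).re with hT
  set U := u ∘ toMfd n c with hU
  have hT0 : 0 ≤ T := (sq_nonneg _).trans h1
  have hm : 0 ≤ m := (norm_nonneg _).trans hS
  have hb0 : 0 ≤ b := (Finset.sum_nonneg fun j _ => Finset.sum_nonneg fun k _ =>
    norm_nonneg _).trans hb
  have e : locE (gramW W c) (potW W c) U U p - kinC G c u p =
      bil ((gramW W c p)⁻¹ - ((gram0 G c p).map Complex.ofReal)⁻¹)
        (fun j => conj (dX U p j)) (dX U p)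
      - Complex.I / 2 * conj (U p) * (imS (gramW W c) p * dS U p +
        bil (gramW W c p)⁻¹ (imX (gramW W c) p) (dX U p)) + potW W c p * conj (U p) * U p := by
    have : bil ((gramW W c p)⁻¹ - ((gram0 G c p).map Complex.ofReal)⁻¹)
        (fun j => conj (dX U p j)) (dX U p) =
        bil (gramW W c p)⁻¹ (fun j => conj (dX U p j)) (dX U p) -
        bil ((gram0 G c p).map Complex.ofReal)⁻¹ (fun j => conj (dX U p j)) (dX U p) := by
      simp only [bil, Matrix.sub_apply, ← Finset.sum_sub_distrib]
      refine Finset.sum_congr rfl fun j _ => Finset.sum_congr rfl fun k _ => by ring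
    rw [this, locE, kinC]
    ring
  -- All derivatives are now measured by √T. Three errors remain: the change of the inverse metric
  -- (at most T/8), the imaginary first order terms, and the potential.
  have hsS : ‖dS U p‖ ≤ Real.sqrt T := Real.le_sqrt_of_sq_le h1
  have hsX : ∀ j, ‖dX U p j‖ ≤ Real.sqrt (L * T) := fun j => Real.le_sqrt_of_sq_le (h2 j)
  have hLT : Real.sqrt (L * T) ≤ L * Real.sqrt T := by
    rw [Real.sqrt_mul (by linarith)]
    exact mul_le_mul_of_nonneg_right ((Real.sqrt_le_left (by linarith)).2 (by nlinarith))
      (Real.sqrt_nonneg _)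
  have b1 : ‖bil ((gramW W c p)⁻¹ - ((gram0 G c p).map Complex.ofReal)⁻¹)
        (fun j => conj (dX U p j)) (dX U p)‖ ≤ T / 8 := by
    refine (norm_bil_le _ (fun j => by simpa using hsX j) hsX (Real.sqrt_nonneg _)).trans ?_
    rw [Real.mul_self_sqrt (by positivity), ← mul_assoc]
    nlinarith
  have b2 : ‖bil (gramW W c p)⁻¹ (imX (gramW W c) p) (dX U p)‖ ≤
      b * (m * (L * Real.sqrt T)) := by
    refine (norm_bil_le _ hX (fun j => (hsX j).trans hLT) hm).trans ?_
    exact mul_le_mul_of_nonneg_right hb (by positivity)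
  have b3 : ‖imS (gramW W c) p * dS U p‖ ≤ m * Real.sqrt T := by
    rw [norm_mul]
    exact mul_le_mul hS hsS (norm_nonneg _) hm
  have b4 : ‖Complex.I / 2 * conj (U p) * (imS (gramW W c) p * dS U p +
        bil (gramW W c p)⁻¹ (imX (gramW W c) p) (dX U p))‖ ≤
      1 / 2 * ‖U p‖ * (m * (1 + b * L) * Real.sqrt T) := by
    rw [norm_mul, norm_mul, norm_div, Complex.norm_I, RCLike.norm_conj, Complex.norm_two]
    refine mul_le_mul_of_nonneg_left ((norm_add_le _ _).trans ?_) (by positivity)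
    linarith
  have b5 : ‖potW W c p * conj (U p) * U p‖ ≤ m * ‖U p‖ ^ 2 := by
    rw [norm_mul, norm_mul, RCLike.norm_conj, mul_assoc, ← sq]
    exact mul_le_mul_of_nonneg_right hq (by positivity)
  rw [e]
  have b6 := (norm_add_le _ _).trans (add_le_add ((norm_sub_le _ _).trans (add_le_add b1 b4)) b5)
  refine b6.trans ?_
  -- Young's inequality: with X = m(1 + bL), the first order error ½ |u| X √T is at most T/8 + ½
  -- X²|u|². With the T/8 from the principal part this gives T/4.
  have b7 := sq_nonneg (Real.sqrt T / 2 - ‖U p‖ * (m * (1 + b * L)))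
  have b8 := Real.sq_sqrt hT0
  have hUp : u (toMfd n c p) = U p := rfl
  rw [hUp]
  have b9 : 0 ≤ (m * (1 + b * L)) ^ 2 * ‖U p‖ ^ 2 := by positivity
  have b10 := sq_nonneg (Real.sqrt T / 2 - 1 / 2 * ‖U p‖ * (m * (1 + b * L)))
  nlinarith

end Kinetic

/-! ### Choice of the thickness and geometry of the tube. -/

section Tube

variable {n : ℕ} {S : Type*} [TopologicalSpace S] [ChartedSpace (Coord n) S]
  [IsManifold (𝓡 n) ω S] {G : AnalyticKGData n S}

theorem theta_zero (W : HolExtension G) (y : S) : theta W (0, y) = 1 := by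
  have hs : y ∈ (chart (n := n) y).source := mem_extChartAt_source y
  have ht : (chart (n := n) y) y ∈ (chart (n := n) y).target := (chart y).map_source hs
  have h := (gram0_posDef G (p := (0, chart y y)) ht).det_pos
  change Real.sqrt (‖(gramW W y (0, chart y y)).det‖ / (gram0 G y (0, chart y y)).det) = 1
  rw [gramW_zero, det_map_ofReal, Complex.norm_real, Real.norm_of_nonneg h.le, div_self h.ne',
    Real.sqrt_one]

/-- At (0, y₀) the inverse matrices of h_{is} and h_0 coincide and θ = 1; all coefficients are
continuous there. Hence the hypotheses of the perturbation estimate, with fixed constants, hold on a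
whole neighborhood of (0, y₀), in the one chart around y₀. -/
theorem exists_local_bound (W : HolExtension G) {V : Set (ℝ × S)} (hV : IsOpen V)
    (hV0 : ∀ y : S, ((0 : ℝ), y) ∈ V) (y₀ : S) :
    ∃ δ : ℝ, 0 < δ ∧ ∃ B : ℝ, 0 ≤ B ∧ ∀ᶠ y in 𝓝 y₀, ∀ s : ℝ, |s| < δ →
      (s, y) ∈ V ∩ G.dom ∩ W.wickDom ∧ 1 / 2 ≤ theta W (s, y) ∧ theta W (s, y) ≤ 2 ∧
      ∀ u, IsSmooth n u → ‖energy W u u (s, y) - kin G u (s, y)‖ ≤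
        kin G u (s, y) / 4 + B * ‖u (s, y)‖ ^ 2 := by
  have hs : y₀ ∈ (chart (n := n) y₀).source := mem_extChartAt_source y₀
  have ht : (chart (n := n) y₀) y₀ ∈ (chart (n := n) y₀).target := (chart y₀).map_source hs
  set p₀ : ℝ × Coord n := (0, chart y₀ y₀) with hp₀
  have hq₀ : toMfd n y₀ p₀ = (0, y₀) := Prod.ext rfl ((chart y₀).left_inv hs)
  have hW0 : ((0 : ℝ), y₀) ∈ W.wickDom := by
    simpa [HolExtension.wickDom] using W.zero_mem y₀
  have hW : toMfd n y₀ p₀ ∈ W.wickDom := by rwa [hq₀]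
  have hA : ∀ j k, ContDiffAt ℝ ∞ (fun p => gramW W y₀ p j k) p₀ := fun j k =>
    contDiffAt_gramW W ht hW j k
  have hH : ∀ j k, ContDiffAt ℝ ∞ (fun p => gram0 G y₀ p j k) p₀ := fun j k =>
    contDiffAt_gram0 G ht j k
  have hD := gramW_det_ne_zero W (p := p₀) ht hW
  have hH0 : ((gram0 G y₀ p₀).map Complex.ofReal).det ≠ 0 := by
    rw [det_map_ofReal]
    exact_mod_cast (gram0_posDef G (p := p₀) ht).det_pos.ne'
  have hAi := contDiffAt_inv_apply hA hD
  have hHi := contDiffAt_inv_apply (fun j k => contDiffAt_ofReal (hH j k)) hH0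
  obtain ⟨L, hL0, hL⟩ := exists_entry_bound (gram0 G y₀ p₀)
  set L' := L + 1 with hL'
  set b := ∑ j, ∑ k, ‖(gramW W y₀ p₀)⁻¹ j k‖ + 1 with hb
  set m := ‖imS (gramW W y₀) p₀‖ + ∑ j, ‖imX (gramW W y₀) p₀ j‖ + ‖potW W y₀ p₀‖ + 1 with hm
  have e1 : ∀ᶠ p in 𝓝 p₀, ∑ j, ∑ k, |gram0 G y₀ p j k| < L' := by
    have : ContinuousAt (fun p => ∑ j, ∑ k, |gram0 G y₀ p j k|) p₀ :=
      tendsto_finsetSum _ fun j _ => tendsto_finsetSum _ fun k _ => (hH j k).continuousAt.abs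
    exact this.eventually_lt continuousAt_const (by linarith)
  have e2 : ∀ᶠ p in 𝓝 p₀, (∑ j, ∑ k, ‖((gramW W y₀ p)⁻¹ -
      ((gram0 G y₀ p).map Complex.ofReal)⁻¹) j k‖) * L' < 1 / 8 := by
    have : ContinuousAt (fun p => (∑ j, ∑ k, ‖((gramW W y₀ p)⁻¹ -
        ((gram0 G y₀ p).map Complex.ofReal)⁻¹) j k‖) * L') p₀ :=
      ContinuousAt.mul (tendsto_finsetSum _ fun j _ => tendsto_finsetSum _ fun k _ =>
        ((hAi j k).continuousAt.sub (hHi j k).continuousAt).norm) continuousAt_const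
    refine this.eventually_lt continuousAt_const ?_
    rw [hp₀, gramW_zero, sub_self]
    simp
  have e3 : ∀ᶠ p in 𝓝 p₀, ∑ j, ∑ k, ‖(gramW W y₀ p)⁻¹ j k‖ < b := by
    have : ContinuousAt (fun p => ∑ j, ∑ k, ‖(gramW W y₀ p)⁻¹ j k‖) p₀ :=
      tendsto_finsetSum _ fun j _ => tendsto_finsetSum _ fun k _ => (hAi j k).continuousAt.norm
    exact this.eventually_lt continuousAt_const (by linarith)
  have hX0 : 0 ≤ ∑ j, ‖imX (gramW W y₀) p₀ j‖ := Finset.sum_nonneg fun j _ => norm_nonneg _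
  have e4 : ∀ᶠ p in 𝓝 p₀, ‖imS (gramW W y₀) p‖ < m :=
    (contDiffAt_imS hA hD).continuousAt.norm.eventually_lt continuousAt_const
      (by rw [hm]; linarith [norm_nonneg (potW W y₀ p₀)])
  have e5 : ∀ᶠ p in 𝓝 p₀, ∀ j, ‖imX (gramW W y₀) p j‖ < m := by
    refine eventually_all.2 fun j => ?_
    refine (contDiffAt_imX hA hD j).continuousAt.norm.eventually_lt continuousAt_const ?_
    have := Finset.single_le_sum (f := fun j => ‖imX (gramW W y₀) p₀ j‖)
      (fun j _ => norm_nonneg _) (Finset.mem_univ j)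
    rw [hm]
    linarith [norm_nonneg (potW W y₀ p₀), norm_nonneg (imS (gramW W y₀) p₀)]
  have e6 : ∀ᶠ p in 𝓝 p₀, ‖potW W y₀ p‖ < m :=
    (contDiffAt_potW W (p := p₀) ht hW).continuousAt.norm.eventually_lt continuousAt_const
      (by rw [hm]; linarith [norm_nonneg (imS (gramW W y₀) p₀)])
  have hc : ContinuousAt (toCoord n y₀) (0, y₀) := continuousAt_toCoord hs
  have e7 := hc.eventually (e1.and (e2.and (e3.and (e4.and (e5.and e6)))))
  have e8 : ∀ᶠ q in 𝓝 ((0 : ℝ), y₀), q ∈ patch n y₀ ∧ q ∈ V ∩ G.dom ∩ W.wickDom :=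
    eventually_patch hs ((hV.inter G.isOpen_dom).inter (isOpen_wickDom W))
      ⟨⟨hV0 y₀, G.zero_mem y₀⟩, hW0⟩
  have e9 : ∀ᶠ q in 𝓝 ((0 : ℝ), y₀), 1 / 2 < theta W q ∧ theta W q < 2 := by
    have h := continuousAt_theta W hW0
    refine (continuousAt_const.eventually_lt h ?_).and (h.eventually_lt continuousAt_const ?_) <;>
    · rw [theta_zero]; norm_num
  have e10 := e7.and (e8.and e9)
  -- A product neighborhood inside the good set yields one δ valid for all y near y₀.
  rw [nhds_prod_eq, eventually_prod_iff] at e10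
  obtain ⟨pa, hpa, pb, hpb, h⟩ := e10
  obtain ⟨δ, hδ, hδa⟩ := Metric.eventually_nhds_iff.1 hpa
  refine ⟨δ, hδ, (m * (1 + b * L')) ^ 2 + m, by positivity, ?_⟩
  filter_upwards [hpb] with y hy s hsδ
  obtain ⟨⟨f1, f2, f3, f4, f5, f6⟩, ⟨f7, f8⟩, f9, f10⟩ :=
    h (hδa (by simpa [Real.dist_eq] using hsδ)) hy
  refine ⟨f8, f9.le, f10.le, fun u hu => ?_⟩
  have hp : toCoord n y₀ (s, y) ∈ cpatch n y₀ := (chart y₀).map_source f7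
  have hback : toMfd n y₀ (toCoord n y₀ (s, y)) = (s, y) := toMfd_toCoord f7
  have hfin := norm_locE_sub_le W u hp (by linarith) f1.le f2.le f3.le f4.le
    (fun j => (f5 j).le) f6.le
  rw [← energy_toMfd W hu hu hp (by rw [hback]; exact f8.2), ← kin_toMfd G hu hp, hback] at hfin
  have him : ((kin G u (s, y) : ℝ) : ℂ) = kinC G y₀ u (toCoord n y₀ (s, y)) := by
    have h2 := kin_toMfd G hu hp
    rw [hback] at h2
    refine Complex.ext ?_ ?_
    · rw [Complex.ofReal_re, h2]
    · rw [Complex.ofReal_im]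
      exact (kinC_bounds G u hp (L := L') (by linarith) f1.le).1.symm
  rw [him]
  exact hfin

/-- The thickness `ε` is admissible at the point `y`. -/
def IsGood (W : HolExtension G) (V : Set (ℝ × S)) (y : S) (ε : ℝ) : Prop :=
  0 < ε ∧ ε ≤ 1 ∧ ∀ s : ℝ, |s| < ε →
    (s, y) ∈ V ∩ G.dom ∩ W.wickDom ∧ 1 / 2 ≤ theta W (s, y) ∧ theta W (s, y) ≤ 2 ∧
    ∀ u, IsSmooth n u → ‖energy W u u (s, y) - kin G u (s, y)‖ ≤
      kin G u (s, y) / 4 + 1 / 64 * (‖u (s, y)‖ ^ 2 * (ε⁻¹) ^ 2)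

/-- Shrinking ε reduces the range of s and enlarges the weight ε⁻². So the admissible thicknesses at
y form an interval with lower end 0, in particular a convex set. -/
theorem IsGood.mono {W : HolExtension G} {V : Set (ℝ × S)} {y : S} {ε ε' : ℝ}
    (h : IsGood W V y ε) (h0 : 0 < ε') (hle : ε' ≤ ε) : IsGood W V y ε' := by
  refine ⟨h0, hle.trans h.2.1, fun s hs => ?_⟩
  obtain ⟨h1, h2, h3, h4⟩ := h.2.2 s (hs.trans_le hle)
  have hε := inv_nonneg.2 h.1.le
  refine ⟨h1, h2, h3, fun u hu => (h4 u hu).trans ?_⟩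
  gcongr

/-- Constants are admissible locally and the admissible sets are convex, so a partition of unity
averages local constants into a smooth global ε. -/
theorem exists_thickness [SecondCountableTopology S] [T2Space S] (W : HolExtension G)
    {V : Set (ℝ × S)} (hV : IsOpen V) (hV0 : ∀ y : S, ((0 : ℝ), y) ∈ V) :
    ∃ ε : S → ℝ, ContMDiff (𝓡 n) 𝓘(ℝ, ℝ) ∞ ε ∧ ∀ y, IsGood W V y (ε y) := by
  have : LocallyCompactSpace S := ChartedSpace.locallyCompactSpace (Coord n) S
  have hconv : ∀ y, Convex ℝ {ε : ℝ | IsGood W V y ε} := fun y => by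
    refine OrdConnected.convex ⟨fun a ha b hb x hx => ?_⟩
    exact IsGood.mono hb (ha.1.trans_le hx.1) hx.2
  obtain ⟨g, hg⟩ := exists_contMDiffMap_forall_mem_convex_of_local_const (I := 𝓡 n)
    (n := (⊤ : ℕ∞)) (F := ℝ) hconv fun y₀ => by
      obtain ⟨δ, hδ, B, hB, h⟩ := exists_local_bound W hV hV0 y₀
      -- The last entry makes ε⁻² ≥ 64 (B + 1)² ≥ 64 B, so the local constant B is dominated by the
      -- Poincaré weight; ε ≤ 1 is used later to compare ε⁻²|u|² with |u|².
      set ε := min (min δ 1) (1 / (8 * (B + 1))) with hε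
      have hε0 : 0 < ε := lt_min (lt_min hδ one_pos) (by positivity)
      have hBε : B ≤ 1 / 64 * (ε⁻¹) ^ 2 := by
        have h1 : ε ≤ 1 / (8 * (B + 1)) := min_le_right _ _
        have h2 : 8 * (B + 1) ≤ ε⁻¹ := by
          rw [← one_div]
          rw [le_div_iff₀ (by positivity)] at h1 ⊢
          linarith
        nlinarith
      refine ⟨ε, h.mono fun y hy => ⟨hε0, (min_le_left _ _).trans (min_le_right _ _),
        fun s hs => ?_⟩⟩
      obtain ⟨h1, h2, h3, h4⟩ := hy s (hs.trans_le ((min_le_left _ _).trans (min_le_left _ _)))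
      refine ⟨h1, h2, h3, fun u hu => (h4 u hu).trans ?_⟩
      have := mul_le_mul_of_nonneg_right hBε (sq_nonneg ‖u (s, y)‖)
      linarith
  exact ⟨g, g.contMDiff, hg⟩

/-- The tube of thickness `ε` around `{0} × S`. -/
def tube (ε : S → ℝ) : Set (ℝ × S) := {q | |q.1| < ε q.2}

theorem isOpen_tube {ε : S → ℝ} (hε : Continuous ε) : IsOpen (tube ε) :=
  isOpen_lt (by fun_prop) (by fun_prop)

/-- The function s² - ε(y)² defines the tube and, unlike |s| - ε(y), is smooth everywhere. On the
boundary |s| = ε > 0, so its s-derivative 2s does not vanish. -/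
theorem hasSmoothBoundary_tube {ε : S → ℝ} (hε : ContMDiff (𝓡 n) 𝓘(ℝ, ℝ) ∞ ε)
    (h0 : ∀ y, 0 < ε y) : HasSmoothBoundary n (tube ε) := by
  intro p hp
  have hρ : ContMDiff (𝓘(ℝ, ℝ).prod (𝓡 n)) 𝓘(ℝ, ℝ) ∞
      (fun q : ℝ × S => q.1 ^ 2 - ε q.2 ^ 2) :=
    (contMDiff_fst.pow 2).sub ((hε.comp contMDiff_snd).pow 2)
  refine ⟨univ, fun q => q.1 ^ 2 - ε q.2 ^ 2, isOpen_univ, mem_univ _, hρ.contMDiffOn, ?_, ?_⟩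
  · have hpe : |p.1| = ε p.2 :=
      frontier_lt_subset_eq (f := fun q : ℝ × S => |q.1|) (g := fun q => ε q.2) (by fun_prop)
        (hε.continuous.comp continuous_snd) hp
    have hp1 : p.1 ≠ 0 := by
      intro h
      rw [h, abs_zero] at hpe
      exact (h0 p.2).ne hpe
    intro hz
    have hγ : MDifferentiableAt 𝓘(ℝ, ℝ) (𝓘(ℝ, ℝ).prod (𝓡 n)) (fun s : ℝ => (s, p.2)) p.1 :=
      mdifferentiableAt_id.prodMk mdifferentiableAt_const
    have h1 := mfderiv_comp (I := 𝓘(ℝ, ℝ)) (I' := 𝓘(ℝ, ℝ).prod (𝓡 n)) (I'' := 𝓘(ℝ, ℝ)) p.1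
      (g := fun q : ℝ × S => q.1 ^ 2 - ε q.2 ^ 2) (f := fun s : ℝ => (s, p.2))
      ((hρ p).mdifferentiableAt (by simp)) hγ
    have h2 : HasDerivAt (fun s : ℝ => s ^ 2 - ε p.2 ^ 2) (2 * p.1) p.1 := by
      simpa using (hasDerivAt_pow 2 p.1).sub_const (ε p.2 ^ 2)
    rw [hz, mfderiv_eq_fderiv] at h1
    have h3 := congrArg (fun L : ℝ →L[ℝ] ℝ => L 1) h1
    have h4 : fderiv ℝ (fun s : ℝ => s ^ 2 - ε p.2 ^ 2) p.1 1 = 2 * p.1 := by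
      rw [fderiv_apply_one_eq_deriv, h2.deriv]
    refine hp1 ?_
    have h5 : 2 * p.1 = 0 := h4.symm.trans (h3.trans rfl)
    linarith
  · intro q _
    change |q.1| < ε q.2 ↔ q.1 ^ 2 - ε q.2 ^ 2 < 0
    rw [sub_neg, sq_lt_sq, abs_of_pos (h0 q.2)]

end Tube

/-! ### The weighted Poincaré inequality. -/

section Estimates

variable {n : ℕ} {S : Type*} [TopologicalSpace S] [ChartedSpace (Coord n) S]
  [IsManifold (𝓡 n) ω S] {G : AnalyticKGData n S}
  [SecondCountableTopology S] [MeasurableSpace S] [BorelSpace S] [T2Space S] [Nonempty S]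

theorem integrable_of_zero_off {E : Type*} [NormedAddCommGroup E] {f : ℝ × S → E} {K : Set (ℝ × S)}
    (hf : Continuous f) (hK : IsCompact K) (h0 : ∀ q ∉ K, f q = 0) :
    Integrable f (measure0 G) := by
  have : SecondCountableTopologyEither (ℝ × S) E := inferInstance
  exact hf.integrable_of_hasCompactSupport (HasCompactSupport.intro hK h0)

/-- The density |h_0|^{1/2} does not depend on s, so it commutes with ∂_s, and in each patch the
integrand is a derivative of a compactly supported function. This is why estimates are made with the
measure at time zero. -/
theorem integral_dsf_eq_zero : ∀ F ∈ TestFn n (univ : Set (ℝ × S)),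
    ∫ q, dsf F q ∂(measure0 G) = 0 := by
  have hint : ∀ F ∈ TestFn n (univ : Set (ℝ × S)), Integrable (dsf F) (measure0 G) := fun F hF =>
    integrable_of_zero_off (continuous_dsf hF.1) hF.2.1 fun q hq => dsf_eq_zero hq
  refine testFn_induction ?_ ?_ ?_
  · have : ∀ q : ℝ × S, dsf (0 : ℝ × S → ℂ) q = 0 := fun q => dsf_eq_zero (by simp [tsupport])
    simp [this]
  · intro v hv w hw h1 h2
    have hd : ∀ {v : ℝ × S → ℂ}, IsSmooth n v → ∀ q : ℝ × S,
        DifferentiableAt ℝ (fun s => v (s, q.2)) q.1 := fun hv q => by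
      have h := hv.comp (contMDiff_id.prodMk contMDiff_const :
        ContMDiff 𝓘(ℝ, ℝ) (𝓘(ℝ, ℝ).prod (𝓡 n)) ∞ fun s : ℝ => (s, q.2))
      exact (contMDiff_iff_contDiff.1 h).contDiffAt.differentiableAt (by simp)
    have h3 : dsf (v + w) = fun q => dsf v q + dsf w q := by
      funext q
      exact deriv_add (hd hv.1 q) (hd hw.1 q)
    rw [h3, integral_add (hint v hv) (hint w hw), h1, h2, add_zero]
  · intro c F hF
    have hF' : F ∈ TestFn n (univ : Set (ℝ × S)) := ⟨hF.1, hF.2.1, subset_univ _⟩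
    obtain ⟨h1, h2, h3⟩ := testFn_coord hF
    set F' := (cpatch n c).indicator (F ∘ toMfd n c) with hFdef
    rw [integral_measure0_eq G c (continuous_dsf hF.1).aestronglyMeasurable
      (fun q hq => dsf_eq_zero fun h => hq (hF.2.2 h).1)]
    have hw : ∀ p ∈ cpatch n c, ContDiffAt ℝ ∞ (fun p => (dens0 G c p : ℂ)) p := fun p hp =>
      contDiffAt_ofReal ((contDiffAt_det fun j k => contDiffAt_gram0 G hp j k).sqrt
        (gram0_posDef G hp).det_pos.ne')
    have hz : ∀ p ∉ tsupport F', (dens0 G c p : ℂ) * F' p = 0 := fun p hp => by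
      rw [image_eq_zero_of_notMem_tsupport hp, mul_zero]
    have hsm : ContDiff ℝ ∞ fun p => (dens0 G c p : ℂ) * F' p :=
      contDiff_of_tsupport_subset (O := cpatch n c) (isClosed_tsupport F')
        (fun p hp => (hw p hp).mul h1.contDiffAt) hz (h3.trans inter_subset_left)
    have h4 := integral_fderiv_eq_zero (volume : Measure (ℝ × Coord n)) (hsm.of_le (by simp))
      (HasCompactSupport.intro h2 hz) (1, 0)
    have h5 : ∀ p ∉ cpatch n c, fderiv ℝ (fun p => (dens0 G c p : ℂ) * F' p) p (1, 0) = 0 := by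
      intro p hp
      have hp' : p ∉ tsupport F' := fun h => hp (h3 h).1
      have : (fun p => (dens0 G c p : ℂ) * F' p) =ᶠ[𝓝 p] fun _ => 0 := by
        filter_upwards [(isClosed_tsupport F').isOpen_compl.mem_nhds hp'] with p' h using hz p' h
      rw [this.fderiv_eq]
      simp
    rw [← setIntegral_eq_integral_of_forall_compl_eq_zero h5] at h4
    rw [← h4]
    refine setIntegral_congr_fun (isOpen_cpatch c).measurableSet fun p hp => ?_
    have e1 : dS F' p = dsf F (toMfd n c p) := by
      rw [dsf_toMfd hF.1 hp]
      have : F' =ᶠ[𝓝 p] F ∘ toMfd n c := by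
        filter_upwards [(isOpen_cpatch c).mem_nhds hp] with p' hp'
        exact indicator_of_mem hp' _
      rw [dS, dS, this.fderiv_eq]
    have hd' := h1.contDiffAt (x := p) |>.differentiableAt (by simp)
    have e2 : dS (fun p => (dens0 G c p : ℂ) * F' p) p = dens0 G c p * dS F' p := by
      rw [dS_eq_deriv (hsm.contDiffAt.differentiableAt (by simp)), dS_eq_deriv hd']
      have hsl : DifferentiableAt ℝ (fun s => F' (s, p.2)) p.1 :=
        hd'.comp p.1 (f := fun s : ℝ => (s, p.2)) (by fun_prop)
      exact (hsl.hasDerivAt.const_mul (dens0 G c p : ℂ)).deriv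
    simp only [Complex.real_smul]
    rw [← e1]
    exact e2.symm

variable {ε : S → ℝ}

/-- The Poincaré inequality in a tube. -/
theorem poincare (hε : ContMDiff (𝓡 n) 𝓘(ℝ, ℝ) ∞ ε) (h0 : ∀ y, 0 < ε y) {u : ℝ × S → ℂ}
    (hu : u ∈ TestFn n (tube ε)) :
    ∫ q, ‖u q‖ ^ 2 * ((ε q.2)⁻¹) ^ 2 ∂(measure0 G) ≤ 4 * ∫ q, kin G u q ∂(measure0 G) := by
  have hz : ∀ q ∉ tsupport u, u q = 0 := fun q hq => image_eq_zero_of_notMem_tsupport hq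
  have hinv : ContMDiff (𝓘(ℝ, ℝ).prod (𝓡 n)) 𝓘(ℝ, ℝ) ∞ (fun q : ℝ × S => (ε q.2)⁻¹) :=
    (hε.comp contMDiff_snd).inv₀ fun q => (h0 q.2).ne'
  have hn : ContMDiff (𝓘(ℝ, ℝ).prod (𝓡 n)) 𝓘(ℝ, ℝ) ∞ (fun q : ℝ × S => ‖u q‖ ^ 2) :=
    (contDiff_norm_sq ℝ (E := ℂ) (n := ∞)).contMDiff.comp hu.1
  have hf : ContMDiff (𝓘(ℝ, ℝ).prod (𝓡 n)) 𝓘(ℝ, ℝ) ∞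
      (fun q : ℝ × S => ((ε q.2)⁻¹) ^ 2 * (q.1 * ‖u q‖ ^ 2)) :=
    (hinv.pow 2).mul (contMDiff_fst.mul hn)
  -- The function ε⁻² s |u|² has s-derivative ε⁻²|u|² + 2 ε⁻² s Re(ū ∂_s u), because ε depends only
  -- on y. Its integral vanishes, so the weighted norm equals minus the cross term.
  have hF : (fun q : ℝ × S => ((((ε q.2)⁻¹) ^ 2 * (q.1 * ‖u q‖ ^ 2) : ℝ) : ℂ)) ∈
      TestFn n (univ : Set (ℝ × S)) :=
    ⟨(Complex.ofRealCLM.contDiff (n := ∞)).contMDiff.comp hf,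
      HasCompactSupport.intro hu.2.1 fun q hq => by simp [hz q hq], subset_univ _⟩
  have hds : ∀ q, dsf (fun q : ℝ × S => ((((ε q.2)⁻¹) ^ 2 * (q.1 * ‖u q‖ ^ 2) : ℝ) : ℂ)) q =
      ((((ε q.2)⁻¹) ^ 2 * (‖u q‖ ^ 2 + q.1 * (2 * inner ℝ (u q) (dsf u q))) : ℝ) : ℂ) := by
    intro q
    have h := hu.1.comp (contMDiff_id.prodMk contMDiff_const :
      ContMDiff 𝓘(ℝ, ℝ) (𝓘(ℝ, ℝ).prod (𝓡 n)) ∞ fun s : ℝ => (s, q.2))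
    have h1 : HasDerivAt (fun s => u (s, q.2)) (dsf u q) q.1 :=
      ((contMDiff_iff_contDiff.1 h).contDiffAt.differentiableAt (by simp)).hasDerivAt
    have h2 := (((hasDerivAt_id q.1).mul h1.norm_sq).const_mul (((ε q.2)⁻¹) ^ 2)).ofReal_comp
    rw [dsf]
    refine h2.deriv.trans ?_
    simp
  have h1 := integral_dsf_eq_zero (G := G) _ hF
  simp only [hds] at h1
  rw [integral_complex_ofReal] at h1
  have h1' := Complex.ofReal_eq_zero.1 h1
  have hdc := continuous_dsf hu.1
  have hic := hinv.continuous
  have huc := hu.1.continuous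
  have i1 : Integrable (fun q => ‖u q‖ ^ 2 * ((ε q.2)⁻¹) ^ 2) (measure0 G) :=
    integrable_of_zero_off (by fun_prop) hu.2.1 fun q hq => by simp [hz q hq]
  have i2 : Integrable (fun q => ((ε q.2)⁻¹) ^ 2 * (‖u q‖ ^ 2 +
      q.1 * (2 * inner ℝ (u q) (dsf u q)))) (measure0 G) :=
    integrable_of_zero_off (by fun_prop) hu.2.1 fun q hq => by simp [hz q hq]
  have i3 : Integrable (kin G u) (measure0 G) :=
    integrable_of_zero_off (continuous_kin G hu.1) hu.2.1 fun q hq => kin_eq_zero G hu.1 hq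
  have hpt : ∀ q, ‖u q‖ ^ 2 * ((ε q.2)⁻¹) ^ 2 ≤ ((ε q.2)⁻¹) ^ 2 * (‖u q‖ ^ 2 +
      q.1 * (2 * inner ℝ (u q) (dsf u q))) + (1 / 2 * (‖u q‖ ^ 2 * ((ε q.2)⁻¹) ^ 2) +
      2 * kin G u q) := by
    intro q
    by_cases hq : q ∈ tsupport u
    · have hqε : |q.1| < ε q.2 := hu.2.2 hq
      have h2 := norm_dsf_sq_le_kin G hu.1 q
      have h3 := abs_real_inner_le_norm (u q) (dsf u q)
      have h4 : |q.1| * (ε q.2)⁻¹ ≤ 1 := by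
        rw [← div_eq_mul_inv, div_le_one (h0 q.2)]; exact hqε.le
      set e := (ε q.2)⁻¹
      have he : 0 < e := inv_pos.2 (h0 q.2)
      have h5 : |e ^ 2 * (q.1 * (2 * inner ℝ (u q) (dsf u q)))| ≤
          2 * (e * ‖u q‖) * ‖dsf u q‖ := by
        rw [abs_mul, abs_mul, abs_mul, abs_of_pos (by positivity : 0 < e ^ 2), abs_two]
        calc e ^ 2 * (|q.1| * (2 * |inner ℝ (u q) (dsf u q)|))
            = (|q.1| * e) * (2 * e * |inner ℝ (u q) (dsf u q)|) := by ring
          _ ≤ 1 * (2 * e * (‖u q‖ * ‖dsf u q‖)) := by gcongr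
          _ = _ := by ring
      have h6 := neg_abs_le (e ^ 2 * (q.1 * (2 * inner ℝ (u q) (dsf u q))))
      -- Since |s| e ≤ 1, the cross term is at most 2 e|u||∂_s u| ≤ ½ e²|u|² + 2|∂_s u|². Absorbing
      -- the first half on the left produces the factor 4.
      have h7 := sq_nonneg (e * ‖u q‖ - 2 * ‖dsf u q‖)
      nlinarith
    · simp [hz q hq, kin_eq_zero G hu.1 hq]
  have i4 : Integrable (fun q => 1 / 2 * (‖u q‖ ^ 2 * ((ε q.2)⁻¹) ^ 2) + 2 * kin G u q)
      (measure0 G) := (i1.const_mul (1 / 2)).add (i3.const_mul 2)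
  have h2 := integral_mono i1 (i2.add i4) hpt
  have h3 : ∫ q, ((((ε q.2)⁻¹) ^ 2 * (‖u q‖ ^ 2 + q.1 * (2 * inner ℝ (u q) (dsf u q)))) +
      (1 / 2 * (‖u q‖ ^ 2 * ((ε q.2)⁻¹) ^ 2) + 2 * kin G u q)) ∂(measure0 G) =
      1 / 2 * ∫ q, ‖u q‖ ^ 2 * ((ε q.2)⁻¹) ^ 2 ∂(measure0 G) + 2 * ∫ q, kin G u q ∂(measure0 G) := by
    rw [integral_add i2 i4, h1', zero_add, integral_add (i1.const_mul (1 / 2)) (i3.const_mul 2),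
      integral_const_mul, integral_const_mul]
  have h4 := h2.trans_eq h3
  linarith

end Estimates

/-! ### Comparison of the two measures, and linearity of the operator. -/

section Comparison

variable {n : ℕ} {S : Type*} [TopologicalSpace S] [ChartedSpace (Coord n) S]
  [IsManifold (𝓡 n) ω S] {G : AnalyticKGData n S}
  [SecondCountableTopology S] [MeasurableSpace S] [BorelSpace S] [Nonempty S]

/-- Domains on which the Wick rotated measure is comparable with the one at time zero. -/
structure IsComparable (W : HolExtension G) (Ω : Set (ℝ × S)) : Prop where
  isOpen : IsOpen Ω
  subset : Ω ⊆ W.wickDom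
  half_le : ∀ q ∈ Ω, 1 / 2 ≤ theta W q
  le_two : ∀ q ∈ Ω, theta W q ≤ 2

variable {W : HolExtension G} {Ω : Set (ℝ × S)}

namespace IsComparable

theorem wick_le (h : IsComparable W Ω) :
    (wickMeasure W).restrict Ω ≤ (2 : NNReal) • (measure0 G).restrict Ω := by
  rw [wickMeasure_restrict W h.isOpen h.subset]
  have : (2 : NNReal) • (measure0 G).restrict Ω =
      ((measure0 G).restrict Ω).withDensity fun _ => (2 : ℝ≥0∞) := by
    rw [withDensity_const]; rfl
  rw [this]
  refine withDensity_mono ?_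
  filter_upwards [ae_restrict_mem h.isOpen.measurableSet] with q hq
  refine (ENNReal.ofReal_le_ofReal (h.le_two q hq)).trans ?_
  simp

theorem le_wick (h : IsComparable W Ω) :
    (measure0 G).restrict Ω ≤ (2 : NNReal) • (wickMeasure W).restrict Ω := by
  have h1 : ((measure0 G).restrict Ω).withDensity (fun _ => (1 / 2 : ℝ≥0∞)) ≤
      (wickMeasure W).restrict Ω := by
    rw [wickMeasure_restrict W h.isOpen h.subset]
    refine withDensity_mono ?_
    filter_upwards [ae_restrict_mem h.isOpen.measurableSet] with q hq
    refine le_trans ?_ (ENNReal.ofReal_le_ofReal (h.half_le q hq))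
    rw [ENNReal.ofReal_div_of_pos two_pos]
    simp
  rw [withDensity_const] at h1
  intro T
  have h2 := h1 T
  simp only [Measure.smul_apply, smul_eq_mul] at h2 ⊢
  calc (measure0 G).restrict Ω T = 2 * (1 / 2 * (measure0 G).restrict Ω T) := by
        rw [← mul_assoc, ENNReal.mul_div_cancel (by simp) (by simp), one_mul]
    _ ≤ 2 * (wickMeasure W).restrict Ω T := by gcongr
    _ = _ := rfl

theorem absolutelyContinuous_measure0 (h : IsComparable W Ω) :
    (measure0 G).restrict Ω ≪ (wickMeasure W).restrict Ω :=
  (Measure.absolutelyContinuous_of_le h.le_wick).trans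
    (Measure.smul_absolutelyContinuous (c := (2 : NNReal)))

theorem isLocallyFiniteMeasure (h : IsComparable W Ω) :
    IsLocallyFiniteMeasure ((wickMeasure W).restrict Ω) :=
  Measure.isLocallyFiniteMeasure_of_le h.wick_le

theorem eLpNorm_measure0_le (h : IsComparable W Ω) (f : ℝ × S → ℂ) :
    eLpNorm f 2 ((measure0 G).restrict Ω) ≤
      (2 : ℝ≥0∞) ^ (1 / (2 : ℝ≥0∞)).toReal * eLpNorm f 2 ((wickMeasure W).restrict Ω) := by
  refine (eLpNorm_mono_measure f h.le_wick).trans (le_of_eq ?_)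
  exact eLpNorm_smul_measure_of_ne_top (by simp) f (2 : ℝ≥0∞)

theorem eLpNorm_wick_le (h : IsComparable W Ω) (f : ℝ × S → ℂ) :
    eLpNorm f 2 ((wickMeasure W).restrict Ω) ≤
      (2 : ℝ≥0∞) ^ (1 / (2 : ℝ≥0∞)).toReal * eLpNorm f 2 ((measure0 G).restrict Ω) := by
  refine (eLpNorm_mono_measure f h.wick_le).trans (le_of_eq ?_)
  exact eLpNorm_smul_measure_of_ne_top (by simp) f (2 : ℝ≥0∞)

theorem integral_wick (h : IsComparable W Ω) {E : Type*} [NormedAddCommGroup E] [NormedSpace ℝ E]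
    {f : ℝ × S → E} (h0 : ∀ q ∉ Ω, f q = 0) :
    ∫ q in Ω, f q ∂(wickMeasure W) = ∫ q, theta W q • f q ∂(measure0 G) := by
  have hθ : AEMeasurable (fun q => ENNReal.ofReal (theta W q)) ((measure0 G).restrict Ω) := by
    refine (ContinuousOn.aemeasurable (fun q hq => ?_) h.isOpen.measurableSet).ennreal_ofReal
    exact (continuousAt_theta W (h.subset hq)).continuousWithinAt
  have hz : ∀ q ∉ Ω, theta W q • f q = 0 := fun q hq => by rw [h0 q hq, smul_zero]
  rw [wickMeasure_restrict W h.isOpen h.subset,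
    integral_withDensity_eq_integral_toReal_smul₀ hθ (by simp),
    ← setIntegral_eq_integral_of_forall_compl_eq_zero hz]
  refine setIntegral_congr_fun h.isOpen.measurableSet fun q hq => ?_
  rw [ENNReal.toReal_ofReal (le_trans (by norm_num) (h.half_le q hq))]

end IsComparable

variable [T2Space S]

theorem locK_eq_zero {A : ℝ × Coord n → Matrix (Fin n) (Fin n) ℂ} {q U : ℝ × Coord n → ℂ}
    {p : ℝ × Coord n} (h : U =ᶠ[𝓝 p] 0) : locK A q U p = 0 := by
  have h1 : fderiv ℝ U =ᶠ[𝓝 p] fun _ => 0 := by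
    have h2 := h.fderiv (𝕜 := ℝ)
    refine h2.trans ?_
    filter_upwards with x
    exact fderiv_const_apply (𝕜 := ℝ) (x := x) (0 : ℂ)
  have h2 : dS U =ᶠ[𝓝 p] fun _ => 0 := h1.mono fun x hx => by simp [dS, hx]
  have h3 : ∀ j k, (fun p => (A p)⁻¹ j k * dX U p k) =ᶠ[𝓝 p] fun _ => 0 := fun j k =>
    h1.mono fun x hx => by simp [dX, hx]
  have h4 : dS (dS U) p = 0 := by rw [dS, h2.fderiv_eq]; simp
  have h5 : ∀ j k, dX (fun p => (A p)⁻¹ j k * dX U p k) p j = 0 := fun j k => by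
    rw [dX, (h3 j k).fderiv_eq]; simp
  have h6 : ∀ k, dX U p k = 0 := fun k => by simp [dX, h1.eq_of_nhds]
  simp [locK, h4, h5, h6, h2.eq_of_nhds, h.eq_of_nhds]

theorem opK_eq_zero (W : HolExtension G) {u : ℝ × S → ℂ} (hu : IsSmooth n u) {q : ℝ × S}
    (hq : q ∉ tsupport u) (hqW : q ∈ W.wickDom) : W.opK u q = 0 := by
  have hs : q ∈ patch n q.2 := mem_extChartAt_source (I := 𝓡 n) q.2
  have ht : (toCoord n q.2 q).2 ∈ (chart q.2).target := (chart (n := n) q.2).map_source hs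
  rw [opK_eq_opKc_self W hu hqW]
  refine locK_eq_zero ?_
  have h2 : ∀ᶠ p in 𝓝 (toCoord n q.2 q), toMfd n q.2 p ∈ (tsupport u)ᶜ :=
    (continuousAt_toMfd ht).eventually
      (by rw [toMfd_toCoord hs]; exact (isClosed_tsupport u).isOpen_compl.mem_nhds hq)
  filter_upwards [h2] with p hp
  exact image_eq_zero_of_notMem_tsupport (f := u) hp

theorem energy_add_right (W : HolExtension G) {v u w : ℝ × S → ℂ} (hu : IsSmooth n u)
    (hw : IsSmooth n w) (q : ℝ × S) : energy W v (u + w) q = energy W v u q + energy W v w q := by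
  have hs : q ∈ patch n q.2 := mem_extChartAt_source (I := 𝓡 n) q.2
  have ht : (toCoord n q.2 q).2 ∈ (chart q.2).target := (chart (n := n) q.2).map_source hs
  have h1 := (contDiffAt_comp_toMfd hu ht).differentiableAt (by simp)
  have h2 := (contDiffAt_comp_toMfd hw ht).differentiableAt (by simp)
  have e : fderiv ℝ ((u + w) ∘ toMfd n q.2) (toCoord n q.2 q) =
      fderiv ℝ (u ∘ toMfd n q.2) (toCoord n q.2 q) +
        fderiv ℝ (w ∘ toMfd n q.2) (toCoord n q.2 q) := fderiv_add h1 h2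
  simp only [energy, locE, dS, dX, e, bil, add_apply, Function.comp_apply, Pi.add_apply,
    mul_add, Finset.sum_add_distrib]
  ring

theorem energy_smul_right (W : HolExtension G) {v u : ℝ × S → ℂ} (hu : IsSmooth n u) (a : ℂ)
    (q : ℝ × S) : energy W v (a • u) q = a * energy W v u q := by
  have hs : q ∈ patch n q.2 := mem_extChartAt_source (I := 𝓡 n) q.2
  have ht : (toCoord n q.2 q).2 ∈ (chart q.2).target := (chart (n := n) q.2).map_source hs
  have h1 := (contDiffAt_comp_toMfd hu ht).differentiableAt (by simp)
  have e : fderiv ℝ ((a • u) ∘ toMfd n q.2) (toCoord n q.2 q) =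
      a • fderiv ℝ (u ∘ toMfd n q.2) (toCoord n q.2 q) := fderiv_const_smul h1 a
  have hb : ∀ (M : Matrix (Fin n) (Fin n) ℂ) (ξ η : Fin n → ℂ),
      bil M ξ (fun j => a * η j) = a * bil M ξ η := fun M ξ η => by
    simp only [bil, Finset.mul_sum]
    refine Finset.sum_congr rfl fun j _ => Finset.sum_congr rfl fun k _ => by ring
  have e' : dX ((a • u) ∘ toMfd n q.2) (toCoord n q.2 q) =
      fun j => a * dX (u ∘ toMfd n q.2) (toCoord n q.2 q) j := by
    funext j
    simp only [dX, e]
    rfl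
  have e'' : dS ((a • u) ∘ toMfd n q.2) (toCoord n q.2 q) =
      a * dS (u ∘ toMfd n q.2) (toCoord n q.2 q) := by
    simp only [dS, e]
    rfl
  simp only [energy, locE, e', e'', hb, Function.comp_apply, Pi.smul_apply, smul_eq_mul]
  ring

/-- A function that is orthogonal to the test functions vanishes. -/
theorem eq_zero_of_weak (W : HolExtension G) {f : ℝ × S → ℂ}
    (hf : ∀ q ∈ W.wickDom, ContinuousAt f q)
    (h : ∀ v ∈ TestFn n W.wickDom, ∫ q, theta W q * (conj (v q) * f q) ∂(measure0 G) = 0) :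
    ∀ q ∈ W.wickDom, f q = 0 := by
  intro q hq
  have h1 := eqOn_zero_of_integral_testFn (G := G) (isOpen_wickDom W)
    (f := fun q => theta W q * f q)
    (fun q hq => ((Complex.continuous_ofReal.continuousAt.comp (continuousAt_theta W hq)).mul
      (hf q hq)).continuousWithinAt) (fun v hv => by simpa only [mul_left_comm] using h v hv) q hq
  exact (mul_eq_zero.1 h1).resolve_left (by exact_mod_cast (theta_pos W hq).ne')

theorem integrable_theta_mul (W : HolExtension G) {v f : ℝ × S → ℂ} (hv : v ∈ TestFn n W.wickDom)
    (hf : ∀ q ∈ W.wickDom, ContinuousAt f q) :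
    Integrable (fun q => theta W q * (conj (v q) * f q)) (measure0 G) := by
  have := integrable_testFn_mul (G := G) hv (f := fun q => theta W q * f q) fun q hq =>
      (Complex.continuous_ofReal.continuousAt.comp (continuousAt_theta W hq)).mul (hf q hq)
  simpa only [mul_left_comm] using this

theorem integrable_theta_energy (W : HolExtension G) {v u : ℝ × S → ℂ}
    (hv : v ∈ TestFn n W.wickDom) (hu : IsSmooth n u) :
    Integrable (fun q => theta W q * energy W v u q) (measure0 G) :=
  integrable_of_zero_off (continuous_of_zero_off (isClosed_tsupport v) (fun q hq =>
      (Complex.continuous_ofReal.continuousAt.comp (continuousAt_theta W hq)).mul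
      (continuousAt_energy W hv.1 hu hq)) (fun q hq => by simp [energy_eq_zero W hq]) hv.2.2)
    hv.2.1 fun q hq => by simp [energy_eq_zero W hq]

/-- The defect of additivity is continuous and orthogonal to all test functions, because the energy
density is additive. The nested derivatives in `opK` need not be expanded. -/
theorem opK_add (W : HolExtension G) {u w : ℝ × S → ℂ} (hu : IsSmooth n u) (hw : IsSmooth n w)
    {q : ℝ × S} (hq : q ∈ W.wickDom) : W.opK (u + w) q = W.opK u q + W.opK w q := by
  have huw : IsSmooth n (u + w) := hu.add hw
  have h := eq_zero_of_weak W (f := fun q => W.opK (u + w) q - (W.opK u q + W.opK w q))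
    (fun q hq => (continuousAt_opK W huw hq).sub
      ((continuousAt_opK W hu hq).add (continuousAt_opK W hw hq))) (fun v hv => ?_) q hq
  · exact sub_eq_zero.1 h
  · have i1 := integrable_theta_mul W hv fun q hq => continuousAt_opK W huw hq
    have i2 := integrable_theta_mul W hv fun q hq => continuousAt_opK W hu hq
    have i3 := integrable_theta_mul W hv fun q hq => continuousAt_opK W hw hq
    have i4 : Integrable (fun q => theta W q * (conj (v q) * W.opK u q) +
        theta W q * (conj (v q) * W.opK w q)) (measure0 G) := i2.add i3
    simp only [mul_sub, mul_add]
    rw [integral_sub i1 i4, integral_add i2 i3,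
      integral_opK_eq W huw v hv, integral_opK_eq W hu v hv, integral_opK_eq W hw v hv,
      ← integral_add (integrable_theta_energy W hv hu) (integrable_theta_energy W hv hw),
      sub_eq_zero]
    congr 1
    funext q
    rw [energy_add_right W hu hw, mul_add]

theorem isSmooth_smul {u : ℝ × S → ℂ} (hu : IsSmooth n u) (a : ℂ) : IsSmooth n (a • u) :=
  (contDiff_const.mul contDiff_id : ContDiff ℝ ∞ fun z : ℂ => a * z).contMDiff.comp hu

theorem opK_smul (W : HolExtension G) {u : ℝ × S → ℂ} (hu : IsSmooth n u) (a : ℂ)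
    {q : ℝ × S} (hq : q ∈ W.wickDom) : W.opK (a • u) q = a * W.opK u q := by
  have hau := isSmooth_smul hu a
  have h := eq_zero_of_weak W (f := fun q => W.opK (a • u) q - a * W.opK u q)
    (fun q hq => (continuousAt_opK W hau hq).sub
      (continuousAt_const.mul (continuousAt_opK W hu hq))) (fun v hv => ?_) q hq
  · exact sub_eq_zero.1 h
  · have i1 := integrable_theta_mul W hv fun q hq => continuousAt_opK W hau hq
    have i2 : Integrable (fun q => theta W q * (conj (v q) * (a * W.opK u q))) (measure0 G) :=
      integrable_theta_mul W hv (f := fun q => a * W.opK u q) fun q hq =>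
        continuousAt_const.mul (continuousAt_opK W hu hq)
    simp only [mul_sub]
    rw [integral_sub i1 i2, integral_opK_eq W hau v hv, sub_eq_zero]
    simp only [energy_smul_right W hu, mul_left_comm _ a]
    rw [integral_const_mul, integral_const_mul, integral_opK_eq W hu v hv]

end Comparison

/-! ### The form on classes of test functions in L². -/

section DirichletForm

variable {n : ℕ} {S : Type*} [TopologicalSpace S] [ChartedSpace (Coord n) S]
  [IsManifold (𝓡 n) ω S] {G : AnalyticKGData n S}
  [SecondCountableTopology S] [MeasurableSpace S] [BorelSpace S] [Nonempty S] [T2Space S]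
  {W : HolExtension G} {Ω : Set (ℝ × S)}

theorem testFn_mono {Ω Ω' : Set (ℝ × S)} (h : Ω ⊆ Ω') {u : ℝ × S → ℂ} (hu : u ∈ TestFn n Ω) :
    u ∈ TestFn n Ω' := ⟨hu.1, hu.2.1, hu.2.2.trans h⟩

theorem testFn_eq_zero {u : ℝ × S → ℂ} (hu : u ∈ TestFn n Ω) {q : ℝ × S} (hq : q ∉ Ω) : u q = 0 :=
  image_eq_zero_of_notMem_tsupport fun h => hq (hu.2.2 h)

theorem IsComparable.memLp (h : IsComparable W Ω) {f : ℝ × S → ℂ} (hf : Continuous f)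
    (hc : HasCompactSupport f) : MemLp f 2 ((wickMeasure W).restrict Ω) := by
  have := h.isLocallyFiniteMeasure
  exact hf.memLp_of_hasCompactSupport hc

/-- K u has no meaning off `W.wickDom`, where the formula may take arbitrary values. The cutoff by Ω
discards them without creating a jump, since K u vanishes off the support of u. -/
theorem continuous_indicator_opK (h : IsComparable W Ω) {u : ℝ × S → ℂ} (hu : u ∈ TestFn n Ω) :
    Continuous (Ω.indicator (W.opK u)) := by
  refine continuous_of_zero_off (O := Ω) (isClosed_tsupport u) (fun q hq => ?_) (fun q hq => ?_)
    hu.2.2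
  · refine (continuousAt_opK W hu.1 (h.subset hq)).congr ?_
    filter_upwards [h.isOpen.mem_nhds hq] with q' hq'
    rw [indicator_of_mem hq']
  · by_cases hqΩ : q ∈ Ω
    · rw [indicator_of_mem hqΩ, opK_eq_zero W hu.1 hq (h.subset hqΩ)]
    · rw [indicator_of_notMem hqΩ]

theorem memLp_indicator_opK (h : IsComparable W Ω) {u : ℝ × S → ℂ} (hu : u ∈ TestFn n Ω) :
    MemLp (Ω.indicator (W.opK u)) 2 ((wickMeasure W).restrict Ω) := by
  refine h.memLp (continuous_indicator_opK h hu) (HasCompactSupport.intro hu.2.1 fun q hq => ?_)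
  by_cases hqΩ : q ∈ Ω
  · rw [indicator_of_mem hqΩ, opK_eq_zero W hu.1 hq (h.subset hqΩ)]
  · rw [indicator_of_notMem hqΩ]

/-- The class of a test function. -/
def testClass (h : IsComparable W Ω) : testSub n Ω →ₗ[ℂ] L2 W Ω where
  toFun u := (h.memLp u.2.1.continuous u.2.2.1).toLp u.1
  map_add' _ _ := rfl
  map_smul' _ _ := rfl

theorem coeFn_testClass (h : IsComparable W Ω) (u : testSub n Ω) :
    testClass h u =ᵐ[(wickMeasure W).restrict Ω] u.1 :=
  (h.memLp u.2.1.continuous u.2.2.1).coeFn_toLp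

/-- A class contains at most one test function, so K and the form are well defined on classes. This
uses continuity and the positivity of the measure on open sets. -/
theorem testFn_eq_of_ae_eq (h : IsComparable W Ω) {u v : ℝ × S → ℂ} (hu : u ∈ TestFn n Ω)
    (hv : v ∈ TestFn n Ω) (huv : u =ᵐ[(wickMeasure W).restrict Ω] v) : u = v := by
  have h1 : u =ᵐ[(measure0 G).restrict Ω] v := h.absolutelyContinuous_measure0.ae_le huv
  have h2 := Measure.eqOn_open_of_ae_eq h1 h.isOpen hu.1.continuous.continuousOn
    hv.1.continuous.continuousOn
  funext q
  by_cases hq : q ∈ Ω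
  · exact h2 hq
  · rw [testFn_eq_zero hu hq, testFn_eq_zero hv hq]

theorem testClass_injective (h : IsComparable W Ω) :
    Function.Injective (testClass (n := n) h) := fun u v huv =>
  Subtype.ext (testFn_eq_of_ae_eq h u.2 v.2
    ((coeFn_testClass h u).symm.trans (by rw [huv]; exact coeFn_testClass h v)))

/-- The operator on test functions, with values in `L²`. -/
def opClass (h : IsComparable W Ω) : testSub n Ω →ₗ[ℂ] L2 W Ω where
  toFun u := (memLp_indicator_opK h u.2).toLp _
  map_add' u v := by
    rw [← MemLp.toLp_add]
    congr 1
    funext q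
    by_cases hq : q ∈ Ω
    · simp only [Pi.add_apply, indicator_of_mem hq]
      exact opK_add W u.2.1 v.2.1 (h.subset hq)
    · simp [indicator_of_notMem hq]
  map_smul' a u := by
    rw [RingHom.id_apply, ← MemLp.toLp_const_smul]
    congr 1
    funext q
    by_cases hq : q ∈ Ω
    · simp only [Pi.smul_apply, indicator_of_mem hq]
      exact opK_smul W u.2.1 a (h.subset hq)
    · simp [indicator_of_notMem hq]

theorem coeFn_opClass (h : IsComparable W Ω) (u : testSub n Ω) :
    opClass h u =ᵐ[(wickMeasure W).restrict Ω] Ω.indicator (W.opK u.1) :=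
  (memLp_indicator_opK h u.2).coeFn_toLp

/-- Test functions and their classes. -/
def testEquiv (h : IsComparable W Ω) : testSub n Ω ≃ₗ[ℂ] LinearMap.range (testClass (n := n) h) :=
  LinearEquiv.ofInjective _ (testClass_injective h)

theorem coe_testEquiv (h : IsComparable W Ω) (u : testSub n Ω) :
    (testEquiv h u : L2 W Ω) = testClass h u := rfl

/-- The operator on the classes of test functions. -/
def opOnClass (h : IsComparable W Ω) : LinearMap.range (testClass (n := n) h) →ₗ[ℂ] L2 W Ω :=
  opClass h ∘ₗ (testEquiv h).symm.toLinearMap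

/-- The form `(v | K u)` on the classes of test functions. -/
def dirichletForm (h : IsComparable W Ω) : SesqForm (L2 W Ω) where
  domain := LinearMap.range (testClass (n := n) h)
  form := LinearMap.mk₂'ₛₗ (starRingEnd ℂ) (RingHom.id ℂ)
    (fun v u => inner ℂ (v : L2 W Ω) (opOnClass h u))
    (fun _ _ _ => by rw [Submodule.coe_add, inner_add_left])
    (fun _ _ _ => by rw [Submodule.coe_smul, inner_smul_left]; rfl)
    (fun _ _ _ => by rw [map_add, inner_add_right])
    (fun _ _ _ => by rw [map_smul, inner_smul_right]; rfl)

theorem dirichletForm_apply (h : IsComparable W Ω) (v u : testSub n Ω) :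
    (dirichletForm h).form (testEquiv h v) (testEquiv h u) =
      ∫ q in Ω, conj (v.1 q) * W.opK u.1 q ∂(wickMeasure W) := by
  have e : opOnClass h (testEquiv h u) = opClass h u := by
    change opClass h ((testEquiv h).symm (testEquiv h u)) = _
    rw [LinearEquiv.symm_apply_apply]
  change inner ℂ (testClass h v) (opOnClass h (testEquiv h u)) = _
  rw [e, L2.inner_def]
  refine integral_congr_ae ?_
  filter_upwards [coeFn_testClass h v, coeFn_opClass h u,
    ae_restrict_mem h.isOpen.measurableSet] with q h1 h2 hq
  rw [h1, h2, indicator_of_mem hq, RCLike.inner_apply, mul_comm]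

theorem integral_opK_eq_energy (h : IsComparable W Ω) {v u : ℝ × S → ℂ} (hv : v ∈ TestFn n Ω)
    (hu : IsSmooth n u) : ∫ q in Ω, conj (v q) * W.opK u q ∂(wickMeasure W) =
      ∫ q, theta W q * energy W v u q ∂(measure0 G) := by
  rw [← integral_opK_eq W hu v (testFn_mono h.subset hv),
    h.integral_wick fun q hq => by rw [testFn_eq_zero hv hq, map_zero, zero_mul]]
  rfl

theorem isDirichletForm_dirichletForm (h : IsComparable W Ω) :
    IsDirichletForm W Ω (dirichletForm h) := by
  refine ⟨fun u hu => h.memLp hu.1.continuous hu.2.1, fun f => ⟨?_, ?_⟩, ?_⟩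
  · rintro ⟨u, rfl⟩
    exact ⟨u.1, u.2, coeFn_testClass h u⟩
  · rintro ⟨u, hu, hf⟩
    exact ⟨⟨u, hu⟩, Lp.ext ((coeFn_testClass h ⟨u, hu⟩).trans hf.symm)⟩
  · intro g f v hv u hu hg hf
    have hg' : g = testEquiv h ⟨v, hv⟩ :=
      Subtype.ext (Lp.ext (hg.trans (coeFn_testClass h ⟨v, hv⟩).symm))
    have hf' : f = testEquiv h ⟨u, hu⟩ :=
      Subtype.ext (Lp.ext (hf.trans (coeFn_testClass h ⟨u, hu⟩).symm))
    refine ⟨?_, by rw [hg', hf', dirichletForm_apply]⟩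
    have h1 : Integrable (fun q => conj (v q) * W.opK u q) ((measure0 G).restrict Ω) :=
      (integrable_testFn_mul (testFn_mono h.subset hv)
        fun q hq => continuousAt_opK W hu.1 hq).restrict
    exact (h1.smul_measure_nnreal (c := 2)).mono_measure h.wick_le

/-- The classes of test functions are dense. -/
theorem dense_testClass (h : IsComparable W Ω) :
    Dense (LinearMap.range (testClass (n := n) h) : Set (L2 W Ω)) := by
  have : LocallyCompactSpace S := ChartedSpace.locallyCompactSpace (Coord n) S
  have := h.isLocallyFiniteMeasure
  rw [Submodule.dense_iff_topologicalClosure_eq_top, Submodule.topologicalClosure_eq_top_iff,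
    Submodule.eq_bot_iff]
  intro f hf
  refine (Lp.eq_zero_iff_ae_eq_zero).2 ?_
  have h1 : ∀ᵐ q ∂((wickMeasure W).restrict Ω), q ∈ Ω → f q = 0 := by
    refine h.isOpen.ae_eq_zero_of_integral_contMDiff_smul_eq_zero (𝓘(ℝ, ℝ).prod (𝓡 n))
      (((Lp.memLp f).locallyIntegrable (by norm_num)).locallyIntegrableOn Ω)
      fun g hg hgc hgN => ?_
    have hmem : (fun q => (g q : ℂ)) ∈ TestFn n Ω := by
      refine ⟨(Complex.ofRealCLM.contDiff (n := ∞)).contMDiff.comp hg,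
        hgc.comp_left (g := Complex.ofReal) Complex.ofReal_zero, ?_⟩
      refine (closure_mono fun q hq => ?_).trans hgN
      exact fun h0 => hq (by simp [h0])
    have h2 := (Submodule.mem_orthogonal _ _).1 hf _ ⟨⟨_, hmem⟩, rfl⟩
    rw [L2.inner_def] at h2
    rw [← h2]
    refine integral_congr_ae ?_
    filter_upwards [coeFn_testClass h ⟨_, hmem⟩] with q hq
    rw [hq, RCLike.inner_apply]
    simp [mul_comm]
  filter_upwards [h1, ae_restrict_mem h.isOpen.measurableSet] with q hq hqΩ using hq hqΩ

theorem norm_testClass_sq (h : IsComparable W Ω) (u : testSub n Ω) :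
    ‖testClass h u‖ ^ 2 = ∫ q, theta W q * ‖u.1 q‖ ^ 2 ∂(measure0 G) := by
  have h1 : ((‖testClass h u‖ ^ 2 : ℝ) : ℂ) = ∫ q in Ω, ((‖u.1 q‖ ^ 2 : ℝ) : ℂ)
      ∂(wickMeasure W) := by
    have := inner_self_eq_norm_sq_to_K (𝕜 := ℂ) (testClass h u)
    rw [L2.inner_def] at this
    push_cast
    refine this.symm.trans (integral_congr_ae ?_)
    filter_upwards [coeFn_testClass h u] with q hq
    rw [hq, inner_self_eq_norm_sq_to_K]
    simp
  rw [integral_complex_ofReal] at h1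
  rw [Complex.ofReal_injective h1, h.integral_wick fun q hq => by
    rw [testFn_eq_zero u.2 hq]; simp]
  rfl

end DirichletForm

/-! ### Coercivity and sectoriality estimates on the tube. -/

section Final

variable {n : ℕ} {S : Type*} [TopologicalSpace S] [ChartedSpace (Coord n) S]
  [IsManifold (𝓡 n) ω S] {G : AnalyticKGData n S}
  [SecondCountableTopology S] [MeasurableSpace S] [BorelSpace S] [Nonempty S] [T2Space S]
  {W : HolExtension G} {V : Set (ℝ × S)} {ε : S → ℝ}

theorem isComparable_tube (hε : Continuous ε) (hg : ∀ y, IsGood W V y (ε y)) :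
    IsComparable W (tube ε) where
  isOpen := isOpen_tube hε
  subset := fun q hq => ((hg q.2).2.2 q.1 hq).1.2
  half_le := fun q hq => ((hg q.2).2.2 q.1 hq).2.1
  le_two := fun q hq => ((hg q.2).2.2 q.1 hq).2.2.1

/-- With k the kinetic density, w = ε⁻²|u|² and ½ ≤ θ ≤ 2, the local bound |E - k| ≤ k/4 + w/64
gives Re θE ≥ 3k/8 - w/32 and |θE| ≤ 5k/2 + w/32. The Poincaré inequality ∫w ≤ 4∫k then leaves 3/8 -
1/8 = 1/4 and 5/2 + 1/8 < 3. -/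
theorem energy_estimate (hε : ContMDiff (𝓡 n) 𝓘(ℝ, ℝ) ∞ ε) (hg : ∀ y, IsGood W V y (ε y))
    {u : ℝ × S → ℂ} (hu : u ∈ TestFn n (tube ε)) :
    1 / 4 * ∫ q, kin G u q ∂(measure0 G) ≤
      (∫ q, theta W q * energy W u u q ∂(measure0 G)).re ∧
    ‖∫ q, theta W q * energy W u u q ∂(measure0 G)‖ ≤ 3 * ∫ q, kin G u q ∂(measure0 G) ∧
    ∫ q, ‖u q‖ ^ 2 ∂(measure0 G) ≤ 4 * ∫ q, kin G u q ∂(measure0 G) := by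
  have h := isComparable_tube hε.continuous hg
  have h0 : ∀ y, 0 < ε y := fun y => (hg y).1
  have hz : ∀ q ∉ tsupport u, u q = 0 := fun q hq => image_eq_zero_of_notMem_tsupport hq
  have hP := poincare (G := G) hε h0 hu
  have huc := hu.1.continuous
  have hic : Continuous fun q : ℝ × S => (ε q.2)⁻¹ :=
    (hε.continuous.comp continuous_snd).inv₀ fun q => (h0 q.2).ne'
  have i1 : Integrable (fun q => ‖u q‖ ^ 2 * ((ε q.2)⁻¹) ^ 2) (measure0 G) :=
    integrable_of_zero_off (by fun_prop) hu.2.1 fun q hq => by simp [hz q hq]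
  have i2 : Integrable (kin G u) (measure0 G) :=
    integrable_of_zero_off (continuous_kin G hu.1) hu.2.1 fun q hq => kin_eq_zero G hu.1 hq
  have i3 : Integrable (fun q => ‖u q‖ ^ 2) (measure0 G) :=
    integrable_of_zero_off (by fun_prop) hu.2.1 fun q hq => by simp [hz q hq]
  have iE := integrable_theta_energy W (testFn_mono h.subset hu) hu.1
  have hpt : ∀ q, 3 / 8 * kin G u q - 1 / 32 * (‖u q‖ ^ 2 * ((ε q.2)⁻¹) ^ 2) ≤
      (theta W q * energy W u u q).re ∧
      ‖theta W q * energy W u u q‖ ≤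
        5 / 2 * kin G u q + 1 / 32 * (‖u q‖ ^ 2 * ((ε q.2)⁻¹) ^ 2) := by
    intro q
    by_cases hq : q ∈ tsupport u
    · obtain ⟨-, h2, h3, h4⟩ := (hg q.2).2.2 q.1 (hu.2.2 hq)
      have h5 := h4 u hu.1
      change 1 / 2 ≤ theta W q at h2
      change theta W q ≤ 2 at h3
      change ‖energy W u u q - kin G u q‖ ≤ kin G u q / 4 +
        1 / 64 * (‖u q‖ ^ 2 * ((ε q.2)⁻¹) ^ 2) at h5
      have hk := kin_nonneg G hu.1 q
      have hn : 0 ≤ ‖u q‖ ^ 2 * ((ε q.2)⁻¹) ^ 2 := by positivity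
      set k := kin G u q
      set w := ‖u q‖ ^ 2 * ((ε q.2)⁻¹) ^ 2
      set E := energy W u u q
      have h6 : k - (k / 4 + 1 / 64 * w) ≤ E.re := by
        have := (Complex.abs_re_le_norm (E - k)).trans h5
        rw [Complex.sub_re, Complex.ofReal_re, abs_le] at this
        linarith
      have h7 : ‖E‖ ≤ k + (k / 4 + 1 / 64 * w) := by
        have := norm_add_le (E - k) (k : ℂ)
        rw [sub_add_cancel, Complex.norm_real, Real.norm_of_nonneg hk] at this
        linarith
      constructor
      · rw [Complex.re_ofReal_mul]
        nlinarith
      · rw [norm_mul, Complex.norm_real, Real.norm_of_nonneg (by linarith)]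
        have := norm_nonneg E
        nlinarith
    · simp [hz q hq, kin_eq_zero G hu.1 hq, energy_eq_zero W hq]
  have hI : 0 ≤ ∫ q, kin G u q ∂(measure0 G) := integral_nonneg fun q => kin_nonneg G hu.1 q
  refine ⟨?_, ?_, ?_⟩
  · have j : Integrable (fun q => 3 / 8 * kin G u q - 1 / 32 * (‖u q‖ ^ 2 * ((ε q.2)⁻¹) ^ 2))
      (measure0 G) := (i2.const_mul _).sub (i1.const_mul _)
    have h1 := integral_mono j iE.re fun q => (hpt q).1
    rw [integral_sub (i2.const_mul _) (i1.const_mul _), integral_const_mul,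
      integral_const_mul] at h1
    have h2 : (∫ q, theta W q * energy W u u q ∂(measure0 G)).re =
      ∫ q, RCLike.re (theta W q * energy W u u q) ∂(measure0 G) := (integral_re iE).symm
    rw [h2]
    linarith
  · have j : Integrable (fun q => 5 / 2 * kin G u q + 1 / 32 * (‖u q‖ ^ 2 * ((ε q.2)⁻¹) ^ 2))
      (measure0 G) := (i2.const_mul _).add (i1.const_mul _)
    have h1 := (norm_integral_le_integral_norm (μ := measure0 G)
      (fun q => theta W q * energy W u u q)).trans
      (integral_mono iE.norm j fun q => (hpt q).2)
    rw [integral_add (i2.const_mul _) (i1.const_mul _), integral_const_mul,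
      integral_const_mul] at h1
    linarith
  · refine le_trans (integral_mono i3 i1 fun q => ?_) hP
    -- Thickness at most 1 makes the weight at least 1.
    have h1 : 1 ≤ (ε q.2)⁻¹ := (one_le_inv₀ (h0 q.2)).2 (hg q.2).2.1
    have h2 : 1 ≤ ((ε q.2)⁻¹) ^ 2 := one_le_pow₀ h1
    exact le_mul_of_one_le_right (sq_nonneg _) h2

theorem h1NormSq_eq {u : ℝ × S → ℂ} (hu : u ∈ TestFn n (tube ε)) :
    h1NormSq G (tube ε) u = ENNReal.ofReal
      (∫ q, kin G u q ∂(measure0 G) + ∫ q, ‖u q‖ ^ 2 ∂(measure0 G)) := by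
  have hz : ∀ q ∉ tsupport u, u q = 0 := fun q hq => image_eq_zero_of_notMem_tsupport hq
  have huc := hu.1.continuous
  have i2 : Integrable (kin G u) (measure0 G) :=
    integrable_of_zero_off (continuous_kin G hu.1) hu.2.1 fun q hq => kin_eq_zero G hu.1 hq
  have i3 : Integrable (fun q => ‖u q‖ ^ 2) (measure0 G) :=
    integrable_of_zero_off (by fun_prop) hu.2.1 fun q hq => by simp [hz q hq]
  have e : ∀ q, h1Density G u q = kin G u q + ‖u q‖ ^ 2 := fun q => by rw [kin]; ring
  have h0 : ∀ q ∉ tube ε, h1Density G u q = 0 := fun q hq => by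
    have hq' : q ∉ tsupport u := fun h => hq (hu.2.2 h)
    rw [e, kin_eq_zero G hu.1 hq', hz q hq']
    simp
  rw [← integral_add i2 i3, h1NormSq]
  simp only [← e]
  have i4 : Integrable (h1Density G u) (measure0 G) := by
    rw [show h1Density G u = fun q => kin G u q + ‖u q‖ ^ 2 from funext e]
    exact i2.add i3
  rw [← setIntegral_eq_integral_of_forall_compl_eq_zero h0,
    ofReal_integral_eq_lintegral_ofReal i4.restrict]
  exact ae_of_all _ fun q => by
    rw [e]
    exact add_nonneg (kin_nonneg G hu.1 q) (sq_nonneg _)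

end Final

/-! ### The closed form, its domain, and the operators. -/

section Closure

variable {n : ℕ} {S : Type*} [TopologicalSpace S] [ChartedSpace (Coord n) S]
  [IsManifold (𝓡 n) ω S] {G : AnalyticKGData n S}
  [SecondCountableTopology S] [MeasurableSpace S] [BorelSpace S] [Nonempty S] [T2Space S]
  {W : HolExtension G} {V : Set (ℝ × S)} {ε : S → ℝ}

theorem dirichletForm_estimate (hε : ContMDiff (𝓡 n) 𝓘(ℝ, ℝ) ∞ ε)
    (hg : ∀ y, IsGood W V y (ε y)) (u : testSub n (tube ε)) :
    1 / 4 * ∫ q, kin G u.1 q ∂(measure0 G) ≤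
      ((dirichletForm (isComparable_tube hε.continuous hg)).form
        (testEquiv (isComparable_tube hε.continuous hg) u)
        (testEquiv (isComparable_tube hε.continuous hg) u)).re ∧
    ‖(dirichletForm (isComparable_tube hε.continuous hg)).form
        (testEquiv (isComparable_tube hε.continuous hg) u)
        (testEquiv (isComparable_tube hε.continuous hg) u)‖ ≤
      3 * ∫ q, kin G u.1 q ∂(measure0 G) := by
  have h1 := energy_estimate hε hg u.2
  rw [dirichletForm_apply, integral_opK_eq_energy (isComparable_tube hε.continuous hg) u.2 u.2.1]
  exact ⟨h1.1, h1.2.1⟩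

theorem norm_testClass_sq_le (hε : ContMDiff (𝓡 n) 𝓘(ℝ, ℝ) ∞ ε)
    (hg : ∀ y, IsGood W V y (ε y)) (u : testSub n (tube ε)) :
    ‖testClass (isComparable_tube hε.continuous hg) u‖ ^ 2 ≤
      8 * ∫ q, kin G u.1 q ∂(measure0 G) := by
  have h := isComparable_tube hε.continuous hg
  have h1 := (energy_estimate hε hg u.2).2.2
  have hz : ∀ q ∉ tsupport u.1, u.1 q = 0 := fun q hq => image_eq_zero_of_notMem_tsupport hq
  have huc := u.2.1.continuous
  have i3 : Integrable (fun q => ‖u.1 q‖ ^ 2) (measure0 G) :=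
    integrable_of_zero_off (by fun_prop) u.2.2.1 fun q hq => by simp [hz q hq]
  have h2 : ∫ q, theta W q * ‖u.1 q‖ ^ 2 ∂(measure0 G) ≤ ∫ q, 2 * ‖u.1 q‖ ^ 2 ∂(measure0 G) := by
    refine integral_mono_of_nonneg (ae_of_all _ fun q => ?_) (i3.const_mul 2)
      (ae_of_all _ fun q => ?_)
    · exact mul_nonneg (Real.sqrt_nonneg _) (sq_nonneg _)
    · by_cases hq : q ∈ tube ε
      · exact mul_le_mul_of_nonneg_right (h.le_two q hq) (sq_nonneg _)
      · simp [testFn_eq_zero u.2 hq]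
  rw [integral_const_mul] at h2
  rw [norm_testClass_sq]
  linarith

/-- By the energy estimates |Q[u]| and the squared H¹ norm bound each other up to constants, so they
have the same Cauchy sequences of test functions. The L² norms for the two measures are equivalent
as ½ ≤ θ ≤ 2, so the limits agree too. -/
theorem isClosure_domain_eq_H10 (hε : ContMDiff (𝓡 n) 𝓘(ℝ, ℝ) ∞ ε)
    (hg : ∀ y, IsGood W V y (ε y)) {Qc : SesqForm (L2 W (tube ε))}
    (hQ : (dirichletForm (isComparable_tube hε.continuous hg)).IsClosure Qc) :
    (Qc.domain : Set (L2 W (tube ε))) = H10 W (tube ε) := by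
  have h := isComparable_tube hε.continuous hg
  have hI : ∀ u : testSub n (tube ε), 0 ≤ ∫ q, kin G u.1 q ∂(measure0 G) := fun u =>
    integral_nonneg fun q => kin_nonneg G u.2.1 q
  have hN : ∀ u : testSub n (tube ε), 0 ≤ ∫ q, ‖u.1 q‖ ^ 2 ∂(measure0 G) := fun u =>
    integral_nonneg fun q => sq_nonneg _
  have hdist : ∀ (t : testSub n (tube ε)) (f : L2 W (tube ε)),
      eLpNorm (fun q => t.1 q - f q) 2 ((wickMeasure W).restrict (tube ε)) =
        edist (testClass h t) f := by
    intro t f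
    rw [Lp.edist_def]
    refine eLpNorm_congr_ae ?_
    filter_upwards [coeFn_testClass h t] with q hq
    simp only [Pi.sub_apply, hq]
  have hC : (2 : ℝ≥0∞) ^ (1 / (2 : ℝ≥0∞)).toReal ≠ ⊤ :=
    ENNReal.rpow_ne_top_of_nonneg (by simp) (by simp)
  ext f
  rw [SetLike.mem_coe, hQ.1 f]
  constructor
  · rintro ⟨u, hu1, hu2⟩
    set t : ℕ → testSub n (tube ε) := fun k => (testEquiv h).symm (u k) with ht
    have hut : ∀ k, u k = testEquiv h (t k) := fun k =>
      ((testEquiv h).apply_symm_apply (u k)).symm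
    refine ⟨fun k => (t k).1, fun k => (t k).2, ?_, ?_⟩
    -- Here 20 = 4 · 5: the squared H¹ norm is ∫ kin + ∫ |u|² ≤ 5 ∫ kin, and ∫ kin ≤ 4 Re Q.
    · have h1 : ∀ q : ℕ × ℕ, h1NormSq G (tube ε) ((t q.1).1 - (t q.2).1) ≤
          ENNReal.ofReal (20 * ‖(dirichletForm h).form (u q.1 - u q.2) (u q.1 - u q.2)‖) := by
        intro q
        have e : u q.1 - u q.2 = testEquiv h (t q.1 - t q.2) := by
          rw [map_sub, ← hut, ← hut]
          rfl
        have h2 := h1NormSq_eq (G := G) (t q.1 - t q.2).2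
        have h3 := (energy_estimate hε hg (t q.1 - t q.2).2).2.2
        have h4 := (dirichletForm_estimate hε hg (t q.1 - t q.2)).1
        have h5 := Complex.re_le_norm ((dirichletForm h).form (testEquiv h (t q.1 - t q.2))
          (testEquiv h (t q.1 - t q.2)))
        rw [e]
        refine h2.le.trans (ENNReal.ofReal_le_ofReal ?_)
        linarith
      have h2 : Tendsto (fun q : ℕ × ℕ => ENNReal.ofReal
          (20 * ‖(dirichletForm h).form (u q.1 - u q.2) (u q.1 - u q.2)‖)) atTop (𝓝 0) := by
        have h3 := (hu2.norm.const_mul 20)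
        rw [norm_zero, mul_zero] at h3
        simpa using ENNReal.tendsto_ofReal h3
      exact tendsto_of_tendsto_of_tendsto_of_le_of_le tendsto_const_nhds h2
        (fun _ => bot_le) h1
    · have h1 : Tendsto (fun k => edist (testClass h (t k)) f) atTop (𝓝 0) := by
        rw [← tendsto_iff_edist_tendsto_0]
        refine hu1.congr fun k => ?_
        rw [hut k]
        rfl
      have h2 : Tendsto (fun k => (2 : ℝ≥0∞) ^ (1 / (2 : ℝ≥0∞)).toReal *
          edist (testClass h (t k)) f) atTop (𝓝 0) := by
        simpa using ENNReal.Tendsto.const_mul h1 (Or.inr hC)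
      refine tendsto_of_tendsto_of_tendsto_of_le_of_le tendsto_const_nhds h2
        (fun _ => bot_le) fun k => ?_
      refine (h.eLpNorm_measure0_le _).trans (le_of_eq ?_)
      rw [hdist]
  · rintro ⟨t, ht, ht1, ht2⟩
    set τ : ℕ → testSub n (tube ε) := fun k => ⟨t k, ht k⟩ with hτ
    refine ⟨fun k => testEquiv h (τ k), ?_, ?_⟩
    · rw [tendsto_iff_edist_tendsto_0]
      have h2 := ENNReal.Tendsto.const_mul (a := (2 : ℝ≥0∞) ^ (1 / (2 : ℝ≥0∞)).toReal) ht2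
        (Or.inr hC)
      rw [mul_zero] at h2
      refine tendsto_of_tendsto_of_tendsto_of_le_of_le tendsto_const_nhds h2
        (fun _ => bot_le) fun k => ?_
      exact (hdist (τ k) f).symm.le.trans (h.eLpNorm_wick_le _)
    · rw [tendsto_zero_iff_norm_tendsto_zero]
      have h2 := (ENNReal.tendsto_toReal ENNReal.zero_ne_top).comp ht1
      have h3 := h2.const_mul 3
      simp only [ENNReal.toReal_zero, mul_zero] at h3
      refine squeeze_zero (fun _ => norm_nonneg _) (fun q => ?_) h3
      have h4 := (dirichletForm_estimate hε hg (τ q.1 - τ q.2)).2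
      have e : testEquiv h (τ q.1 - τ q.2) = testEquiv h (τ q.1) - testEquiv h (τ q.2) :=
        map_sub _ _ _
      have h5 : (h1NormSq G (tube ε) (t q.1 - t q.2)).toReal =
          ∫ p, kin G (τ q.1 - τ q.2).1 p ∂(measure0 G) +
            ∫ p, ‖(τ q.1 - τ q.2).1 p‖ ^ 2 ∂(measure0 G) :=
        (congrArg ENNReal.toReal (h1NormSq_eq (G := G) (τ q.1 - τ q.2).2)).trans
          (ENNReal.toReal_ofReal (add_nonneg (hI (τ q.1 - τ q.2)) (hN (τ q.1 - τ q.2))))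
      simp only [Function.comp_apply]
      rw [h5]
      rw [e] at h4
      refine h4.trans ?_
      have := hN (τ q.1 - τ q.2)
      linarith

theorem exists_wick_domain (W : HolExtension G) {V : Set (ℝ × S)}
    (hV : IsOpen V) (hV0 : ∀ y : S, ((0 : ℝ), y) ∈ V) :
      ∃ Ω : Set (ℝ × S),
        IsOpen Ω ∧ (∀ y : S, ((0 : ℝ), y) ∈ Ω) ∧ Ω ⊆ V ∩ G.dom ∩ W.wickDom ∧
        HasSmoothBoundary n Ω ∧
        (∀ (s : ℝ) (y : S), (s, y) ∈ Ω → (-s, y) ∈ Ω) ∧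
        ∃ Q : SesqForm (L2 W Ω),
          IsDirichletForm W Ω Q ∧
          Dense (Q.domain : Set (L2 W Ω)) ∧
          Q.IsCloseable ∧ Q.adjoint.IsCloseable ∧
          ∃ Qc Qc' : SesqForm (L2 W Ω),
            Q.IsClosure Qc ∧ Q.adjoint.IsClosure Qc' ∧
            Qc.IsClosed ∧ Qc'.IsClosed ∧
            Qc.IsSectorial ∧ Qc'.IsSectorial ∧
            (Qc.domain : Set (L2 W Ω)) = H10 W Ω ∧
            (Qc'.domain : Set (L2 W Ω)) = H10 W Ω ∧
            ∃ K K' : L2 W Ω →ₗ.[ℂ] L2 W Ω,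
              Qc.IsAssociated K ∧ Qc'.IsAssociated K' ∧
              Dense (K.domain : Set (L2 W Ω)) ∧
              Dense (K'.domain : Set (L2 W Ω)) ∧
              K.IsClosed ∧ K'.IsClosed ∧
              (0 : ℂ) ∈ resolventSet K ∧
              (0 : ℂ) ∈ resolventSet K' ∧
              K.adjoint = K' := by
  obtain ⟨ε, hε, hg⟩ := exists_thickness W hV hV0
  have h := isComparable_tube hε.continuous hg
  -- ‖u‖² ≤ 8 ∫ kin and ∫ kin ≤ 4 Re Q give 1/32; |Q| ≤ 3 ∫ kin and the same lower bound give 12.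
  have hest : ∀ u : (dirichletForm h).domain,
      1 / 32 * ‖(u : L2 W (tube ε))‖ ^ 2 ≤ ((dirichletForm h).form u u).re ∧
      ‖(dirichletForm h).form u u‖ ≤ 12 * ((dirichletForm h).form u u).re := by
    intro u
    obtain ⟨t, rfl⟩ := (testEquiv h).surjective u
    have h1 := dirichletForm_estimate hε hg t
    have h2 := norm_testClass_sq_le hε hg t
    rw [coe_testEquiv]
    constructor <;> linarith [h1.1, h1.2]
  obtain ⟨c1, c2, Qc, Qc', d1, d2, d3, d4, d5, d6, d7, d8⟩ :=
    (dirichletForm h).closure_of_coercive (dense_testClass h) (opOnClass h) (fun _ _ => rfl)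
      (a := 1 / 32) (M := 12) (by norm_num) (by norm_num) (fun u => (hest u).1)
      (fun u => (hest u).2)
  have hdom := isClosure_domain_eq_H10 hε hg d1
  refine ⟨tube ε, h.isOpen, fun y => ?_, fun q hq => ((hg q.2).2.2 q.1 hq).1,
    hasSmoothBoundary_tube hε fun y => (hg y).1, fun s y hs => ?_, dirichletForm h,
    isDirichletForm_dirichletForm h, dense_testClass h, c1, c2, Qc, Qc', d1, d2, d3, d4, d5, d6,
    hdom, by rw [d7]; exact hdom, d8⟩
  · change |(0 : ℝ)| < ε y
    rw [abs_zero]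
    exact (hg y).1
  · change |(-s)| < ε y
    rw [abs_neg]
    exact hs

end Closure

/-! ### Complexification of real power series. -/

section Complexification

variable {ι : Type*} [Fintype ι] {E : Type*} [NormedAddCommGroup E] [NormedSpace ℝ E]

/-- The complexification of a multilinear map, restricted to the span of a finite family. -/
def complexifyTerm (b : ι → E) {k : ℕ} (p : ContinuousMultilinearMap ℝ (fun _ : Fin k => E) ℝ) :
    ContinuousMultilinearMap ℂ (fun _ : Fin k => ι → ℂ) ℂ :=
  ∑ i : Fin k → ι, (p (fun l => b (i l)) : ℂ) •
    (ContinuousMultilinearMap.mkPiAlgebra ℂ (Fin k) ℂ).compContinuousLinearMap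
      (fun l => ContinuousLinearMap.proj (i l))

theorem complexifyTerm_apply (b : ι → E) {k : ℕ}
    (p : ContinuousMultilinearMap ℝ (fun _ : Fin k => E) ℝ) (m : Fin k → ι → ℂ) :
    complexifyTerm b p m = ∑ i : Fin k → ι, (p (fun l => b (i l)) : ℂ) * ∏ l, m l (i l) := by
  simp [complexifyTerm]

theorem complexifyTerm_ofReal (b : ι → E) {k : ℕ}
    (p : ContinuousMultilinearMap ℝ (fun _ : Fin k => E) ℝ) (y : ι → ℝ) :
    complexifyTerm b p (fun _ i => (y i : ℂ)) = (p (fun _ => ∑ i, y i • b i) : ℝ) := by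
  classical
  have h : p (fun _ => ∑ i, y i • b i) =
      ∑ i : Fin k → ι, p (fun l => y (i l) • b (i l)) :=
    p.toMultilinearMap.map_sum (fun _ i => y i • b i)
  rw [complexifyTerm_apply, h, Complex.ofReal_sum]
  refine Finset.sum_congr rfl fun i _ => ?_
  rw [p.map_smul_univ (fun l => y (i l)) (fun l => b (i l)), smul_eq_mul, mul_comm]
  push_cast
  rfl

/-- Expanding in the family b produces (card ι)^k terms, each at most ‖p‖ B^k. The growth in k stays
geometric, so a positive radius of convergence survives. -/
theorem norm_complexifyTerm_le (b : ι → E) {B : ℝ} (hB : ∀ i, ‖b i‖ ≤ B) {k : ℕ}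
    (p : ContinuousMultilinearMap ℝ (fun _ : Fin k => E) ℝ) :
    ‖complexifyTerm b p‖ ≤ ‖p‖ * (Fintype.card ι * B) ^ k := by
  have hb : ∀ i : Fin k → ι, ‖p (fun l => b (i l))‖ ≤ ‖p‖ * B ^ k := fun i => by
    refine (p.le_opNorm _).trans (mul_le_mul_of_nonneg_left ?_ (norm_nonneg _))
    refine (Finset.prod_le_prod (fun l _ => norm_nonneg _) fun l _ => hB (i l)).trans ?_
    simp
  have hnn : ∀ i : Fin k → ι, 0 ≤ ‖p‖ * B ^ k := fun i => (norm_nonneg _).trans (hb i)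
  have e : ‖p‖ * (Fintype.card ι * B) ^ k = ∑ i : Fin k → ι, ‖p‖ * B ^ k := by
    simp only [Finset.sum_const, Finset.card_univ, Fintype.card_fun, Fintype.card_fin,
      nsmul_eq_mul]
    push_cast
    ring
  rw [e]
  refine ContinuousMultilinearMap.opNorm_le_bound (Finset.sum_nonneg fun i _ => hnn i) fun m => ?_
  rw [complexifyTerm_apply, Finset.sum_mul]
  refine (norm_sum_le _ _).trans (Finset.sum_le_sum fun i _ => ?_)
  rw [norm_mul, Complex.norm_real, norm_prod]
  exact mul_le_mul (hb i) (Finset.prod_le_prod (fun l _ => norm_nonneg _)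
    fun l _ => norm_le_pi_norm _ _) (Finset.prod_nonneg fun l _ => norm_nonneg _) (hnn i)

/-- A real analytic function has a holomorphic extension to the complexification of the span of a
finite family of vectors. -/
theorem exists_complexification (b : ι → E) {f : E → ℝ} {x₀ : E} (hf : AnalyticAt ℝ f x₀) :
    ∃ F : (ι → ℂ) → ℂ, AnalyticAt ℂ F 0 ∧
      ∀ᶠ y : ι → ℝ in 𝓝 0, F (fun i => (y i : ℂ)) = f (x₀ + ∑ i, y i • b i) := by
  obtain ⟨p, r, hp⟩ := hf
  obtain ⟨C, a, hC, ha, hpa⟩ := p.le_mul_pow_of_radius_pos (hp.r_pos.trans_le hp.r_le)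
  set B : ℝ := ∑ i, ‖b i‖ + 1 with hB
  have hBb : ∀ i, ‖b i‖ ≤ B := fun i =>
    (Finset.single_le_sum (f := fun i => ‖b i‖) (fun _ _ => norm_nonneg _)
      (Finset.mem_univ i)).trans (by linarith)
  have hB0 : 0 < B := by positivity
  set P : FormalMultilinearSeries ℂ (ι → ℂ) ℂ := fun k => complexifyTerm b (p k) with hP
  -- Using card ι + 1 rather than card ι keeps D positive for an empty family.
  set D : ℝ := a * ((Fintype.card ι + 1) * B) with hD
  have hD0 : 0 < D := by positivity
  have hPn : ∀ k, ‖P k‖ ≤ C * D ^ k := fun k => by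
    refine (norm_complexifyTerm_le b hBb (p k)).trans ?_
    have h1 : (Fintype.card ι * B : ℝ) ^ k ≤ ((Fintype.card ι + 1) * B) ^ k := by
      gcongr
      linarith
    rw [hD, mul_pow a, ← mul_assoc C]
    exact mul_le_mul (hpa k) h1 (by positivity) (by positivity)
  have hrad : 0 < P.radius := by
    refine lt_of_lt_of_le ?_ (P.le_radius_of_bound (r := ⟨D⁻¹, by positivity⟩) C fun k => ?_)
    · exact ENNReal.coe_pos.2 (inv_pos.2 hD0)
    · calc ‖P k‖ * (D⁻¹) ^ k ≤ C * D ^ k * (D⁻¹) ^ k := by gcongr; exact hPn k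
        _ = C := by rw [mul_assoc, ← mul_pow, mul_inv_cancel₀ hD0.ne', one_pow, mul_one]
  refine ⟨P.sum, (P.hasFPowerSeriesOnBall hrad).analyticAt, ?_⟩
  have hcont : Continuous fun y : ι → ℝ => ∑ i, y i • b i := by fun_prop
  have hmem : ∀ᶠ y : ι → ℝ in 𝓝 0, ∑ i, y i • b i ∈ Metric.eball (0 : E) r := by
    refine hcont.continuousAt.eventually (Metric.isOpen_eball.mem_nhds ?_)
    simpa using hp.r_pos
  filter_upwards [hmem] with y hy
  have h1 := Complex.hasSum_ofReal.2 (hp.hasSum hy)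
  rw [← h1.tsum_eq, FormalMultilinearSeries.sum]
  exact tsum_congr fun k => complexifyTerm_ofReal b (p k) y

end Complexification

/-! ### Holomorphic extension in time and its uniqueness. -/

section HolomorphicExtension

variable {n : ℕ}

/-- The extension of a real analytic function of `(t, x)` to complex `t`. -/
theorem exists_extension {f : ℝ × Coord n → ℝ} {x₀ : Coord n} (hf : AnalyticAt ℝ f (0, x₀)) :
    ∃ Φ : ℂ × Coord n → ℂ, ∀ᶠ δ : ℝ in 𝓝[>] 0,
      AnalyticOnNhd ℝ Φ (Metric.ball 0 δ ×ˢ Metric.ball x₀ δ) ∧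
      (∀ x ∈ Metric.ball x₀ δ, DifferentiableOn ℂ (fun z => Φ (z, x)) (Metric.ball 0 δ)) ∧
      ∀ t : ℝ, |t| < δ → ∀ x ∈ Metric.ball x₀ δ, Φ ((t : ℂ), x) = f (t, x) := by
  set b : Unit ⊕ Fin n → ℝ × Coord n :=
    Sum.elim (fun _ => (1, 0)) (fun j => (0, stdVec j)) with hb
  obtain ⟨F, hF, hFf⟩ := exists_complexification b hf
  obtain ⟨r, hr, hFr⟩ := hF.exists_ball_analyticOnNhd
  obtain ⟨r', hr', hFr'⟩ := Metric.eventually_nhds_iff_ball.1 hFf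
  -- Only the time coordinate is made complex. The composite F ∘ L is holomorphic in z, and jointly
  -- real analytic as a holomorphic function of a real affine map.
  set L : ℂ × Coord n → (Unit ⊕ Fin n → ℂ) := fun p =>
    Sum.elim (fun _ => p.1) (fun j => ((p.2 - x₀) j : ℝ)) with hL
  have hcoord : ∀ (x : Coord n) (j : Fin n), |(x - x₀) j| ≤ ‖x - x₀‖ := fun x j =>
    PiLp.norm_apply_le (x - x₀) j
  refine ⟨F ∘ L, ?_⟩
  filter_upwards [Ioo_mem_nhdsGT (lt_min hr hr')] with δ hδ
  have hδr : δ < r := hδ.2.trans_le (min_le_left _ _)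
  have hδr' : δ < r' := hδ.2.trans_le (min_le_right _ _)
  have hLmem : ∀ p ∈ Metric.ball (0 : ℂ) δ ×ˢ Metric.ball x₀ δ, L p ∈ Metric.ball 0 r := by
    rintro p ⟨h1, h2⟩
    rw [mem_ball_zero_iff] at h1 ⊢
    rw [mem_ball_iff_norm] at h2
    rw [pi_norm_lt_iff hr]
    rintro (_ | j)
    · exact h1.trans hδr
    · change ‖(((p.2 - x₀) j : ℝ) : ℂ)‖ < r
      rw [Complex.norm_real]
      exact ((hcoord p.2 j).trans_lt h2).trans hδr
  refine ⟨fun p hp => ?_, fun x hx z hz => ?_, fun t ht x hx => ?_⟩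
  · have hLa : ContDiff ℝ ω L := by
      refine contDiff_pi.2 ?_
      rintro (_ | j)
      · exact (contDiff_fst : ContDiff ℝ ω (Prod.fst : ℂ × Coord n → ℂ))
      have h1 : ContDiff ℝ ω fun p : ℂ × Coord n => p.2 - x₀ := contDiff_snd.sub contDiff_const
      exact Complex.ofRealCLM.contDiff.comp (contDiff_euclidean.1 h1 j)
    exact AnalyticAt.comp ((hFr _ (hLmem p hp)).restrictScalars (𝕜 := ℝ)) hLa.contDiffAt.analyticAt
  · have h1 : DifferentiableAt ℂ (fun z => L (z, x)) z := by
      refine differentiableAt_pi.2 ?_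
      rintro (_ | j)
      · exact (differentiableAt_id : DifferentiableAt ℂ (id : ℂ → ℂ) z)
      · exact differentiableAt_const (((x - x₀) j : ℝ) : ℂ)
    exact ((hFr _ (hLmem (z, x) ⟨hz, hx⟩)).differentiableAt.comp z h1).differentiableWithinAt
  · set y : Unit ⊕ Fin n → ℝ := Sum.elim (fun _ => t) (fun j => (x - x₀) j) with hy
    have h1 : L ((t : ℂ), x) = fun i => (y i : ℂ) := by
      funext i
      rcases i with _ | j <;> rfl
    have h2 : y ∈ Metric.ball (0 : Unit ⊕ Fin n → ℝ) r' := by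
      rw [mem_ball_zero_iff, pi_norm_lt_iff hr']
      rw [mem_ball_iff_norm] at hx
      rintro (_ | j)
      · exact lt_trans (by simpa [hy] using ht) hδr'
      · exact ((hcoord x j).trans_lt hx).trans hδr'
    have h3 : ((0 : ℝ), x₀) + ∑ i, y i • b i = (t, x) := by
      rw [Fintype.sum_sum_type]
      refine Prod.ext ?_ ?_
      · simp [hb, hy, Prod.fst_sum]
      · simp only [hb, hy, Sum.elim_inl, Sum.elim_inr, Prod.snd_add, Prod.snd_sum, Prod.smul_mk,
          smul_zero, Finset.sum_const_zero, zero_add, sum_smul_stdVec]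
        abel
    rw [Function.comp_apply, h1, hFr' y h2, h3]

/-- `Φ` is a holomorphic extension of `a` to the disc of radius `ρ`. -/
def IsExt (a : ℝ → ℝ) (ρ : ℝ) (Φ : ℂ → ℂ) : Prop :=
  DifferentiableOn ℂ Φ (Metric.ball 0 ρ) ∧ ∀ t : ℝ, |t| < ρ → Φ t = a t

open Classical in
/-- The holomorphic extension of a real analytic function, to the points where it exists on a disc
around the origin. -/
def holExt (a : ℝ → ℝ) (z : ℂ) : ℂ :=
  if h : ∃ (ρ : ℝ) (Φ : ℂ → ℂ), IsExt a ρ Φ ∧ ‖z‖ < ρ then h.choose_spec.choose z else 0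

/-- Identity theorem on the smaller disc, which is connected: the two extensions agree at real
points, which accumulate at 0. -/
theorem IsExt.unique {a : ℝ → ℝ} {ρ ρ' : ℝ} {Φ Φ' : ℂ → ℂ} (h : IsExt a ρ Φ)
    (h' : IsExt a ρ' Φ') {z : ℂ} (hz : ‖z‖ < ρ) (hz' : ‖z‖ < ρ') : Φ z = Φ' z := by
  set σ := min ρ ρ' with hσ
  have hzσ : ‖z‖ < σ := lt_min hz hz'
  have hσ0 : 0 < σ := (norm_nonneg z).trans_lt hzσ
  have h1 : AnalyticOnNhd ℂ Φ (Metric.ball 0 σ) :=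
    (h.1.mono (Metric.ball_subset_ball (min_le_left _ _))).analyticOnNhd Metric.isOpen_ball
  have h2 : AnalyticOnNhd ℂ Φ' (Metric.ball 0 σ) :=
    (h'.1.mono (Metric.ball_subset_ball (min_le_right _ _))).analyticOnNhd Metric.isOpen_ball
  refine h1.eqOn_of_preconnected_of_frequently_eq h2
    (convex_ball (0 : ℂ) σ).isPreconnected (z₀ := 0) (Metric.mem_ball_self hσ0) ?_
    (by rwa [mem_ball_zero_iff])
  have h3 : Tendsto (fun t : ℝ => (t : ℂ)) (𝓝[≠] 0) (𝓝[≠] 0) := by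
    refine tendsto_nhdsWithin_iff.2 ⟨?_, ?_⟩
    · have : Tendsto (fun t : ℝ => (t : ℂ)) (𝓝 0) (𝓝 ((0 : ℝ) : ℂ)) :=
        Complex.continuous_ofReal.tendsto 0
      rw [Complex.ofReal_zero] at this
      exact this.mono_left nhdsWithin_le_nhds
    · filter_upwards [self_mem_nhdsWithin] with t ht
      simpa using ht
  refine h3.frequently (Eventually.frequently ?_)
  have h4 : ∀ᶠ t : ℝ in 𝓝 0, |t| < σ := by
    have := Metric.ball_mem_nhds (0 : ℝ) hσ0
    filter_upwards [this] with t ht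
    simpa using ht
  filter_upwards [nhdsWithin_le_nhds h4] with t ht
  rw [h.2 t (ht.trans_le (min_le_left _ _)), h'.2 t (ht.trans_le (min_le_right _ _))]

/-- By uniqueness the arbitrary choice in `holExt` is immaterial; any available local extension
computes it. This replaces all gluing. -/
theorem IsExt.holExt_eq {a : ℝ → ℝ} {ρ : ℝ} {Φ : ℂ → ℂ} (h : IsExt a ρ Φ) {z : ℂ}
    (hz : ‖z‖ < ρ) : holExt a z = Φ z := by
  have hex : ∃ (ρ : ℝ) (Φ : ℂ → ℂ), IsExt a ρ Φ ∧ ‖z‖ < ρ := ⟨ρ, Φ, h, hz⟩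
  rw [holExt, dif_pos hex]
  exact hex.choose_spec.choose_spec.1.unique h hex.choose_spec.choose_spec.2 hz

theorem IsExt.mono {a : ℝ → ℝ} {ρ ρ' : ℝ} {Φ : ℂ → ℂ} (h : IsExt a ρ Φ) (hle : ρ' ≤ ρ) :
    IsExt a ρ' Φ :=
  ⟨h.1.mono (Metric.ball_subset_ball hle), fun t ht => h.2 t (ht.trans_le hle)⟩

theorem IsExt.add {a a' : ℝ → ℝ} {ρ : ℝ} {Φ Φ' : ℂ → ℂ} (h : IsExt a ρ Φ) (h' : IsExt a' ρ Φ') :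
    IsExt (fun t => a t + a' t) ρ (fun z => Φ z + Φ' z) :=
  ⟨h.1.add h'.1, fun t ht => by simp only [h.2 t ht, h'.2 t ht]; push_cast; rfl⟩

theorem IsExt.const_mul {a : ℝ → ℝ} {ρ : ℝ} {Φ : ℂ → ℂ} (h : IsExt a ρ Φ) (r : ℝ) :
    IsExt (fun t => r * a t) ρ (fun z => r * Φ z) :=
  ⟨h.1.const_mul _, fun t ht => by simp only [h.2 t ht]; push_cast; rfl⟩

theorem IsExt.sum {κ : Type*} {s : Finset κ} {a : κ → ℝ → ℝ} {ρ : ℝ} {Φ : κ → ℂ → ℂ}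
    (h : ∀ k ∈ s, IsExt (a k) ρ (Φ k)) :
    IsExt (fun t => ∑ k ∈ s, a k t) ρ (fun z => ∑ k ∈ s, Φ k z) :=
  ⟨DifferentiableOn.fun_sum fun k hk => (h k hk).1, fun t ht => by
    push_cast
    exact Finset.sum_congr rfl fun k hk => (h k hk).2 t ht⟩

/-- The function has a holomorphic extension to a disc around the origin that contains `z`. -/
def HasExt (a : ℝ → ℝ) (z : ℂ) : Prop := ∃ (ρ : ℝ) (Φ : ℂ → ℂ), IsExt a ρ Φ ∧ ‖z‖ < ρ

/-- On the smaller of the two discs the sum of extensions extends the sum, and uniqueness identifies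
it. This makes the extended metric bilinear. -/
theorem holExt_add {a a' : ℝ → ℝ} {z : ℂ} (h : HasExt a z) (h' : HasExt a' z) :
    holExt (fun t => a t + a' t) z = holExt a z + holExt a' z := by
  obtain ⟨ρ, Φ, h1, h2⟩ := h
  obtain ⟨ρ', Φ', h1', h2'⟩ := h'
  rw [h1.holExt_eq h2, h1'.holExt_eq h2']
  exact ((h1.mono (min_le_left ρ ρ')).add (h1'.mono (min_le_right ρ ρ'))).holExt_eq (lt_min h2 h2')

theorem holExt_const_mul {a : ℝ → ℝ} {z : ℂ} (h : HasExt a z) (r : ℝ) :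
    holExt (fun t => r * a t) z = r * holExt a z := by
  obtain ⟨ρ, Φ, h1, h2⟩ := h
  rw [h1.holExt_eq h2, (h1.const_mul r).holExt_eq h2]

end HolomorphicExtension

/-! ### Existence of the holomorphic extension of the metric and the potential. -/

section Existence

variable {n : ℕ} {S : Type*} [TopologicalSpace S] [ChartedSpace (Coord n) S]
  [IsManifold (𝓡 n) ω S]

open Classical in
/-- The holomorphic extension of the metric, where it exists. -/
def extForm (G : AnalyticKGData n S) (z : ℂ) (y : S) : Coord n →ₗ[ℝ] Coord n →ₗ[ℝ] ℂ :=
  if h : ∀ v w, HasExt (fun t => formAt (G.metric t) y v w) z then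
    LinearMap.mk₂ ℝ (fun v w => holExt (fun t => formAt (G.metric t) y v w) z)
      (fun v v' w => by
        simp only [map_add, LinearMap.add_apply]
        exact holExt_add (h v w) (h v' w))
      (fun r v w => by
        simp only [map_smul, LinearMap.smul_apply, smul_eq_mul, Complex.real_smul]
        exact holExt_const_mul (h v w) r)
      (fun v w w' => by
        simp only [map_add]
        exact holExt_add (h v w) (h v w'))
      (fun r v w => by
        simp only [map_smul, smul_eq_mul, Complex.real_smul]
        exact holExt_const_mul (h v w) r)
  else 0

/-- The extended metric as a field of forms on the tangent spaces. -/
def extMetric (G : AnalyticKGData n S) (z : ℂ) (y : S) :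
    TangentSpace (𝓡 n) y →ₗ[ℝ] TangentSpace (𝓡 n) y →ₗ[ℝ] ℂ := extForm G z y

/-- Holomorphic extensions of the metric and the potential in a chart, near its center. -/
structure LocalExtension (G : AnalyticKGData n S) (c : S) where
  radius : ℝ
  radius_pos : 0 < radius
  ball_subset : Metric.ball (chart c c) radius ⊆ (chart (n := n) c).target
  matrix : Fin n → Fin n → ℂ × Coord n → ℂ
  matrix_analytic : ∀ j k,
    AnalyticOnNhd ℝ (matrix j k) (Metric.ball 0 radius ×ˢ Metric.ball (chart c c) radius)
  matrix_isExt : ∀ j k, ∀ x ∈ Metric.ball (chart c c) radius,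
    IsExt (fun t => gram (G.metric t) c x j k) radius fun z => matrix j k (z, x)
  potential : ℂ × Coord n → ℂ
  potential_analytic :
    AnalyticOnNhd ℝ potential (Metric.ball 0 radius ×ˢ Metric.ball (chart c c) radius)
  potential_isExt : ∀ x ∈ Metric.ball (chart c c) radius,
    IsExt (fun t => G.potential (t, (chart c).symm x)) radius fun z => potential (z, x)

theorem analyticAt_potential (G : AnalyticKGData n S) (c : S) :
    AnalyticAt ℝ (G.potential ∘ toMfd n c) (0, chart c c) := by
  have hc : chart c c ∈ (chart (n := n) c).target := mem_extChartAt_target c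
  have hG : toMfd n c (0, chart c c) ∈ G.dom := G.zero_mem _
  have h1 := (G.potential_analytic).contMDiffAt (G.isOpen_dom.mem_nhds hG)
  exact (contMDiffAt_iff_contDiffAt.1 (h1.comp _ (contMDiffAt_toMfd hc))).analyticAt

theorem nonempty_localExtension (G : AnalyticKGData n S) (c : S) :
    Nonempty (LocalExtension G c) := by
  have hc : chart c c ∈ (chart (n := n) c).target := mem_extChartAt_target c
  choose Φ hΦ using fun j k => exists_extension
    (G.metric_analytic c j k (0, chart c c) ⟨hc, G.zero_mem _⟩)
  obtain ⟨Ψ, hΨ⟩ := exists_extension (analyticAt_potential G c)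
  obtain ⟨ε, hε, hεc⟩ := Metric.isOpen_iff.1 (isOpen_target (n := n) c) _ hc
  -- `exists_extension` holds for every sufficiently small radius, so the finitely many matrix
  -- entries and the potential share a common one.
  have hall := eventually_all.2 fun j => eventually_all.2 fun k => hΦ j k
  obtain ⟨δ, ⟨h1, h2⟩, h3⟩ := ((hall.and hΨ).and (Ioo_mem_nhdsGT hε)).exists
  exact ⟨{
    radius := δ
    radius_pos := h3.1
    ball_subset := (Metric.ball_subset_ball h3.2.le).trans hεc
    matrix := Φ
    matrix_analytic := fun j k => (h1 j k).1
    matrix_isExt := fun j k x hx => ⟨(h1 j k).2.1 x hx, fun t ht => (h1 j k).2.2 t ht x hx⟩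
    potential := Ψ
    potential_analytic := h2.1
    potential_isExt := fun x hx => ⟨h2.2.1 x hx, fun t ht => h2.2.2 t ht x hx⟩ }⟩

theorem exists_eq_sum_dSymm {c : S} {x : Coord n} (hx : x ∈ (chart c).target) (v : Coord n) :
    ∃ a : Fin n → ℝ, v = ∑ j, a j • dSymm c x (stdVec j) := by
  have hd := det_jac_trans_ne_zero hx (mem_extChartAt_source (I := 𝓡 n) ((chart c).symm x))
  rw [det_jac, ← dSymm_eq hx] at hd
  obtain ⟨u, hu⟩ :=
    (LinearMap.equivOfDetNeZero (dSymm c x : Coord n →ₗ[ℝ] Coord n) hd).surjective v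
  refine ⟨fun j => u j, ?_⟩
  have hu' : dSymm c x u = v := hu
  rw [← hu']
  conv_lhs => rw [← sum_smul_stdVec u]
  simp only [map_sum, map_smul]

namespace LocalExtension

variable {G : AnalyticKGData n S} {c : S} (L : LocalExtension G c)

/-- The determinant of the extended metric. -/
def det (p : ℂ × Coord n) : ℂ := (Matrix.of fun j k => L.matrix j k p).det

/-- The part of `ℂ × S` where the extended metric is nondegenerate. -/
def region : Set (ℂ × S) :=
  {q | q.2 ∈ (chart (n := n) c).source ∧
    (q.1, chart (n := n) c q.2) ∈ Metric.ball (0 : ℂ) L.radius ×ˢ Metric.ball (chart c c) L.radius ∧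
    L.det (q.1, chart (n := n) c q.2) ≠ 0}

theorem continuousOn_det :
    ContinuousOn L.det (Metric.ball 0 L.radius ×ˢ Metric.ball (chart c c) L.radius) := by
  intro p hp
  refine ContinuousAt.continuousWithinAt ?_
  have : ContinuousAt (fun p => (Matrix.of fun j k => L.matrix j k p)) p :=
    continuousAt_pi.2 fun j => continuousAt_pi.2 fun k => (L.matrix_analytic j k p hp).continuousAt
  exact (Continuous.matrix_det continuous_id).continuousAt.comp this

theorem isOpen_region : IsOpen L.region := by
  have h1 : ContinuousOn (fun q : ℂ × S => (q.1, chart (n := n) c q.2))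
      (univ ×ˢ (chart (n := n) c).source) :=
    continuousOn_fst.prodMk ((continuousOn_extChartAt c).comp continuousOn_snd fun q hq => hq.2)
  have h2 := L.continuousOn_det.isOpen_inter_preimage (Metric.isOpen_ball.prod Metric.isOpen_ball)
    (isOpen_compl_singleton (x := (0 : ℂ)))
  have h3 := h1.isOpen_inter_preimage (isOpen_univ.prod (isOpen_source c)) h2
  convert h3 using 1
  ext q
  simp [region, mem_prod, and_assoc]

/-- At z = 0 the extended matrix is the real, positive definite h_0, whose determinant is positive.
-/
theorem center_mem_region : ((0 : ℂ), c) ∈ L.region := by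
  have hb : chart c c ∈ Metric.ball (chart (n := n) c c) L.radius :=
    Metric.mem_ball_self L.radius_pos
  refine ⟨mem_extChartAt_source c, ⟨Metric.mem_ball_self L.radius_pos, hb⟩, ?_⟩
  have h1 : (Matrix.of fun j k => L.matrix j k ((0 : ℂ), chart c c)) =
      (gram (G.metric 0) c (chart c c)).map Complex.ofReal := by
    ext j k
    have := (L.matrix_isExt j k _ hb).2 0 (by simpa using L.radius_pos)
    simpa using this
  have h2 := (gram0_posDef G (p := (0, chart c c)) (mem_extChartAt_target (I := 𝓡 n) c)).det_pos
  change (Matrix.of fun j k => L.matrix j k ((0 : ℂ), chart c c)).det ≠ 0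
  rw [h1]
  have h3 := Complex.ofRealHom.map_det (gram (G.metric 0) c (chart c c))
  intro h4
  refine h2.ne' ?_
  have h5 : ((gram (G.metric 0) c (chart c c)).det : ℂ) = 0 := h3.trans h4
  exact_mod_cast h5

variable {L}

/-- Tangent vectors are real combinations of the coordinate vectors, so the extensions of the matrix
entries combine to an extension, on the same disc, for any pair of vectors. -/
theorem exists_isExt {x : Coord n} (hx : x ∈ Metric.ball (chart c c) L.radius) (v w : Coord n) :
    ∃ Θ, IsExt (fun t => formAt (G.metric t) ((chart c).symm x) v w) L.radius Θ := by
  obtain ⟨a, rfl⟩ := exists_eq_sum_dSymm (L.ball_subset hx) v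
  obtain ⟨b, rfl⟩ := exists_eq_sum_dSymm (L.ball_subset hx) w
  refine ⟨fun z => ∑ j, ((a j : ℝ) : ℂ) * ∑ k, ((b k : ℝ) : ℂ) * L.matrix j k (z, x), ?_⟩
  have h := IsExt.sum (s := Finset.univ) fun j _ =>
    (IsExt.sum (s := Finset.univ) fun k _ => (L.matrix_isExt j k x hx).const_mul (b k)).const_mul
      (a j)
  convert h using 2 with t
  simp only [map_sum, map_smul, LinearMap.sum_apply, LinearMap.smul_apply, smul_eq_mul,
    Finset.mul_sum, gram_eq_formAt]
  rw [Finset.sum_comm]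
  exact Finset.sum_congr rfl fun j _ => Finset.sum_congr rfl fun k _ => by ring

theorem extForm_apply {x : Coord n} (hx : x ∈ Metric.ball (chart c c) L.radius) {z : ℂ}
    (hz : z ∈ Metric.ball (0 : ℂ) L.radius) (v w : Coord n) :
    extForm G z ((chart c).symm x) v w =
      holExt (fun t => formAt (G.metric t) ((chart c).symm x) v w) z := by
  have h : ∀ v w, HasExt (fun t => formAt (G.metric t) ((chart c).symm x) v w) z := fun v w =>
    let ⟨Θ, hΘ⟩ := L.exists_isExt hx v w
    ⟨_, Θ, hΘ, mem_ball_zero_iff.1 hz⟩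
  rw [extForm, dif_pos h, LinearMap.mk₂_apply]

theorem gram_extMetric {x : Coord n} (hx : x ∈ Metric.ball (chart c c) L.radius) {z : ℂ}
    (hz : z ∈ Metric.ball (0 : ℂ) L.radius) (j k : Fin n) :
    gram (extMetric G z) c x j k = L.matrix j k (z, x) :=
  (extForm_apply hx hz _ _).trans ((L.matrix_isExt j k x hx).holExt_eq (mem_ball_zero_iff.1 hz))

theorem differentiableAt_extForm {z : ℂ} {y : S} (h : (z, y) ∈ L.region) (v w : Coord n) :
    DifferentiableAt ℂ (fun z => extForm G z y v w) z := by
  obtain ⟨hy, ⟨hz, hx⟩, -⟩ := h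
  simp only at hy hz hx
  obtain ⟨Θ, hΘ⟩ := L.exists_isExt hx v w
  have hb := Metric.isOpen_ball.mem_nhds hz
  refine (hΘ.1.differentiableAt hb).congr_of_eventuallyEq ?_
  filter_upwards [hb] with z' hz'
  rw [← (chart c).left_inv hy, extForm_apply hx hz']
  exact hΘ.holExt_eq (mem_ball_zero_iff.1 hz')

theorem extForm_ofReal {t : ℝ} {y : S} (h : ((t : ℂ), y) ∈ L.region) (v w : Coord n) :
    extForm G t y v w = formAt (G.metric t) y v w := by
  obtain ⟨hy, ⟨hz, hx⟩, -⟩ := h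
  simp only at hy hz hx
  obtain ⟨Θ, hΘ⟩ := L.exists_isExt hx v w
  have ht : ‖(t : ℂ)‖ < L.radius := mem_ball_zero_iff.1 hz
  rw [← (chart c).left_inv hy, extForm_apply hx hz, hΘ.holExt_eq ht]
  exact hΘ.2 t (by simpa using ht)

/-- In a chart other than c the components are those of c multiplied by Jacobian entries of the
transition map, which are real analytic because the manifold is. -/
theorem analyticAt_gram_extMetric {c' : S} {p : ℂ × Coord n} (hp : p.2 ∈ (chart c').target)
    (h : (p.1, (chart c').symm p.2) ∈ L.region) (j k : Fin n) :
    AnalyticAt ℝ (fun p : ℂ × Coord n => gram (extMetric G p.1) c' p.2 j k) p := by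
  obtain ⟨hy, hzx, -⟩ := h
  simp only at hy hzx
  have hτ : AnalyticAt ℝ (trans c' c) p.2 := (contDiffAt_trans hp hy).analyticAt
  have hJ : ∀ l m, AnalyticAt ℝ (fun p : ℂ × Coord n => jac (trans c' c) p.2 l m) p := by
    intro l m
    have h1 : AnalyticAt ℝ (fun x => jac (trans c' c) x l m) p.2 :=
      (contDiffAt_euclidean.1 (hτ.fderiv.contDiffAt (n := ω) |>.clm_apply contDiffAt_const)
        l).analyticAt
    exact AnalyticAt.fun_comp h1 analyticAt_snd
  have hT : AnalyticAt ℝ (fun p : ℂ × Coord n => (p.1, trans c' c p.2)) p :=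
    analyticAt_fst.prod (AnalyticAt.fun_comp hτ analyticAt_snd)
  have hM : ∀ l m, AnalyticAt ℝ (fun p : ℂ × Coord n => L.matrix l m (p.1, trans c' c p.2)) p :=
    fun l m => AnalyticAt.fun_comp (g := L.matrix l m) (L.matrix_analytic l m _ hzx) hT
  have hF : AnalyticAt ℝ (fun p : ℂ × Coord n => ∑ l, ∑ m, jac (trans c' c) p.2 l j •
      jac (trans c' c) p.2 m k • L.matrix l m (p.1, trans c' c p.2)) p :=
    Finset.analyticAt_fun_sum _ fun l _ => Finset.analyticAt_fun_sum _ fun m _ =>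
      (hJ l j).smul ((hJ m k).smul (hM l m))
  refine hF.congr ?_
  have hzx' := hT.continuousAt.eventually
    ((Metric.isOpen_ball.prod Metric.isOpen_ball).mem_nhds hzx)
  filter_upwards [hzx', continuousAt_snd.eventually (eventually_mem_overlap hp hy)] with q h1 h2
  rw [gram_eq_sum _ h2.1 h2.2]
  simp only [gram_extMetric h1.2 h1.1]

theorem det_gram_extMetric_ne_zero {z : ℂ} {y : S} (h : (z, y) ∈ L.region) :
    (gram (extMetric G z) y (chart y y)).det ≠ 0 := by
  obtain ⟨hy, ⟨hz, hx⟩, hd⟩ := h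
  simp only at hy hz hx hd
  have hyt : chart y y ∈ (chart (n := n) y).target := mem_extChartAt_target y
  have hs : (chart y).symm (chart (n := n) y y) = y := extChartAt_to_inv y
  have hys : (chart y).symm (chart (n := n) y y) ∈ (chart (n := n) c).source := by rwa [hs]
  have hτ : trans y c (chart (n := n) y y) = chart c y := by rw [trans, hs]
  have hm : gram (extMetric G z) c (chart c y) =
      Matrix.of fun j k => L.matrix j k (z, chart c y) := by
    ext j k
    exact gram_extMetric hx hz j k
  have hJ : ((jac (trans y c) (chart (n := n) y y)).map Complex.ofReal).det ≠ 0 := by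
    have h3 := Complex.ofRealHom.map_det (jac (trans y c) (chart (n := n) y y))
    intro h4
    refine det_jac_trans_ne_zero hyt hys ?_
    have h5 : ((jac (trans y c) (chart (n := n) y y)).det : ℂ) = 0 := h3.trans h4
    exact_mod_cast h5
  rw [gram_complex_eq _ hyt hys, hτ, hm, Matrix.det_mul, Matrix.det_mul, Matrix.det_transpose]
  exact mul_ne_zero (mul_ne_zero hJ hd) hJ

theorem holExt_potential {z : ℂ} {y : S} (hy : y ∈ (chart (n := n) c).source)
    (h : (z, chart (n := n) c y) ∈
      Metric.ball (0 : ℂ) L.radius ×ˢ Metric.ball (chart c c) L.radius) :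
    holExt (fun t => G.potential (t, y)) z = L.potential (z, chart c y) := by
  have := (L.potential_isExt _ h.2).holExt_eq (mem_ball_zero_iff.1 h.1)
  rwa [(chart c).left_inv hy] at this

theorem differentiableAt_potential {z : ℂ} {y : S} (h : (z, y) ∈ L.region) :
    DifferentiableAt ℂ (fun z => holExt (fun t => G.potential (t, y)) z) z := by
  obtain ⟨hy, ⟨hz, hx⟩, -⟩ := h
  simp only at hy hz hx
  have hb := Metric.isOpen_ball.mem_nhds hz
  refine ((L.potential_isExt _ hx).1.differentiableAt hb).congr_of_eventuallyEq ?_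
  filter_upwards [hb] with z' hz'
  exact holExt_potential hy ⟨hz', hx⟩

theorem potential_ofReal {t : ℝ} {y : S} (h : ((t : ℂ), y) ∈ L.region) :
    holExt (fun t => G.potential (t, y)) t = G.potential (t, y) := by
  obtain ⟨hy, ⟨hz, hx⟩, -⟩ := h
  simp only at hy hz hx
  have ht : |t| < L.radius := by simpa using hz
  have := (L.potential_isExt _ hx).2 t ht
  rw [(chart c).left_inv hy] at this
  exact (holExt_potential hy ⟨hz, hx⟩).trans this

theorem contMDiffAt_potential {q : ℂ × S} (h : q ∈ L.region) :
    ContMDiffAt (𝓘(ℝ, ℂ).prod (𝓡 n)) 𝓘(ℝ, ℂ) ω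
      (fun q : ℂ × S => holExt (fun t => G.potential (t, q.2)) q.1) q := by
  obtain ⟨hy, hzx, -⟩ := id h
  have h1 : ContMDiffAt (𝓡 n) 𝓘(ℝ, Coord n) ω (chart (n := n) c) q.2 :=
    contMDiffAt_extChartAt' (by rwa [← extChartAt_source (𝓡 n)])
  have h2 : ContMDiffAt (𝓘(ℝ, ℂ).prod (𝓡 n)) 𝓘(ℝ, ℂ × Coord n) ω
      (fun q : ℂ × S => (q.1, chart (n := n) c q.2)) q :=
    contMDiffAt_fst.prodMk_space (h1.comp q contMDiffAt_snd)
  have h3 : ContMDiffAt 𝓘(ℝ, ℂ × Coord n) 𝓘(ℝ, ℂ) ω L.potential (q.1, chart (n := n) c q.2) :=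
    (L.potential_analytic _ hzx).contDiffAt.contMDiffAt
  refine (h3.comp q h2).congr_of_eventuallyEq ?_
  filter_upwards [L.isOpen_region.mem_nhds h] with q' hq'
  exact holExt_potential hq'.1 hq'.2.1

end LocalExtension

/-- A real analytic metric and potential have holomorphic extensions in the time variable. -/
theorem nonempty_holExtension (G : AnalyticKGData n S) : Nonempty (HolExtension G) := by
  let L : ∀ c, LocalExtension G c := fun c => (nonempty_localExtension G c).some
  -- The extended metric and potential are defined globally through `holExt`, so each property is
  -- checked at a point in any one local extension containing it, with no compatibility between
  -- charts to verify.
  have mem : ∀ q ∈ ⋃ c, (L c).region, ∃ c, q ∈ (L c).region := fun q hq => mem_iUnion.1 hq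
  exact ⟨{
    dom := ⋃ c, (L c).region
    isOpen_dom := isOpen_iUnion fun c => (L c).isOpen_region
    zero_mem := fun y => mem_iUnion.2 ⟨y, (L y).center_mem_region⟩
    metric := extMetric G
    metric_holomorphic := fun y v w z hz =>
      let ⟨_, hc⟩ := mem _ hz
      (LocalExtension.differentiableAt_extForm hc v w).differentiableWithinAt
    metric_analytic := fun c j k p hp =>
      let ⟨_, hc⟩ := mem _ hp.2
      LocalExtension.analyticAt_gram_extMetric hp.1 hc j k
    metric_extends := fun t y _ h v w =>
      let ⟨_, hc⟩ := mem _ h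
      LocalExtension.extForm_ofReal hc v w
    metric_nondegenerate := fun z y h =>
      let ⟨_, hc⟩ := mem _ h
      LocalExtension.det_gram_extMetric_ne_zero hc
    potential := fun q => holExt (fun t => G.potential (t, q.2)) q.1
    potential_holomorphic := fun y z hz =>
      let ⟨_, hc⟩ := mem _ hz
      (LocalExtension.differentiableAt_potential hc).differentiableWithinAt
    potential_analytic := fun q hq =>
      let ⟨_, hc⟩ := mem _ hq
      (LocalExtension.contMDiffAt_potential hc).contMDiffWithinAt
    potential_extends := fun t y _ h =>
      let ⟨_, hc⟩ := mem _ h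
      LocalExtension.potential_ofReal hc }⟩

end Existence

end WickRotation

end

theorem mainTheorem7 {n : ℕ} {S : Type*} [TopologicalSpace S]
    [ChartedSpace (WickRotation.Coord n) S] [IsManifold (𝓡 n) ω S]
    [T2Space S] [SecondCountableTopology S] [Nonempty S] [MeasurableSpace S] [BorelSpace S]
    (G : WickRotation.AnalyticKGData n S) :
    Nonempty (WickRotation.HolExtension G) ∧
    ∀ (W : WickRotation.HolExtension G) (V : Set (ℝ × S)),
      IsOpen V → (∀ y : S, ((0 : ℝ), y) ∈ V) →
      ∃ Ω : Set (ℝ × S),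
        IsOpen Ω ∧ (∀ y : S, ((0 : ℝ), y) ∈ Ω) ∧ Ω ⊆ V ∩ G.dom ∩ W.wickDom ∧
        WickRotation.HasSmoothBoundary n Ω ∧
        (∀ (s : ℝ) (y : S), (s, y) ∈ Ω → (-s, y) ∈ Ω) ∧
        ∃ Q : WickRotation.SesqForm (WickRotation.L2 W Ω),
          WickRotation.IsDirichletForm W Ω Q ∧
          Dense (Q.domain : Set (WickRotation.L2 W Ω)) ∧
          Q.IsCloseable ∧ Q.adjoint.IsCloseable ∧
          ∃ Qc Qc' : WickRotation.SesqForm (WickRotation.L2 W Ω),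
            Q.IsClosure Qc ∧ Q.adjoint.IsClosure Qc' ∧
            Qc.IsClosed ∧ Qc'.IsClosed ∧
            Qc.IsSectorial ∧ Qc'.IsSectorial ∧
            (Qc.domain : Set (WickRotation.L2 W Ω)) = WickRotation.H10 W Ω ∧
            (Qc'.domain : Set (WickRotation.L2 W Ω)) = WickRotation.H10 W Ω ∧
            ∃ K K' : WickRotation.L2 W Ω →ₗ.[ℂ] WickRotation.L2 W Ω,
              Qc.IsAssociated K ∧ Qc'.IsAssociated K' ∧
              Dense (K.domain : Set (WickRotation.L2 W Ω)) ∧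
              Dense (K'.domain : Set (WickRotation.L2 W Ω)) ∧
              K.IsClosed ∧ K'.IsClosed ∧
              (0 : ℂ) ∈ WickRotation.resolventSet K ∧
              (0 : ℂ) ∈ WickRotation.resolventSet K' ∧
              K.adjoint = K' := by
  exact ⟨WickRotation.nonempty_holExtension G, fun W _ hV hV0 =>
    WickRotation.exists_wick_domain W hV hV0⟩
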